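/- **Setting.** Let $\lambda$ be the security parameter. A function of $\lambda$ is *negligible* if it vanishes faster than every inverse polynomial. A *PPT algorithm* is a probabilistic program that, on input $(1^\lambda,x)$, always halts within a number of steps polynomial in $\lambda+|x|$. A family of distributions is *efficiently samplable* if some PPT algorithm, on input $1^\lambda$, samples it up to negligible statistical distance. *LWE parameters.* For each $\lambda$ let $n,q,p,d_0$ be natural numbers with $q,p\ge 1$ and let $\sigma>0$ be real (all depending on $\lambda$). Assume that $n,q,p,d_0$ are computable in polynomial time from $1^\lambda$, and that $n,d_0$ are polynomially bounded. Let $\chi_e$ be the discrete Gaussian on $\mathbb Z$ with $\Pr[x]\propto e^{-x^2/(2\sigma^2)}$, reduced mod $q$ and assumed to be efficiently samplable, and let $\chi_s$ be the uniform distribution on $\{0,1\}^n$. The LWE parameters are *secure* if for every PPT algorithm $\mathcal B$ the difference $$\bigl|\Pr[\mathcal B(1^\lambda,A,As+e)=1]-\Pr[\mathcal B(1^\lambda,A,u)=1]\bigr|$$ is negligible, where $A\in\mathbb Z_q^{d_0\times n}$ and $u\in\mathbb Z_q^{d_0}$ are uniform, $s\leftarrow\chi_s$, $e\leftarrow\chi_e^{d_0}$.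 *Paillier parameters.* Key generation is an efficiently samplable distribution on pairs of distinct primes $P,Q$ with $\gcd(PQ,(P-1)(Q-1))=1$. The public key is $m=PQ$; encryption is $\mathrm{Enc}(\mu)=(1+m)^{\mu}r^{m}\bmod m^2$ with $r\leftarrow\mathbb Z_m^*$ uniform; decryption is $\mathrm{Dec}(c)=L(c^{\Lambda}\bmod m^2)\cdot\Lambda^{-1}\bmod m$ with $\Lambda=\mathrm{lcm}(P-1,Q-1)$ and $L(u)=\lfloor (u-1)/m\rfloor$, with $L(0)=0$ (and is applied to every $c\in\mathbb Z_{m^2}$). The parameters are *secure* if the scheme is IND-CPA secure against PPT adversaries and, for some $\ell(\lambda)$ with $2^{-\ell(\lambda)}$ negligible, both primes always have at least $\ell(\lambda)$ bits. *Protocol ZipPIR.* A public matrix $A\in\mathbb Z_q^{d_0\times n}$ is uniform. $\mathrm{Setup}(1^\lambda)$ generates a Paillier key, samples $\mathsf{ck}_r\in\mathbb Z_{m^2}^{n}$ uniformly, sets $\mathsf{pt}_r=\mathrm{Dec}(\mathsf{ck}_r)$ entrywise, keeps the secret key and $\mathsf{pt}_r$, and outputs the hint request $q_h=(m,\mathsf{ck}_r)$.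 $\mathrm{Query}(i,\mathsf{pt}_r)$ samples $s\leftarrow\{0,1\}^n$ and $e\leftarrow\chi_e^{d_0}$ and outputs $\mathsf{qu}=(\mathsf{ck}_o,\mathsf{qu}_0)$ with $\mathsf{ck}_o=s-\mathsf{pt}_r\bmod m$ and $\mathsf{qu}_0=As+e+\Delta u_i\bmod q$, where $u_i$ is the $i$-th unit vector and $\Delta=\lfloor q/p\rceil$. **Theorem (ZipPIR security).** Assume that the LWE parameters and the Paillier parameters are secure. Then for every PPT adversary $\mathcal A$ there is a negligible function $\epsilon$ such that for all $\lambda$ and all $i,j\in[d_0(\lambda)]$, $$\Bigl|\Pr\bigl[\mathcal A(1^\lambda,A,q_h,\mathsf{qu})=1 : \mathsf{qu}\leftarrow\mathrm{Query}(i,\mathsf{pt}_r)\bigr]-\Pr\bigl[\mathcal A(1^\lambda,A,q_h,\mathsf{qu})=1 : \mathsf{qu}\leftarrow\mathrm{Query}(j,\mathsf{pt}_r)\bigr]\Bigr|<\epsilon(\lambda),$$ where in both probabilities $A$ is uniform and $(\mathsf{pt}_r,q_h)$ comes from $\mathrm{Setup}(1^\lambda)$. -/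

import Mathlib

open Filter Asymptotics

noncomputable section

namespace ZipPIR

/-! ## Probabilistic polynomial-time algorithms

A register machine whose registers are stacks of natural numbers, with structured control flow,
arithmetic at logarithmic cost, and uniform sampling.  Two stacks simulate the tape of a Turing
machine.  Every instruction is charged at least the bit length of the numbers it touches, and the
arithmetic operations on `n`-bit numbers are polynomial-time on a Turing machine, so polynomial
time here is polynomial time on Turing machines. -/

/-- Arithmetic operations (`sub` is truncated; `div` and `mod` round as for natural numbers). -/
inductive Op
  | add | sub | mul | div | mod

def Op.eval : Op → ℕ → ℕ → ℕ
  | .add, x, y => x + y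
  | .sub, x, y => x - y
  | .mul, x, y => x * y
  | .div, x, y => x / y
  | .mod, x, y => x % y

/-- Programs.  `push a v` pushes the constant `v` on stack `a`; `pop a` removes the top of `a`;
`copy a b` pushes the top of `a` on `b`; `isNil a b` pushes `1` on `b` if `a` is empty and `0`
otherwise; `arith o a b c` pushes `o (top a) (top b)` on `c`; `unif a b` pushes on `b` a fresh
uniformly random element of `{0, …, top a - 1}`; `ite a c d` runs `c` if the top of `a` is nonzero
and `d` otherwise; `while a c` repeats `c` as long as the top of `a` is nonzero. -/
inductive Cmd
  | skip
  | push (a v : ℕ)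
  | pop (a : ℕ)
  | copy (a b : ℕ)
  | isNil (a b : ℕ)
  | arith (o : Op) (a b c : ℕ)
  | unif (a b : ℕ)
  | seq (c d : Cmd)
  | ite (a : ℕ) (c d : Cmd)
  | while (a : ℕ) (c : Cmd)

/-- The contents of all stacks; the head of a list is the top of the stack. -/
abbrev State := ℕ → List ℕ

/-- The top of a stack (`0` for the empty stack). -/
def State.top (s : State) (a : ℕ) : ℕ := (s a).headD 0

/-- Push `v` on stack `a`. -/
def State.push (s : State) (a v : ℕ) : State := Function.update s a (v :: s a)

/-- A result is `none` if the time budget was exceeded, and otherwise the final state together with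
the remaining budget. -/
abbrev Result := Option (State × ℕ)

/-- Charge `cost` to the budget `t` and continue in state `s`. -/
def pay (cost t : ℕ) (s : State) : Result := if cost ≤ t then some (s, t - cost) else none

/-- Continue a computation that has not exceeded its budget. -/
def andThen (f : ℕ → State → PMF Result) : Result → PMF Result
  | none => PMF.pure none
  | some (s, t) => f t s

/-- The uniform distribution on `{0, …, v - 1}` (and the constant `0` for `v = 0`). -/
def unifBelow (v : ℕ) : PMF ℕ :=
  if h : (Finset.range v).Nonempty then PMF.uniformOfFinset (Finset.range v) h else PMF.pure 0

/-- Iterate `body` as long as the top of `a` is nonzero; each test costs one unit of time.  The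
first numeric argument bounds the number of tests. -/
def loop (body : ℕ → State → PMF Result) (a : ℕ) : ℕ → ℕ → State → PMF Result
  | 0, _, _ => PMF.pure none
  | fuel + 1, t, s =>
      if t = 0 then PMF.pure none
      else if s.top a = 0 then PMF.pure (some (s, t - 1))
      else (body (t - 1) s).bind (andThen (loop body a fuel))

/-- `exec c t s` runs the program `c` with time budget `t` from the state `s`. -/
def exec : Cmd → ℕ → State → PMF Result
  | .skip, t, s => PMF.pure (pay 1 t s)
  | .push a v, t, s => PMF.pure (pay (1 + v.size) t (s.push a v))
  | .pop a, t, s => PMF.pure (pay 1 t (Function.update s a (s a).tail))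
  | .copy a b, t, s => PMF.pure (pay (1 + (s.top a).size) t (s.push b (s.top a)))
  | .isNil a b, t, s => PMF.pure (pay 1 t (s.push b (if (s a).isEmpty then 1 else 0)))
  | .arith o a b c, t, s =>
      PMF.pure (pay (1 + (s.top a).size + (s.top b).size) t
        (s.push c (o.eval (s.top a) (s.top b))))
  | .unif a b, t, s =>
      (unifBelow (s.top a)).map fun r => pay (1 + (s.top a).size) t (s.push b r)
  | .seq c d, t, s => (exec c t s).bind (andThen (exec d))
  | .ite a c d, t, s =>
      if t = 0 then PMF.pure none
      else if s.top a = 0 then exec d (t - 1) s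
      else exec c (t - 1) s
  -- a test costs at least one unit, so `t + 1` tests suffice to use up the budget `t`
  | .while a c, t, s => loop (exec c) a (t + 1) t s

/-- The bit length of a list of natural numbers, with one separator per entry. -/
def bitSize (x : List ℕ) : ℕ := (x.map fun v => v.size + 1).sum

/-- Initial state: the input on stack `0`, the security parameter on stack `1`. -/
def init (κ : ℕ) (x : List ℕ) : State :=
  fun a => if a = 0 then x else if a = 1 then [κ] else []

/-- A probabilistic polynomial-time algorithm with input `(1^κ, x)`: a single program which, for
all `κ` and `x` and all random choices, halts within a number of steps that is polynomial in
`κ` plus the length of `x`. -/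
structure PPT where
  prog : Cmd
  bound : Polynomial ℕ
  halts : ∀ (κ : ℕ) (x : List ℕ),
    none ∉ (exec prog (bound.eval (κ + bitSize x)) (init κ x)).support

/-- The output distribution on input `(1^κ, x)`: the final contents of stack `0`. -/
def PPT.run (M : PPT) (κ : ℕ) (x : List ℕ) : PMF (List ℕ) :=
  (exec M.prog (M.bound.eval (κ + bitSize x)) (init κ x)).map fun r =>
    match r with
    | none => []
    | some (s, _) => s 0

/-- `Pr[𝒜(1^κ, x) = 1 | x ← D]`: the output is `1` if its first entry is `1`. -/
def PPT.prOne (M : PPT) (κ : ℕ) (D : PMF (List ℕ)) : ℝ :=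
  ((D.bind (M.run κ)).toOuterMeasure {y | y.head? = some 1}).toReal

/-- A function of the security parameter that vanishes faster than every inverse polynomial. -/
def Negligible (f : ℕ → ℝ) : Prop := SuperpolynomialDecay atTop (fun κ : ℕ => (κ : ℝ)) f

/-- `f(κ)` can be computed (in binary) in polynomial time from `1^κ`. -/
def PolyTimeComputable (f : ℕ → ℕ) : Prop :=
  ∃ M : PPT, ∀ κ, M.run κ [] = PMF.pure [f κ]

def PolyBounded (f : ℕ → ℕ) : Prop := ∃ P : Polynomial ℕ, ∀ κ, f κ ≤ P.eval κ

/-- The distributions `D κ` can be sampled in polynomial time from `1^κ`, up to a negligible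
statistical distance. -/
def EfficientlySamplable (D : ℕ → PMF (List ℕ)) : Prop :=
  ∃ M : PPT, ∃ ε : ℕ → ℝ, Negligible ε ∧ ∀ (κ : ℕ) (S : Set (List ℕ)),
    |((M.run κ []).toOuterMeasure S).toReal - ((D κ).toOuterMeasure S).toReal| ≤ ε κ

/-! ## Distributions and encodings -/

/-- The weight of `x` under the discrete Gaussian. -/
def gaussianWeight (σ : ℝ) (x : ℤ) : ENNReal :=
  ENNReal.ofReal (Real.exp (-(x : ℝ) ^ 2 / (2 * σ ^ 2)))

theorem gaussianWeight_tsum_ne_zero (σ : ℝ) : ∑' x : ℤ, gaussianWeight σ x ≠ 0 := by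
  intro h
  have h0 := ENNReal.tsum_eq_zero.1 h 0
  simp [gaussianWeight] at h0

theorem gaussianWeight_tsum_ne_top {σ : ℝ} (hσ : 0 < σ) :
    ∑' x : ℤ, gaussianWeight σ x ≠ ⊤ := by
  have hc : -(1 / (2 * σ ^ 2)) < 0 := by
    have : 0 < 1 / (2 * σ ^ 2) := by positivity
    linarith
  have hn : Summable fun n : ℕ => Real.exp (-((n : ℤ) : ℝ) ^ 2 / (2 * σ ^ 2)) := by
    have h := Real.summable_exp_nat_mul_of_ge hc (f := fun n : ℕ => (n : ℝ) ^ 2) (fun n => by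
      rcases Nat.eq_zero_or_pos n with rfl | hp
      · simp
      · have : (1 : ℝ) ≤ n := by exact_mod_cast hp
        nlinarith)
    refine h.congr fun n => ?_
    congr 1
    push_cast
    ring
  have hs : Summable fun x : ℤ => Real.exp (-(x : ℝ) ^ 2 / (2 * σ ^ 2)) :=
    Summable.of_nat_of_neg hn (by simpa using hn)
  exact hs.tsum_ofReal_ne_top

/-- The discrete Gaussian on `ℤ` of width `σ`: `Pr[x]` is proportional to `exp(-x² / (2σ²))`. -/
def discreteGaussian (σ : ℝ) (hσ : 0 < σ) : PMF ℤ :=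
  PMF.normalize (gaussianWeight σ) (gaussianWeight_tsum_ne_zero σ) (gaussianWeight_tsum_ne_top hσ)

/-- `k` independent samples of `D`. -/
def iid {α : Type} (D : PMF α) : (k : ℕ) → PMF (Fin k → α)
  | 0 => PMF.pure Fin.elim0
  | k + 1 => D.bind fun a => (iid D k).map fun v => (Fin.cons a v : Fin (k + 1) → α)

/-- Vectors over `ℤ/N` as lists: the length, followed by the representatives in `{0, …, N-1}`. -/
def encVec {N k : ℕ} (v : Fin k → ZMod N) : List ℕ := k :: List.ofFn fun i => (v i).val

/-- Matrices over `ℤ/N` as lists: the number of rows, followed by the rows. -/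
def encMat {N k l : ℕ} (A : Matrix (Fin k) (Fin l) (ZMod N)) : List ℕ :=
  k :: (List.ofFn fun i => encVec (A i)).flatten

/-! ## The Paillier cryptosystem -/

/-- A Paillier secret key: the two prime factors of the modulus. -/
structure PaillierKey where
  p : ℕ
  q : ℕ
  p_prime : p.Prime
  q_prime : q.Prime
  p_ne_q : p ≠ q
  coprime : (p * q).Coprime ((p - 1) * (q - 1))

namespace PaillierKey

/-- The modulus, which is the public key. -/
def m (K : PaillierKey) : ℕ := K.p * K.q

instance (K : PaillierKey) : NeZero K.m :=
  ⟨Nat.mul_ne_zero K.p_prime.ne_zero K.q_prime.ne_zero⟩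

/-- Encryption `(1 + m)^μ * r^m mod m²` for a uniformly random `r ∈ (ℤ/m)ˣ`. -/
def enc (K : PaillierKey) (μ : ZMod K.m) : PMF (ZMod (K.m ^ 2)) :=
  (PMF.uniformOfFintype (ZMod K.m)ˣ).map fun r =>
    (1 + (K.m : ZMod (K.m ^ 2))) ^ μ.val * (((r : ZMod K.m).val : ZMod (K.m ^ 2))) ^ K.m

/-- Carmichael's function of the modulus. -/
def lam (K : PaillierKey) : ℕ := Nat.lcm (K.p - 1) (K.q - 1)

/-- Decryption `L(c^lam mod m²) * lam⁻¹ mod m` with `L(u) = ⌊(u - 1) / m⌋`. -/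
def dec (K : PaillierKey) (c : ZMod (K.m ^ 2)) : ZMod K.m :=
  ((((c ^ K.lam).val - 1) / K.m : ℕ) : ZMod K.m) * (K.lam : ZMod K.m)⁻¹

end PaillierKey

/-- Key generation for each security parameter. -/
abbrev KeyGen := ℕ → PMF PaillierKey

/-- The pair of primes can be generated in probabilistic polynomial time. -/
def KeyGen.Efficient (gen : KeyGen) : Prop :=
  EfficientlySamplable fun κ => (gen κ).map fun K => [K.p, K.q]

/-- The input of the second stage of a chosen-plaintext attack.  The first stage `A₁` receives the
public key and outputs two messages (read modulo `m`) and a state; the second stage receives an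
encryption of the first message (`b = false`) or of the second one (`b = true`), and the state. -/
def indCPAChallenge (gen : KeyGen) (A₁ : PPT) (κ : ℕ) (b : Bool) : PMF (List ℕ) :=
  (gen κ).bind fun K =>
  (A₁.run κ [K.m]).bind fun out =>
  (K.enc (((if b then out.getD 1 0 else out.getD 0 0) : ℕ) : ZMod K.m)).map fun c =>
  c.val :: out.drop 2

/-- IND-CPA security of the Paillier cryptosystem. -/
def IndCPASecure (gen : KeyGen) : Prop :=
  ∀ A₁ A₂ : PPT, Negligible fun κ =>
    |A₂.prOne κ (indCPAChallenge gen A₁ κ false) - A₂.prOne κ (indCPAChallenge gen A₁ κ true)|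

/-- Secure Paillier parameters: IND-CPA security, and primes of at least `ℓ(κ)` bits where
`2^(-ℓ(κ))` is negligible. -/
structure SecurePaillier (gen : KeyGen) : Prop where
  indCPA : IndCPASecure gen
  large : ∃ ℓ : ℕ → ℕ, (Negligible fun κ => ((2 : ℝ) ^ ℓ κ)⁻¹) ∧
    ∀ κ, ∀ K ∈ (gen κ).support, ℓ κ ≤ K.p.size ∧ ℓ κ ≤ K.q.size

/-! ## Learning with errors -/

/-- LWE dimension `n`, ciphertext modulus `q`, plaintext modulus `p`, number `d₀` of rows of the
database, and width `σ` of the discrete Gaussian error, for each security parameter. -/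
structure Params where
  n : ℕ → ℕ
  q : ℕ → ℕ
  p : ℕ → ℕ
  d₀ : ℕ → ℕ
  σ : ℕ → ℝ
  q_pos : ∀ κ, 0 < q κ
  p_pos : ∀ κ, 0 < p κ
  σ_pos : ∀ κ, 0 < σ κ

namespace Params

variable (P : Params)

instance (κ : ℕ) : NeZero (P.q κ) := ⟨(P.q_pos κ).ne'⟩

/-- The error distribution `χ_e` on `ℤ/q`. -/
def errorDist (κ : ℕ) : PMF (ZMod (P.q κ)) :=
  (discreteGaussian (P.σ κ) (P.σ_pos κ)).map fun x => (x : ZMod (P.q κ))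

/-- The parameters can be computed, and the errors sampled, in polynomial time from `1^κ`, and the
dimensions `n` and `d₀` are polynomially bounded. -/
structure Efficient : Prop where
  n_comp : PolyTimeComputable P.n
  q_comp : PolyTimeComputable P.q
  p_comp : PolyTimeComputable P.p
  d₀_comp : PolyTimeComputable P.d₀
  n_bound : PolyBounded P.n
  d₀_bound : PolyBounded P.d₀
  error : EfficientlySamplable fun κ => (P.errorDist κ).map fun e => [e.val]

/-- The public matrix `A`, uniform in `(ℤ/q)^{d₀ × n}`. -/
def matrixDist (κ : ℕ) : PMF (Matrix (Fin (P.d₀ κ)) (Fin (P.n κ)) (ZMod (P.q κ))) :=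
  PMF.uniformOfFintype _

/-- The LWE secret key, uniform in `{0,1}^n`. -/
def secretDist (κ : ℕ) : PMF (Fin (P.n κ) → Bool) := PMF.uniformOfFintype _

/-- A binary vector as a vector over a ring. -/
def bits {k : ℕ} (R : Type) [Ring R] (s : Fin k → Bool) : Fin k → R :=
  fun j => if s j then 1 else 0

/-- LWE samples `(A, A s + e)`. -/
def lweReal (κ : ℕ) : PMF (List ℕ) :=
  (P.matrixDist κ).bind fun A =>
  (P.secretDist κ).bind fun s =>
  (iid (P.errorDist κ) (P.d₀ κ)).map fun e =>
  encMat A ++ encVec (A.mulVec (bits (ZMod (P.q κ)) s) + e)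

/-- Uniform samples `(A, u)`. -/
def lweUniform (κ : ℕ) : PMF (List ℕ) :=
  (P.matrixDist κ).bind fun A =>
  (PMF.uniformOfFintype (Fin (P.d₀ κ) → ZMod (P.q κ))).map fun u =>
  encMat A ++ encVec u

/-- Secure LWE parameters: decisional LWE is hard with `d₀` samples, binary secrets and discrete
Gaussian errors. -/
def LWESecure : Prop :=
  ∀ B : PPT, Negligible fun κ => |B.prOne κ (P.lweReal κ) - B.prOne κ (P.lweUniform κ)|

/-! ## The protocol -/

/-- The scaling factor `Δ = ⌊q / p⌉`. -/
def scale (κ : ℕ) : ℤ := round ((P.q κ : ℚ) / (P.p κ : ℚ))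

/-- The output of `Setup`: the client key `(K, pt_r)`, and the ciphertexts `ck_r` which together
with the modulus of `K` form the hint request. -/
structure SetupOutput (κ : ℕ) where
  K : PaillierKey
  pt_r : Fin (P.n κ) → ZMod K.m
  ck_r : Fin (P.n κ) → ZMod (K.m ^ 2)

/-- The hint request `q_h = (m, ck_r)`. -/
def SetupOutput.hintRequest {P : Params} {κ : ℕ} (S : P.SetupOutput κ) : List ℕ :=
  S.K.m :: encVec S.ck_r

/-- `Setup`: generate Paillier keys, sample `ck_r` uniformly in `(ℤ/m²)^n`, and decrypt it. -/
def setup (gen : KeyGen) (κ : ℕ) : PMF (P.SetupOutput κ) :=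
  (gen κ).bind fun K =>
  (PMF.uniformOfFintype (Fin (P.n κ) → ZMod (K.m ^ 2))).map fun ck_r =>
  { K := K, pt_r := fun j => K.dec (ck_r j), ck_r := ck_r }

/-- `Query`: sample an LWE key `sk`, and output the offset `ck_o = sk - pt_r mod m` together with
the LWE encryption `qu_0 = A sk + e + Δ u_i mod q` of the selection vector of the index `i`. -/
def query (κ : ℕ) (A : Matrix (Fin (P.d₀ κ)) (Fin (P.n κ)) (ZMod (P.q κ)))
    (i : Fin (P.d₀ κ)) {m : ℕ} (pt_r : Fin (P.n κ) → ZMod m) :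
    PMF ((Fin (P.n κ) → ZMod m) × (Fin (P.d₀ κ) → ZMod (P.q κ))) :=
  (P.secretDist κ).bind fun sk =>
  (iid (P.errorDist κ) (P.d₀ κ)).map fun e =>
  (bits (ZMod m) sk - pt_r,
    A.mulVec (bits (ZMod (P.q κ)) sk) + e + Pi.single i (P.scale κ : ZMod (P.q κ)))

/-- What the server sees when the client queries index `i`: the public matrix `A`, the hint request
and the query. -/
def view (gen : KeyGen) (κ : ℕ) (i : Fin (P.d₀ κ)) : PMF (List ℕ) :=
  (P.matrixDist κ).bind fun A =>
  (P.setup gen κ).bind fun S =>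
  (P.query κ A i S.pt_r).map fun qu =>
  encMat A ++ S.hintRequest ++ encVec qu.1 ++ encVec qu.2

end Params

end ZipPIR

end

noncomputable section

namespace ZipPIR

/-! ## Basic facts about the machine -/

/-! The proof compares the view with games `world b t i`. In these the ciphertexts encrypt `b * s -
o`, where `s` is the LWE key and `o` a uniform offset vector that is also revealed; the LWE vector
is genuine for `t = 1` and uniform for `t = 0`.

The real view is statistically close to `world 1 1 i`. Paillier encryption is injective on pairs
(message, unit), and its image misses at most a fraction 1/P + 1/Q of ℤ/m². A uniform `ck_r` is
therefore almost an encryption of a uniform message, and with `o = s - pt_r` as the new uniform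
variable the pair `(ck_r, ck_o)` becomes an encryption of `s - o` together with `o`
(`close_encWith`, `close_decrypted`, `close_view`). IND-CPA security leads from `b = 1` to `b = 0`.
No hybrid over the coordinates is needed: from one challenge ciphertext `c` of the bit `b`, the
homomorphic property yields all ciphertexts as `c ^ s j` times a fresh encryption of `-o j`
(`close_ctPair`). For `b = 0` the key `s` enters only through the LWE sample (`world_zero`), so LWE
security leads to `t = 0`. A uniform vector absorbs the shift by `Δ u_i`, so this last game does not
depend on `i` (`world_zero_zero`).

One bound must serve all indices, whereas a reduction is a single uniform program that knows neither
a good index nor the sign of the adversary's advantage there. It therefore draws the index at random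
and plays `parityGame`: the bit obtained from the challenge is added modulo 2 to the bit of a
self-made sample from a random world and to the name of that world. The advantage is then the mean
over the indices of the squared gaps (`parityGame_sub`). There is no cancellation, and each single
gap is at most the square root of `d₀` times the advantage, which is again negligible.

The reductions must also be actual programs of the machine. This is the purpose of the calculus of
`Spec` and `EffOn`: kernels on registers that are computable in polynomial time are closed under
composition, subroutine calls and loops whose stacks grow by a bounded amount per iteration. Since
running time limits output length, the polynomial bounds compose. All samplers (errors, keys, units)
are only approximate; `Close` collects their statistical errors. -/

theorem bind_congr_support {α β : Type*} (p : PMF α) {f g : α → PMF β}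
    (h : ∀ a ∈ p.support, f a = g a) : p.bind f = p.bind g := by
  ext b
  simp only [PMF.bind_apply]
  refine tsum_congr fun a => ?_
  by_cases ha : a ∈ p.support
  · rw [h a ha]
  · rw [(p.apply_eq_zero_iff a).2 ha]; simp

theorem map_congr_support {α β : Type*} (p : PMF α) {f g : α → β}
    (h : ∀ a ∈ p.support, f a = g a) : p.map f = p.map g :=
  bind_congr_support p fun a ha => by simp [h a ha]

theorem map_eq_bind {α β : Type*} (p : PMF α) (f : α → β) :
    p.map f = p.bind fun a => PMF.pure (f a) := rfl

@[simp] theorem bitSize_nil : bitSize [] = 0 := rfl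

@[simp] theorem bitSize_cons (v : ℕ) (l : List ℕ) :
    bitSize (v :: l) = v.size + 1 + bitSize l := by simp [bitSize]

@[simp] theorem bitSize_append (l l' : List ℕ) : bitSize (l ++ l') = bitSize l + bitSize l' := by
  simp [bitSize]

@[simp] theorem bitSize_reverse (l : List ℕ) : bitSize l.reverse = bitSize l := by
  simp [bitSize]

theorem bitSize_tail_le (l : List ℕ) : bitSize l.tail ≤ bitSize l := by
  cases l <;> simp

theorem size_head_le (l : List ℕ) : (l.headD 0).size ≤ bitSize l := by
  cases l <;> simp; omega

theorem length_le_bitSize (l : List ℕ) : l.length ≤ bitSize l := by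
  induction l with
  | nil => simp
  | cons a l ih => simp; omega

theorem size_le_of_mem {l : List ℕ} {v : ℕ} (h : v ∈ l) : v.size + 1 ≤ bitSize l := by
  induction l with
  | nil => simp at h
  | cons a l ih =>
    rcases List.mem_cons.1 h with rfl | h
    · simp
    · have := ih h; simp; omega

theorem size_add_le (x y : ℕ) : (x + y).size ≤ x.size + y.size + 1 := by
  rw [Nat.size_le]
  have hx := Nat.lt_size_self x
  have hy := Nat.lt_size_self y
  have h1 : 2 ^ x.size ≤ 2 ^ (x.size + y.size) := Nat.pow_le_pow_right (by norm_num) (by omega)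
  have h2 : 2 ^ y.size ≤ 2 ^ (x.size + y.size) := Nat.pow_le_pow_right (by norm_num) (by omega)
  rw [pow_succ]; omega

theorem size_mul_le (x y : ℕ) : (x * y).size ≤ x.size + y.size := by
  rw [Nat.size_le, pow_add]
  exact Nat.mul_lt_mul'' (Nat.lt_size_self x) (Nat.lt_size_self y)

theorem Op.size_eval_le (o : Op) (x y : ℕ) : (o.eval x y).size ≤ x.size + y.size + 1 := by
  cases o
  · exact size_add_le x y
  · exact (Nat.size_le_size (Nat.sub_le x y)).trans (by omega)
  · exact (size_mul_le x y).trans (by omega)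
  · exact (Nat.size_le_size (Nat.div_le_self x y)).trans (by omega)
  · exact (Nat.size_le_size (Nat.mod_le x y)).trans (by omega)

theorem mem_support_unifBelow {v r : ℕ} (h : r ∈ (unifBelow v).support) : r < v ∨ r = 0 := by
  unfold unifBelow at h
  split_ifs at h
  · left; simpa using h
  · right; simpa using h

theorem size_unifBelow {v r : ℕ} (h : r ∈ (unifBelow v).support) : r.size ≤ v.size := by
  rcases mem_support_unifBelow h with h | rfl
  · exact Nat.size_le_size h.le
  · simp

theorem pay_eq_some {cost t : ℕ} {s s' : State} {t' : ℕ} :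
    some (s', t') = pay cost t s ↔ cost ≤ t ∧ s' = s ∧ t' = t - cost := by
  unfold pay
  split_ifs with h <;> simp [h]

theorem mem_support_bind_andThen {p : PMF Result} {f : ℕ → State → PMF Result} {r : State × ℕ} :
    some r ∈ (p.bind (andThen f)).support ↔
      ∃ s t, some (s, t) ∈ p.support ∧ some r ∈ (f t s).support := by
  rw [PMF.mem_support_bind_iff]
  constructor
  · rintro ⟨a, ha, h⟩
    rcases a with _ | ⟨s, t⟩
    · simp [andThen] at h
    · exact ⟨s, t, ha, h⟩
  · rintro ⟨s, t, ha, h⟩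
    exact ⟨_, ha, h⟩

theorem none_mem_support_bind_andThen {p : PMF Result} {f : ℕ → State → PMF Result} :
    none ∈ (p.bind (andThen f)).support ↔
      none ∈ p.support ∨ ∃ s t, some (s, t) ∈ p.support ∧ none ∈ (f t s).support := by
  rw [PMF.mem_support_bind_iff]
  constructor
  · rintro ⟨a, ha, h⟩
    rcases a with _ | ⟨s, t⟩
    · exact Or.inl ha
    · exact Or.inr ⟨s, t, ha, h⟩
  · rintro (h | ⟨s, t, ha, h⟩)
    · exact ⟨none, h, by simp [andThen]⟩
    · exact ⟨_, ha, h⟩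

/-- An invariant of all instructions is an invariant of all programs. -/
def Grows (f : ℕ → State → PMF Result) : Prop :=
  ∀ t s s' t', some (s', t') ∈ (f t s).support →
    t' ≤ t ∧ ∀ a, bitSize (s' a) + 2 * t' ≤ bitSize (s a) + 2 * t

theorem Grows.loop {f : ℕ → State → PMF Result} (hf : Grows f) (a fuel : ℕ) :
    Grows (loop f a fuel) := by
  induction fuel with
  | zero => intro t s s' t' h; simp [ZipPIR.loop] at h
  | succ n ih =>
    intro t s s' t' h
    rw [ZipPIR.loop] at h
    split_ifs at h with h1 h2
    · simp at h
    · simp only [PMF.mem_support_pure_iff, Option.some.injEq, Prod.mk.injEq] at h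
      obtain ⟨rfl, rfl⟩ := h
      exact ⟨by omega, fun a => by omega⟩
    · obtain ⟨s1, t1, h3, h4⟩ := mem_support_bind_andThen.1 h
      have h5 := hf _ _ _ _ h3
      have h6 := ih _ _ _ _ h4
      exact ⟨by omega, fun a => by have := h5.2 a; have := h6.2 a; omega⟩

theorem bitSize_push_le (s : State) (a v b : ℕ) :
    bitSize (s.push a v b) ≤ bitSize (s b) + (v.size + 1) := by
  by_cases h : b = a
  · subst h; simp [State.push]; omega
  · simp [State.push, h]

/-- The potential "stack size plus twice the remaining budget" never increases: an instruction that
pushes a number pays at least half of the bits it adds, separator included. The factor 2 absorbs the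
carry of `add` and the separator. -/
theorem grows_exec (c : Cmd) : Grows (exec c) := by
  induction c with
  | seq c d hc hd =>
    intro t s s' t' h
    rw [exec] at h
    obtain ⟨s1, t1, h3, h4⟩ := mem_support_bind_andThen.1 h
    have h5 := hc _ _ _ _ h3
    have h6 := hd _ _ _ _ h4
    exact ⟨by omega, fun a => by have := h5.2 a; have := h6.2 a; omega⟩
  | ite a c d hc hd =>
    intro t s s' t' h
    rw [exec] at h
    split_ifs at h with h1 h2
    · simp at h
    · have h5 := hd _ _ _ _ h
      exact ⟨by omega, fun a => by have := h5.2 a; omega⟩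
    · have h5 := hc _ _ _ _ h
      exact ⟨by omega, fun a => by have := h5.2 a; omega⟩
  | skip =>
    intro t s s' t' h
    rw [exec, PMF.mem_support_pure_iff, pay_eq_some] at h
    obtain ⟨h1, rfl, rfl⟩ := h
    exact ⟨by omega, fun a => by omega⟩
  | push a v =>
    intro t s s' t' h
    rw [exec, PMF.mem_support_pure_iff, pay_eq_some] at h
    obtain ⟨h1, rfl, rfl⟩ := h
    exact ⟨by omega, fun b => by have := bitSize_push_le s a v b; omega⟩
  | pop a =>
    intro t s s' t' h
    rw [exec, PMF.mem_support_pure_iff, pay_eq_some] at h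
    obtain ⟨h1, rfl, rfl⟩ := h
    refine ⟨by omega, fun b => ?_⟩
    by_cases hb : b = a
    · subst hb; have := bitSize_tail_le (s b); simp; omega
    · rw [Function.update_of_ne hb]; omega
  | copy a v =>
    intro t s s' t' h
    rw [exec, PMF.mem_support_pure_iff, pay_eq_some] at h
    obtain ⟨h1, rfl, rfl⟩ := h
    exact ⟨by omega, fun b => by have := bitSize_push_le s v (s.top a) b; omega⟩
  | isNil a v =>
    intro t s s' t' h
    rw [exec, PMF.mem_support_pure_iff, pay_eq_some] at h
    obtain ⟨h1, rfl, rfl⟩ := h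
    refine ⟨by omega, fun b => ?_⟩
    have := bitSize_push_le s v (if (s a).isEmpty then 1 else 0) b
    have h2 : (if (s a).isEmpty then 1 else 0 : ℕ).size ≤ 1 := by split_ifs <;> simp
    omega
  | arith o a b c =>
    intro t s s' t' h
    rw [exec, PMF.mem_support_pure_iff, pay_eq_some] at h
    obtain ⟨h1, rfl, rfl⟩ := h
    refine ⟨by omega, fun x => ?_⟩
    have := bitSize_push_le s c (o.eval (s.top a) (s.top b)) x
    have := o.size_eval_le (s.top a) (s.top b)
    omega
  | unif a b =>
    intro t s s' t' h
    rw [exec, PMF.mem_support_map_iff] at h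
    obtain ⟨r, hr, h⟩ := h
    rw [eq_comm, pay_eq_some] at h
    obtain ⟨h1, rfl, rfl⟩ := h
    refine ⟨by omega, fun x => ?_⟩
    have := bitSize_push_le s b r x
    have := size_unifBelow hr
    omega
  | _ =>
    rename_i a c hc
    intro t s s' t' h; exact hc.loop a _ _ _ _ _ h

/-- Every test consumes a unit of time, so the budget runs out before the fuel does and the exact
amount of fuel is immaterial. -/
theorem loop_fuel {f : ℕ → State → PMF Result} (hf : Grows f) (a : ℕ) :
    ∀ t n n' s, t < n → t < n' → loop f a n t s = loop f a n' t s := by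
  intro t
  induction t using Nat.strong_induction_on with
  | _ t ih =>
    intro n n' s hn hn'
    obtain ⟨n, rfl⟩ : ∃ k, n = k + 1 := ⟨n - 1, by omega⟩
    obtain ⟨n', rfl⟩ : ∃ k, n' = k + 1 := ⟨n' - 1, by omega⟩
    rw [loop, loop]
    split_ifs with h1 h2
    · rfl
    · rfl
    · refine bind_congr_support _ fun r hr => ?_
      rcases r with _ | ⟨s', t'⟩
      · rfl
      · have := (hf _ _ _ _ hr).1
        exact ih _ (by omega) _ _ _ (by omega) (by omega)

/-- The unfolding equation for `while` in terms of itself. The fuel in the definition only serves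
termination and is removed by `loop_fuel`. -/
theorem exec_while (a : ℕ) (c : Cmd) (t : ℕ) (s : State) :
    exec (.while a c) t s =
      if t = 0 then PMF.pure none
      else if s.top a = 0 then PMF.pure (some (s, t - 1))
      else (exec c (t - 1) s).bind (andThen (exec (.while a c))) := by
  conv_lhs => rw [exec, loop]
  split_ifs with h1 h2
  · rfl
  · rfl
  · refine bind_congr_support _ fun r hr => ?_
    rcases r with _ | ⟨s', t'⟩
    · rfl
    · have := (grows_exec c _ _ _ _ hr).1
      simp only [andThen]
      rw [exec]
      exact loop_fuel (grows_exec c) a _ _ _ _ (by omega) (by omega)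

/-- Add `k` to the remaining budget. -/
def shift (k : ℕ) : Result → Result := Option.map (Prod.map id (· + k))

theorem bind_shift {p p' : PMF Result} {f : ℕ → State → PMF Result} {k : ℕ}
    (hp : p' = p.map (shift k))
    (hn : none ∉ p.support)
    (hf : ∀ s t, some (s, t) ∈ p.support → f (t + k) s = (f t s).map (shift k)) :
    p'.bind (andThen f) = (p.bind (andThen f)).map (shift k) := by
  rw [hp, PMF.bind_map, PMF.map_bind]
  refine bind_congr_support _ fun r hr => ?_
  rcases r with _ | ⟨s, t⟩
  · exact absurd hr hn
  · exact hf s t hr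

theorem pay_shift {cost t k : ℕ} {s : State} (h : pay cost t s ≠ none) :
    pay cost (t + k) s = shift k (pay cost t s) := by
  unfold pay at *
  split_ifs at h ⊢ with h1 h2 <;> simp [shift] at * <;> omega

/-- The budget never influences the computation except by aborting it, so a run that cannot abort
merely keeps any additional budget. For `while` the induction is on the budget, which each test
decreases. -/
theorem exec_shift (c : Cmd) (k : ℕ) : ∀ t s, none ∉ (exec c t s).support →
    exec c (t + k) s = (exec c t s).map (shift k) := by
  induction c with
  | seq c d hc hd =>
    intro t s h
    rw [exec, none_mem_support_bind_andThen] at h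
    push Not at h
    rw [exec, exec]
    exact bind_shift (hc _ _ h.1) h.1 fun s' t' h' => hd _ _ (h.2 s' t' h')
  | ite a c d hc hd =>
    intro t s h
    rw [exec] at h ⊢
    rw [exec]
    have ht : t ≠ 0 := by rintro rfl; simp at h
    rw [if_neg ht] at h ⊢
    rw [if_neg (by omega), show t + k - 1 = t - 1 + k by omega]
    split_ifs at h ⊢ with h1
    · exact hd _ _ h
    · exact hc _ _ h
  | unif a b =>
    intro t s h
    rw [exec] at h ⊢
    rw [exec, PMF.map_comp]
    refine map_congr_support _ fun r hr => ?_
    refine pay_shift fun h' => h ?_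
    rw [PMF.mem_support_map_iff]
    exact ⟨r, hr, h'⟩
  | skip | push | pop | copy | isNil | arith =>
    intro t s h
    rw [exec] at h ⊢
    rw [exec, PMF.pure_map]
    exact congrArg _ (pay_shift fun h' => h (by rw [h']; simp))
  | _ =>
    rename_i a c hc
    intro t
    induction t using Nat.strong_induction_on with
    | _ t ih =>
      intro s h
      rw [exec_while] at h
      rw [exec_while, exec_while a c t]
      have ht : t ≠ 0 := by rintro rfl; simp at h
      rw [if_neg ht] at h ⊢
      rw [if_neg (by omega), show t + k - 1 = t - 1 + k by omega]
      split_ifs at h ⊢ with h1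
      · simp [PMF.pure_map, shift]
      · rw [none_mem_support_bind_andThen] at h
        push Not at h
        exact bind_shift (hc _ _ h.1) h.1 fun s' t' h' =>
          ih t' (by have := (grows_exec c _ _ _ _ h').1; omega) _ (h.2 s' t' h')

/-! ## Specifications -/

/-- From the state `s`, the program `c` halts within `T` steps, and its final state has
distribution `D`. -/
def Spec (c : Cmd) (s : State) (T : ℕ) (D : PMF State) : Prop :=
  ∃ μ : PMF (State × ℕ), μ.map Prod.fst = D ∧ (∀ x ∈ μ.support, x.2 ≤ T) ∧
    ∀ t, T ≤ t → exec c t s = μ.map fun x => some (x.1, t - x.2)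

theorem Spec.mono {c : Cmd} {s : State} {T T' : ℕ} {D : PMF State} (h : Spec c s T D)
    (hT : T ≤ T') : Spec c s T' D := by
  obtain ⟨μ, h1, h2, h3⟩ := h
  exact ⟨μ, h1, fun x hx => (h2 x hx).trans hT, fun t ht => h3 t (hT.trans ht)⟩

theorem Spec.of_eq {c : Cmd} {s : State} {k : ℕ} {D : PMF State}
    (h : ∀ t, k ≤ t → exec c t s = D.map fun s' => some (s', t - k)) : Spec c s k D := by
  refine ⟨D.map fun s' => (s', k), ?_, ?_, ?_⟩
  · rw [PMF.map_comp]; exact PMF.map_id D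
  · intro x hx
    rw [PMF.mem_support_map_iff] at hx
    obtain ⟨a, -, rfl⟩ := hx
    exact le_rfl
  · intro t ht
    rw [h t ht, PMF.map_comp]
    rfl

theorem spec_skip (s : State) : Spec .skip s 1 (PMF.pure s) :=
  .of_eq fun t ht => by simp [exec, pay, ht, PMF.pure_map]

theorem spec_push (a v : ℕ) (s : State) :
    Spec (.push a v) s (1 + v.size) (PMF.pure (s.push a v)) :=
  .of_eq fun t ht => by simp [exec, pay, ht, PMF.pure_map]

theorem spec_pop (a : ℕ) (s : State) :
    Spec (.pop a) s 1 (PMF.pure (Function.update s a (s a).tail)) :=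
  .of_eq fun t ht => by simp [exec, pay, ht, PMF.pure_map]

theorem spec_copy (a b : ℕ) (s : State) :
    Spec (.copy a b) s (1 + (s.top a).size) (PMF.pure (s.push b (s.top a))) :=
  .of_eq fun t ht => by simp [exec, pay, ht, PMF.pure_map]

theorem spec_isNil (a b : ℕ) (s : State) :
    Spec (.isNil a b) s 1 (PMF.pure (s.push b (if (s a).isEmpty then 1 else 0))) :=
  .of_eq fun t ht => by simp [exec, pay, ht, PMF.pure_map]

theorem spec_arith (o : Op) (a b c : ℕ) (s : State) :
    Spec (.arith o a b c) s (1 + (s.top a).size + (s.top b).size)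
      (PMF.pure (s.push c (o.eval (s.top a) (s.top b)))) :=
  .of_eq fun t ht => by simp [exec, pay, ht, PMF.pure_map]

theorem spec_unif (a b : ℕ) (s : State) :
    Spec (.unif a b) s (1 + (s.top a).size) ((unifBelow (s.top a)).map (s.push b)) :=
  .of_eq fun t ht => by
    simp [exec, pay, ht, PMF.map_comp, Function.comp_def]

/-- Choose witnesses on the support of a distribution. -/
theorem Spec.bind_aux {T T' : ℕ} {D : PMF State} {E : State → PMF State}
    {f : ℕ → State → PMF Result} {μ : PMF (State × ℕ)} (h1 : μ.map Prod.fst = D)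
    (h2 : ∀ x ∈ μ.support, x.2 ≤ T)
    (hd : ∀ s' ∈ D.support, ∃ ν : PMF (State × ℕ), ν.map Prod.fst = E s' ∧
      (∀ x ∈ ν.support, x.2 ≤ T') ∧ ∀ t, T' ≤ t → f t s' = ν.map fun x => some (x.1, t - x.2)) :
    ∃ ρ : PMF (State × ℕ), ρ.map Prod.fst = D.bind E ∧ (∀ x ∈ ρ.support, x.2 ≤ T + T') ∧
      ∀ t, T + T' ≤ t → (μ.map fun x => some (x.1, t - x.2)).bind (andThen f) =
        ρ.map fun x => some (x.1, t - x.2) := by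
  classical
  have hd' : ∀ s', ∃ ν : PMF (State × ℕ), s' ∈ D.support → ν.map Prod.fst = E s' ∧
      (∀ x ∈ ν.support, x.2 ≤ T') ∧ ∀ t, T' ≤ t → f t s' = ν.map fun x => some (x.1, t - x.2) := by
    intro s'
    by_cases h : s' ∈ D.support
    · obtain ⟨ν, h⟩ := hd s' h; exact ⟨ν, fun _ => h⟩
    · exact ⟨PMF.pure (s', 0), fun h' => absurd h' h⟩
  choose ν hν using hd'
  have hmem : ∀ x ∈ μ.support, x.1 ∈ D.support := by
    intro x hx
    rw [← h1, PMF.mem_support_map_iff]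
    exact ⟨x, hx, rfl⟩
  refine ⟨μ.bind fun x => (ν x.1).map fun y => (y.1, x.2 + y.2), ?_, ?_, ?_⟩
  · rw [PMF.map_bind, ← h1, PMF.bind_map]
    refine bind_congr_support _ fun x hx => ?_
    rw [PMF.map_comp, Function.comp_apply, ← (hν x.1 (hmem x hx)).1]
    rfl
  · intro z hz
    rw [PMF.mem_support_bind_iff] at hz
    obtain ⟨x, hx, hz⟩ := hz
    rw [PMF.mem_support_map_iff] at hz
    obtain ⟨y, hy, rfl⟩ := hz
    exact Nat.add_le_add (h2 x hx) ((hν x.1 (hmem x hx)).2.1 y hy)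
  · intro t ht
    rw [PMF.bind_map, PMF.map_bind]
    refine bind_congr_support _ fun x hx => ?_
    have hx2 := h2 x hx
    rw [Function.comp_apply, PMF.map_comp]
    simp only [andThen]
    rw [(hν x.1 (hmem x hx)).2.2 _ (by omega)]
    refine map_congr_support _ fun y hy => ?_
    simp [Nat.sub_sub]

theorem Spec.seq {c d : Cmd} {s : State} {T T' : ℕ} {D : PMF State} {E : State → PMF State}
    (hc : Spec c s T D) (hd : ∀ s' ∈ D.support, Spec d s' T' (E s')) :
    Spec (.seq c d) s (T + T') (D.bind E) := by
  obtain ⟨μ, h1, h2, h3⟩ := hc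
  obtain ⟨ρ, h4, h5, h6⟩ := Spec.bind_aux h1 h2 hd
  refine ⟨ρ, h4, h5, fun t ht => ?_⟩
  rw [exec, h3 t (by omega), h6 t ht]

theorem Spec.seq_pure {c d : Cmd} {s s' : State} {T T' : ℕ} {D : PMF State}
    (hc : Spec c s T (PMF.pure s')) (hd : Spec d s' T' D) :
    Spec (.seq c d) s (T + T') D := by
  have := Spec.seq (E := fun _ => D) hc (fun x hx => by
    rw [PMF.mem_support_pure_iff] at hx; subst hx; exact hd)
  rwa [PMF.pure_bind] at this

theorem Spec.ite_zero {a : ℕ} {c d : Cmd} {s : State} {T : ℕ} {D : PMF State}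
    (h : s.top a = 0) (hd : Spec d s T D) : Spec (.ite a c d) s (1 + T) D := by
  obtain ⟨μ, h1, h2, h3⟩ := hd
  refine ⟨μ.map fun x => (x.1, 1 + x.2), ?_, ?_, fun t ht => ?_⟩
  · rw [PMF.map_comp]; exact h1
  · intro x hx
    rw [PMF.mem_support_map_iff] at hx
    obtain ⟨y, hy, rfl⟩ := hx
    have := h2 y hy
    simp only; omega
  · rw [exec, if_neg (by omega), if_pos h, h3 _ (by omega), PMF.map_comp]
    simp only [Function.comp_def, Nat.sub_sub]

theorem Spec.ite_ne_zero {a : ℕ} {c d : Cmd} {s : State} {T : ℕ} {D : PMF State}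
    (h : s.top a ≠ 0) (hd : Spec c s T D) : Spec (.ite a c d) s (1 + T) D := by
  obtain ⟨μ, h1, h2, h3⟩ := hd
  refine ⟨μ.map fun x => (x.1, 1 + x.2), ?_, ?_, fun t ht => ?_⟩
  · rw [PMF.map_comp]; exact h1
  · intro x hx
    rw [PMF.mem_support_map_iff] at hx
    obtain ⟨y, hy, rfl⟩ := hx
    have := h2 y hy
    simp only; omega
  · rw [exec, if_neg (by omega), if_neg h, h3 _ (by omega), PMF.map_comp]
    simp only [Function.comp_def, Nat.sub_sub]

theorem Spec.while_zero {a : ℕ} {c : Cmd} {s : State} (h : s.top a = 0) :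
    Spec (.while a c) s 1 (PMF.pure s) :=
  .of_eq fun t ht => by rw [exec_while, if_neg (by omega), if_pos h, PMF.pure_map]

theorem Spec.while_ne_zero {a : ℕ} {c : Cmd} {s : State} {T T' : ℕ} {D : PMF State}
    {E : State → PMF State} (h : s.top a ≠ 0) (hc : Spec c s T D)
    (hd : ∀ s' ∈ D.support, Spec (.while a c) s' T' (E s')) :
    Spec (.while a c) s (1 + T + T') (D.bind E) := by
  obtain ⟨μ, h1, h2, h3⟩ := hc
  obtain ⟨ρ, h4, h5, h6⟩ := Spec.bind_aux h1 h2 hd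
  refine ⟨ρ.map fun x => (x.1, 1 + x.2), ?_, ?_, fun t ht => ?_⟩
  · rw [PMF.map_comp]; exact h4
  · intro x hx
    rw [PMF.mem_support_map_iff] at hx
    obtain ⟨y, hy, rfl⟩ := hx
    have := h5 y hy
    simp only; omega
  · rw [exec_while, if_neg (by omega), if_neg h, h3 _ (by omega), h6 _ (by omega), PMF.map_comp]
    simp only [Function.comp_def, Nat.sub_sub]

theorem Spec.while_ne_zero_pure {a : ℕ} {c : Cmd} {s s' : State} {T T' : ℕ} {D : PMF State}
    (h : s.top a ≠ 0) (hc : Spec c s T (PMF.pure s')) (hd : Spec (.while a c) s' T' D) :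
    Spec (.while a c) s (1 + T + T') D := by
  have := Spec.while_ne_zero (E := fun _ => D) h hc (fun x hx => by
    rw [PMF.mem_support_pure_iff] at hx; subst hx; exact hd)
  rwa [PMF.pure_bind] at this

/-- Time bounds output length. This is what allows the running time of a subsequent program to be
bounded by composing polynomials. -/
theorem Spec.bitSize_le {c : Cmd} {s : State} {T : ℕ} {D : PMF State} (h : Spec c s T D)
    {s' : State} (hs : s' ∈ D.support) (a : ℕ) : bitSize (s' a) ≤ bitSize (s a) + 2 * T := by
  obtain ⟨μ, h1, h2, h3⟩ := h
  rw [← h1, PMF.mem_support_map_iff] at hs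
  obtain ⟨x, hx, rfl⟩ := hs
  have h4 : some (x.1, T - x.2) ∈ (exec c T s).support := by
    rw [h3 T le_rfl, PMF.mem_support_map_iff]
    exact ⟨x, hx, rfl⟩
  have h5 := (grows_exec c _ _ _ _ h4).2 a
  omega

theorem Spec.none_notMem {c : Cmd} {s : State} {T : ℕ} {D : PMF State} (h : Spec c s T D) {t : ℕ}
    (ht : T ≤ t) : none ∉ (exec c t s).support := by
  obtain ⟨μ, -, -, h3⟩ := h
  rw [h3 t ht, PMF.mem_support_map_iff]
  simp

/-- The state component of a result. -/
def final (s : State) : Result → State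
  | none => s
  | some (s', _) => s'

theorem Spec.final {c : Cmd} {s : State} {T : ℕ} {D : PMF State} (h : Spec c s T D) (s₀ : State)
    {t : ℕ} (ht : T ≤ t) : (exec c t s).map (final s₀) = D := by
  obtain ⟨μ, h1, -, h3⟩ := h
  rw [h3 t ht, PMF.map_comp, ← h1]
  rfl

/-- Converts the halting condition of `PPT`, which concerns one particular budget, into a
specification for all larger budgets; the time used is read off as `T` minus the remaining budget.
-/
theorem Spec.of_halts {c : Cmd} {s : State} {T : ℕ} (h : none ∉ (exec c T s).support) :
    Spec c s T ((exec c T s).map (ZipPIR.final s)) := by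
  have hle : ∀ s' t', some (s', t') ∈ (exec c T s).support → t' ≤ T :=
    fun s' t' h' => (grows_exec c _ _ _ _ h').1
  refine ⟨(exec c T s).map fun r => (ZipPIR.final s r, match r with | none => 0 | some x => T - x.2),
    ?_, ?_, fun t ht => ?_⟩
  · rw [PMF.map_comp]; rfl
  · intro x hx
    rw [PMF.mem_support_map_iff] at hx
    obtain ⟨r, -, rfl⟩ := hx
    rcases r with _ | r <;> simp
  · obtain ⟨k, rfl⟩ := Nat.exists_eq_add_of_le ht
    rw [exec_shift c k T s h, PMF.map_comp]
    refine map_congr_support _ fun r hr => ?_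
    rcases r with _ | ⟨s', t'⟩
    · exact absurd hr h
    · have := hle _ _ hr
      simp [shift, ZipPIR.final]; omega

/-! ## Renaming registers -/

/-- Rename the registers of a program. -/
def Cmd.rename (f : ℕ → ℕ) : Cmd → Cmd
  | .skip => .skip
  | .push a v => .push (f a) v
  | .pop a => .pop (f a)
  | .copy a b => .copy (f a) (f b)
  | .isNil a b => .isNil (f a) (f b)
  | .arith o a b c => .arith o (f a) (f b) (f c)
  | .unif a b => .unif (f a) (f b)
  | .seq c d => .seq (c.rename f) (d.rename f)
  | .ite a c d => .ite (f a) (c.rename f) (d.rename f)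
  | .while a c => .while (f a) (c.rename f)

section rename

variable {f : ℕ → ℕ} {J : State → State}

/-- Apply an embedding of states to a result. -/
def liftResult (J : State → State) : Result → Result := Option.map (Prod.map J id)

theorem bind_liftResult {p p' : PMF Result} {g g' : ℕ → State → PMF Result}
    (hp : p' = p.map (liftResult J)) (hg : ∀ s t, g' t (J s) = (g t s).map (liftResult J)) :
    p'.bind (andThen g') = (p.bind (andThen g)).map (liftResult J) := by
  rw [hp, PMF.bind_map, PMF.map_bind]
  congr 1
  funext r
  rcases r with _ | ⟨s, t⟩
  · simp [andThen, liftResult, PMF.pure_map]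
  · exact hg s t

/-- The semantics only reads and writes single registers. An embedding `J` that respects reads
(`h1`) and writes (`h2`) along `f` therefore commutes with every program, and the registers outside
the range of `f` may hold anything that `J` prescribes. -/
theorem exec_rename (h1 : ∀ s a, J s (f a) = s a)
    (h2 : ∀ s a l, Function.update (J s) (f a) l = J (Function.update s a l)) (c : Cmd) :
    ∀ t s, exec (c.rename f) t (J s) = (exec c t s).map (liftResult J) := by
  have htop : ∀ s a, (J s).top (f a) = s.top a := fun s a => by simp [State.top, h1]
  have hpush : ∀ s a v, (J s).push (f a) v = J (s.push a v) := fun s a v => by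
    simp [State.push, h1, h2]
  have hpay : ∀ k t s, pay k t (J s) = liftResult J (pay k t s) := fun k t s => by
    unfold pay; split_ifs <;> rfl
  induction c with
  | seq c d hc hd =>
    intro t s
    simp only [Cmd.rename, exec]
    exact bind_liftResult (hc t s) fun s t => hd t s
  | ite a c d hc hd =>
    intro t s
    simp only [Cmd.rename, exec, htop]
    split_ifs
    · simp [liftResult, PMF.pure_map]
    · exact hd _ _
    · exact hc _ _
  | unif a b =>
    intro t s
    simp only [Cmd.rename, exec, PMF.map_comp, htop, hpush, hpay]
    rfl
  | skip | push | pop | copy | isNil | arith =>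
    intro t s
    simp only [Cmd.rename, exec, PMF.pure_map, htop, hpush, hpay, h1, h2]
  | _ =>
    rename_i a c hc
    intro t s
    simp only [Cmd.rename, exec]
    generalize t + 1 = n
    induction n generalizing t s with
    | zero => simp [loop, liftResult, PMF.pure_map]
    | succ n ih =>
      simp only [loop, htop]
      split_ifs
      · simp [liftResult, PMF.pure_map]
      · simp [liftResult, PMF.pure_map]
      · exact bind_liftResult (hc _ s) fun s t => ih t s

theorem Spec.rename (h1 : ∀ s a, J s (f a) = s a)
    (h2 : ∀ s a l, Function.update (J s) (f a) l = J (Function.update s a l)) {c : Cmd}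
    {s : State} {T : ℕ} {D : PMF State} (h : Spec c s T D) :
    Spec (c.rename f) (J s) T (D.map J) := by
  obtain ⟨μ, h3, h4, h5⟩ := h
  refine ⟨μ.map (Prod.map J id), ?_, ?_, fun t ht => ?_⟩
  · rw [PMF.map_comp, ← h3, PMF.map_comp]; rfl
  · intro x hx
    rw [PMF.mem_support_map_iff] at hx
    obtain ⟨y, hy, rfl⟩ := hx
    exact h4 y hy
  · rw [exec_rename h1 h2, h5 t ht, PMF.map_comp, PMF.map_comp]
    rfl

end rename

/-! ## Registers used by a program -/

/-- All registers used by a program are smaller than this number. -/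
def Cmd.regs : Cmd → ℕ
  | .skip => 0
  | .push a _ => a + 1
  | .pop a => a + 1
  | .copy a b => a + b + 1
  | .isNil a b => a + b + 1
  | .arith _ a b c => a + b + c + 1
  | .unif a b => a + b + 1
  | .seq c d => c.regs + d.regs
  | .ite a c d => a + c.regs + d.regs
  | .while a c => a + c.regs

/-- A program leaves all but finitely many registers alone. Hence the workspace of a subroutine can
be wiped by a program of fixed length afterwards. -/
theorem exec_apply_of_le (c : Cmd) {x : ℕ} (hx : c.regs ≤ x) : ∀ {t s s' t'},
    some (s', t') ∈ (exec c t s).support → s' x = s x := by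
  have hpush : ∀ {s : State} {a v : ℕ}, a < x → s.push a v x = s x := fun {s a v} h => by
    simp [State.push, h.ne']
  induction c with
  | seq c d hc hd =>
    intro t s s' t' h
    simp only [Cmd.regs] at hx
    rw [exec] at h
    obtain ⟨s1, t1, h3, h4⟩ := mem_support_bind_andThen.1 h
    rw [hd (by omega) h4, hc (by omega) h3]
  | ite a c d hc hd =>
    intro t s s' t' h
    simp only [Cmd.regs] at hx
    rw [exec] at h
    split_ifs at h with h1 h2
    · simp at h
    · exact hd (by omega) h
    · exact hc (by omega) h
  | unif a b =>
    intro t s s' t' h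
    simp only [Cmd.regs] at hx
    rw [exec, PMF.mem_support_map_iff] at h
    obtain ⟨r, hr, h⟩ := h
    rw [eq_comm, pay_eq_some] at h
    rw [h.2.1, hpush (by omega)]
  | pop a =>
    intro t s s' t' h
    simp only [Cmd.regs] at hx
    rw [exec, PMF.mem_support_pure_iff, pay_eq_some] at h
    rw [h.2.1, Function.update_of_ne (by omega)]
  | skip =>
    intro t s s' t' h
    rw [exec, PMF.mem_support_pure_iff, pay_eq_some] at h
    rw [h.2.1]
  | push | copy | isNil | arith =>
    intro t s s' t' h
    simp only [Cmd.regs] at hx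
    rw [exec, PMF.mem_support_pure_iff, pay_eq_some] at h
    rw [h.2.1, hpush (by omega)]
  | _ =>
    rename_i a c hc
    intro t s s' t' h
    simp only [Cmd.regs] at hx
    rw [exec] at h
    generalize t + 1 = n at h
    induction n generalizing t s with
    | zero => simp [loop] at h
    | succ n ih =>
      rw [loop] at h
      split_ifs at h
      · simp at h
      · simp only [PMF.mem_support_pure_iff, Option.some.injEq, Prod.mk.injEq] at h
        rw [h.1]
      · obtain ⟨s1, t1, h3, h4⟩ := mem_support_bind_andThen.1 h
        rw [ih h4, hc (by omega) h3]

theorem Spec.apply_of_le {c : Cmd} {s : State} {T : ℕ} {D : PMF State} (h : Spec c s T D)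
    {s' : State} (hs : s' ∈ D.support) {x : ℕ} (hx : c.regs ≤ x) : s' x = s x := by
  obtain ⟨μ, h1, h2, h3⟩ := h
  rw [← h1, PMF.mem_support_map_iff] at hs
  obtain ⟨y, hy, rfl⟩ := hs
  have h4 : some (y.1, T - y.2) ∈ (exec c T s).support := by
    rw [h3 T le_rfl, PMF.mem_support_map_iff]
    exact ⟨y, hy, rfl⟩
  exact exec_apply_of_le c hx h4

/-! ## Memory layout

A state is split into the registers of the program proper, a few system registers, and the
registers of a subroutine. -/

/-- From 2 on, registers are dealt out by residue modulo 3. The exceptional values are `uR 0 = 0`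
and `sR 0 = 1`, so that the input of a program is a user register and the security parameter a
system register. -/
def uR : ℕ → ℕ
  | 0 => 0
  | a + 1 => 3 * a + 2

def sR : ℕ → ℕ
  | 0 => 1
  | a + 1 => 3 * a + 3

def wR (a : ℕ) : ℕ := 3 * a + 4

def mem (U S w : State) : State := fun r =>
  if r = 0 then U 0 else if r = 1 then S 0
  else if r % 3 = 2 then U (r / 3 + 1) else if r % 3 = 0 then S (r / 3) else w (r / 3 - 1)

@[simp] theorem mem_uR (U S w : State) (a : ℕ) : mem U S w (uR a) = U a := by
  cases a with
  | zero => simp [mem, uR]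
  | succ a =>
    have h1 : (3 * a + 2) % 3 = 2 := by omega
    have h2 : (3 * a + 2) / 3 = a := by omega
    simp [mem, uR, h1, h2]

@[simp] theorem mem_sR (U S w : State) (a : ℕ) : mem U S w (sR a) = S a := by
  cases a with
  | zero => simp [mem, sR]
  | succ a =>
    have h1 : (3 * a + 3) % 3 = 0 := by omega
    have h2 : (3 * a + 3) / 3 = a + 1 := by omega
    simp [mem, sR, h2]

@[simp] theorem mem_wR (U S w : State) (a : ℕ) : mem U S w (wR a) = w a := by
  have h1 : (3 * a + 4) % 3 = 1 := by omega
  have h2 : (3 * a + 4) / 3 - 1 = a := by omega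
  simp [mem, wR, h1, h2]

theorem reg_cases (r : ℕ) : (∃ a, r = uR a) ∨ (∃ a, r = sR a) ∨ ∃ a, r = wR a := by
  rcases r with _ | _ | r
  · exact Or.inl ⟨0, rfl⟩
  · exact Or.inr (Or.inl ⟨0, rfl⟩)
  · have : r % 3 = 0 ∨ r % 3 = 1 ∨ r % 3 = 2 := by omega
    rcases this with h | h | h
    · exact Or.inl ⟨r / 3 + 1, by simp [uR]; omega⟩
    · exact Or.inr (Or.inl ⟨r / 3 + 1, by simp [sR]; omega⟩)
    · exact Or.inr (Or.inr ⟨r / 3, by simp [wR]; omega⟩)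

@[simp] theorem uR_inj {a b : ℕ} : uR a = uR b ↔ a = b := by
  cases a <;> cases b <;> simp [uR]

@[simp] theorem sR_inj {a b : ℕ} : sR a = sR b ↔ a = b := by
  cases a <;> cases b <;> simp [sR]

@[simp] theorem wR_inj {a b : ℕ} : wR a = wR b ↔ a = b := by
  simp [wR]

@[simp] theorem uR_ne_sR {a b : ℕ} : uR a ≠ sR b := by
  cases a <;> cases b <;> (simp [uR, sR]; try omega)

@[simp] theorem uR_ne_wR {a b : ℕ} : uR a ≠ wR b := by
  cases a <;> simp [uR, wR]; omega

@[simp] theorem sR_ne_wR {a b : ℕ} : sR a ≠ wR b := by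
  cases a <;> simp [sR, wR]; omega

@[simp] theorem sR_ne_uR {a b : ℕ} : sR a ≠ uR b := uR_ne_sR.symm

@[simp] theorem wR_ne_uR {a b : ℕ} : wR a ≠ uR b := uR_ne_wR.symm

@[simp] theorem wR_ne_sR {a b : ℕ} : wR a ≠ sR b := sR_ne_wR.symm

@[simp] theorem update_mem_uR (U S w : State) (a : ℕ) (l : List ℕ) :
    Function.update (mem U S w) (uR a) l = mem (Function.update U a l) S w := by
  funext r
  rcases reg_cases r with ⟨b, rfl⟩ | ⟨b, rfl⟩ | ⟨b, rfl⟩ <;> simp [Function.update_apply]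

@[simp] theorem update_mem_sR (U S w : State) (a : ℕ) (l : List ℕ) :
    Function.update (mem U S w) (sR a) l = mem U (Function.update S a l) w := by
  funext r
  rcases reg_cases r with ⟨b, rfl⟩ | ⟨b, rfl⟩ | ⟨b, rfl⟩ <;> simp [Function.update_apply]

@[simp] theorem update_mem_wR (U S w : State) (a : ℕ) (l : List ℕ) :
    Function.update (mem U S w) (wR a) l = mem U S (Function.update w a l) := by
  funext r
  rcases reg_cases r with ⟨b, rfl⟩ | ⟨b, rfl⟩ | ⟨b, rfl⟩ <;> simp [Function.update_apply]

/-- The state whose first stacks are given by a list, all others being empty. -/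
def st (L : List (List ℕ)) : State := fun a => L.getD a []

theorem st_apply (L : List (List ℕ)) (a : ℕ) : st L a = L.getD a [] := rfl

theorem update_st (L : List (List ℕ)) (a : ℕ) (l : List ℕ) (h : a < L.length) :
    Function.update (st L) a l = st (L.set a l) := by
  funext r
  by_cases hr : r = a
  · subst hr; simp [st, h]
  · simp [st, hr, Ne.symm hr]

/-- The system registers: security parameter, two scratch stacks, and the control stack. -/
def sys (κ : ℕ) (X Y C : List ℕ) : State := st [[κ], X, Y, C]

@[simp] theorem sys_zero (κ : ℕ) (X Y C : List ℕ) : sys κ X Y C 0 = [κ] := rfl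
@[simp] theorem sys_one (κ : ℕ) (X Y C : List ℕ) : sys κ X Y C 1 = X := rfl
@[simp] theorem sys_two (κ : ℕ) (X Y C : List ℕ) : sys κ X Y C 2 = Y := rfl
@[simp] theorem sys_three (κ : ℕ) (X Y C : List ℕ) : sys κ X Y C 3 = C := rfl

@[simp] theorem update_sys_one (κ : ℕ) (X Y C l : List ℕ) :
    Function.update (sys κ X Y C) 1 l = sys κ l Y C := update_st _ _ _ (by simp)
@[simp] theorem update_sys_two (κ : ℕ) (X Y C l : List ℕ) :
    Function.update (sys κ X Y C) 2 l = sys κ X l C := update_st _ _ _ (by simp)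
@[simp] theorem update_sys_three (κ : ℕ) (X Y C l : List ℕ) :
    Function.update (sys κ X Y C) 3 l = sys κ X Y l := update_st _ _ _ (by simp)

theorem init_eq_mem (κ : ℕ) (x : List ℕ) :
    init κ x = mem (st [x]) (sys κ [] [] []) (st []) := by
  funext r
  have h0 : ∀ a, sR a = 1 ↔ a = 0 := fun a => by cases a <;> simp [sR]
  have h1 : ∀ a, uR a = 0 ↔ a = 0 := fun a => by cases a <;> simp [uR]
  have h2 : ∀ a, sR a ≠ 0 := fun a => by cases a <;> simp [sR]
  have h3 : ∀ a, uR a ≠ 1 := fun a => by cases a <;> simp [uR]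
  have h4 : ∀ a, wR a ≠ 1 := fun a => by simp [wR]
  have h5 : ∀ a, wR a ≠ 0 := fun a => by simp [wR]
  rcases reg_cases r with ⟨b, rfl⟩ | ⟨b, rfl⟩ | ⟨b, rfl⟩
  · rcases b with _ | b <;> simp [init, h1, h3, st]
  · rcases b with _ | _ | _ | _ | b <;> simp [init, h0, h2, sys, st]
  · simp [init, h4, h5, st]

/-! ## Arithmetic expressions -/

inductive Expr
  | var (a : ℕ)
  | const (v : ℕ)
  | op (o : Op) (e f : Expr)

namespace Expr

def eval (U : State) : Expr → ℕ
  | .var a => U.top a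
  | .const v => v
  | .op o e f => o.eval (e.eval U) (f.eval U)

instance : Add Expr := ⟨.op .add⟩
instance : Sub Expr := ⟨.op .sub⟩
instance : Mul Expr := ⟨.op .mul⟩
instance : Div Expr := ⟨.op .div⟩
instance : Mod Expr := ⟨.op .mod⟩
instance (n : ℕ) : OfNat Expr n := ⟨.const n⟩

@[simp] theorem eval_var (U : State) (a : ℕ) : (var a).eval U = U.top a := rfl
@[simp] theorem eval_add (U : State) (e f : Expr) : (e + f).eval U = e.eval U + f.eval U := rfl
@[simp] theorem eval_sub (U : State) (e f : Expr) : (e - f).eval U = e.eval U - f.eval U := rfl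
@[simp] theorem eval_mul (U : State) (e f : Expr) : (e * f).eval U = e.eval U * f.eval U := rfl
@[simp] theorem eval_div (U : State) (e f : Expr) : (e / f).eval U = e.eval U / f.eval U := rfl
@[simp] theorem eval_mod (U : State) (e f : Expr) : (e % f).eval U = e.eval U % f.eval U := rfl
@[simp] theorem eval_ofNat (U : State) (n : ℕ) : eval U (no_index (OfNat.ofNat n)) = n := rfl

/-- Push the value of an expression on the first scratch stack. -/
def compile : Expr → Cmd
  | .var a => .copy (uR a) (sR 1)
  | .const v => .push (sR 1) v
  | .op o e f =>
      .seq e.compile (.seq f.compile (.seq (.copy (sR 1) (sR 2)) (.seq (.pop (sR 1))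
        (.seq (.arith o (sR 1) (sR 2) (sR 2)) (.seq (.pop (sR 1)) (.seq (.copy (sR 2) (sR 1))
          (.seq (.pop (sR 2)) (.pop (sR 2)))))))))

/-- For a fixed expression both the length of the value and the time are linear in the size of the
registers. The two bounds are proved together because the cost of an operation depends on the
lengths of its operands. -/
theorem spec_compile (e : Expr) : ∃ k, ∀ b κ U X Y C w, (∀ a, bitSize (U a) ≤ b) →
    (e.eval U).size ≤ k * (b + 1) ∧
    Spec e.compile (mem U (sys κ X Y C) w) (k * (b + 1))
      (PMF.pure (mem U (sys κ (e.eval U :: X) Y C) w)) := by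
  induction e with
  | var a =>
    refine ⟨1, fun b κ U X Y C w hb => ?_⟩
    have h : (U.top a).size ≤ b := (size_head_le _).trans (hb a)
    refine ⟨by simp only [eval_var]; omega, ?_⟩
    have := spec_copy (uR a) (sR 1) (mem U (sys κ X Y C) w)
    simp only [State.push, State.top, mem_uR, mem_sR, update_mem_sR, update_sys_one,
      sys_one] at this
    exact this.mono (by simp only [State.top] at h; omega)
  | const v =>
    refine ⟨1 + v.size, fun b κ U X Y C w hb => ?_⟩
    refine ⟨by simp only [eval]; nlinarith [Nat.zero_le b, Nat.zero_le v.size], ?_⟩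
    have := spec_push (sR 1) v (mem U (sys κ X Y C) w)
    simp only [State.push, mem_sR, update_mem_sR, update_sys_one, sys_one] at this
    exact this.mono (Nat.le_mul_of_pos_right _ (by omega))
  | op o e f he hf =>
    obtain ⟨k, he⟩ := he
    obtain ⟨l, hf⟩ := hf
    refine ⟨4 * k + 4 * l + 20, fun b κ U X Y C w hb => ?_⟩
    obtain ⟨h1, he⟩ := he b κ U X Y C w hb
    obtain ⟨h2, hf⟩ := hf b κ U (e.eval U :: X) Y C w hb
    have h3 := o.size_eval_le (e.eval U) (f.eval U)
    have hT : (4 * k + 4 * l + 20) * (b + 1) =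
      4 * (k * (b + 1)) + 4 * (l * (b + 1)) + 20 * b + 20 := by ring
    rw [hT]
    refine ⟨by simp only [eval]; omega, ?_⟩
    have s1 := spec_copy (sR 1) (sR 2) (mem U (sys κ (f.eval U :: e.eval U :: X) Y C) w)
    have s2 := spec_pop (sR 1)
      (mem U (sys κ (f.eval U :: e.eval U :: X) (f.eval U :: Y) C) w)
    have s3 := spec_arith o (sR 1) (sR 2) (sR 2) (mem U (sys κ (e.eval U :: X) (f.eval U :: Y) C) w)
    have s4 := spec_pop (sR 1)
      (mem U (sys κ (e.eval U :: X) (o.eval (e.eval U) (f.eval U) :: f.eval U :: Y) C) w)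
    have s5 := spec_copy (sR 2) (sR 1)
      (mem U (sys κ X (o.eval (e.eval U) (f.eval U) :: f.eval U :: Y) C) w)
    have s6 := spec_pop (sR 2) (mem U (sys κ (o.eval (e.eval U) (f.eval U) :: X)
      (o.eval (e.eval U) (f.eval U) :: f.eval U :: Y) C) w)
    have s7 := spec_pop (sR 2) (mem U (sys κ (o.eval (e.eval U) (f.eval U) :: X)
      (f.eval U :: Y) C) w)
    simp only [State.push, State.top, mem_sR, update_mem_sR, update_sys_one, update_sys_two,
      sys_one, sys_two, List.headD_cons, List.tail_cons] at s1 s2 s3 s4 s5 s6 s7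
    exact (he.seq_pure (hf.seq_pure (s1.seq_pure (s2.seq_pure (s3.seq_pure (s4.seq_pure
      (s5.seq_pure (s6.seq_pure s7)))))))).mono (by omega)

end Expr

/-! ## Efficient kernels -/

theorem polynomial_eval_mono (P : Polynomial ℕ) {a b : ℕ} (h : a ≤ b) : P.eval a ≤ P.eval b := by
  rw [Polynomial.eval_eq_sum, Polynomial.eval_eq_sum]
  exact Finset.sum_le_sum fun i _ => Nat.mul_le_mul_left _ (Nat.pow_le_pow_left h i)

/-- A random transformation of the registers, depending on the security parameter. -/
abbrev Kern := ℕ → State → PMF State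

/-- The memory between two statements. -/
def frame (κ : ℕ) (C : List ℕ) (U : State) : State := mem U (sys κ [] [] C) (st [])

theorem frame_uR (κ : ℕ) (C : List ℕ) (U : State) (a : ℕ) : frame κ C U (uR a) = U a :=
  mem_uR _ _ _ _

/-- The kernel `F` can be computed in polynomial time on all states which satisfy `Pre`. -/
def EffOn (Pre : ℕ → State → Prop) (F : Kern) : Prop :=
  ∃ (c : Cmd) (P : Polynomial ℕ), ∀ b κ U C, κ ≤ b → (∀ a, bitSize (U a) ≤ b) → Pre κ U →
    Spec c (frame κ C U) (P.eval b) ((F κ U).map (frame κ C))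

/-- The kernel `F` can be computed in polynomial time. -/
abbrev Eff (F : Kern) : Prop := EffOn (fun _ _ => True) F

theorem EffOn.congr {Pre : ℕ → State → Prop} {F F' : Kern} (h : EffOn Pre F)
    (hp : ∀ κ U, Pre κ U → F κ U = F' κ U) : EffOn Pre F' := by
  obtain ⟨c, P, h⟩ := h
  refine ⟨c, P, fun b κ U C h1 h2 h3 => ?_⟩
  rw [← hp κ U h3]
  exact h b κ U C h1 h2 h3

theorem Spec.bitSize_frame_le {c : Cmd} {κ T b : ℕ} {C : List ℕ} {U : State} {D : PMF State}
    (h : Spec c (frame κ C U) T (D.map (frame κ C))) (hb : ∀ a, bitSize (U a) ≤ b) {U' : State}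
    (hU : U' ∈ D.support) (a : ℕ) : bitSize (U' a) ≤ b + 2 * T := by
  have h1 : frame κ C U' ∈ (D.map (frame κ C)).support := by
    rw [PMF.mem_support_map_iff]; exact ⟨U', hU, rfl⟩
  have h2 := h.bitSize_le h1 (uR a)
  rw [frame_uR, frame_uR] at h2
  have := hb a
  omega

/-- Sequential composition of kernels. -/
def kseq (F G : Kern) : Kern := fun κ U => (F κ U).bind (G κ)

/-- The second kernel starts on stacks of size at most `b + 2 * P(b)`, since the first one cannot
write more than twice its running time. This explains the polynomial `Q ∘ (X + 2P)`. -/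
theorem EffOn.seq {Pre Pre' : ℕ → State → Prop} {F G : Kern} (hF : EffOn Pre F)
    (hG : EffOn Pre' G) (h : ∀ κ U U', Pre κ U → U' ∈ (F κ U).support → Pre' κ U') :
    EffOn Pre (kseq F G) := by
  obtain ⟨c, P, hF⟩ := hF
  obtain ⟨d, Q, hG⟩ := hG
  refine ⟨.seq c d, P + Q.comp (Polynomial.X + 2 * P), fun b κ U C h1 h2 h3 => ?_⟩
  have hc := hF b κ U C h1 h2 h3
  -- The continuation has to be a function of the machine state, so the user state is recovered by
  -- reading the registers `uR a`.
  have hd : ∀ s' ∈ ((F κ U).map (frame κ C)).support,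
      Spec d s' (Q.eval (b + 2 * P.eval b))
        ((G κ (fun a => s' (uR a))).map (frame κ C)) := by
    intro s' hs
    rw [PMF.mem_support_map_iff] at hs
    obtain ⟨U', hU', rfl⟩ := hs
    simp only [frame_uR]
    exact hG _ κ U' C (by omega) (fun a => hc.bitSize_frame_le h2 hU' a) (h κ U U' h3 hU')
  have := hc.seq hd
  rw [PMF.bind_map] at this
  simp only [Function.comp_def, frame_uR] at this
  rw [kseq, PMF.map_bind]
  simpa using this

theorem Eff.seq {F G : Kern} (hF : Eff F) (hG : Eff G) : Eff (kseq F G) :=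
  EffOn.seq hF hG fun _ _ _ _ _ => trivial

def kskip : Kern := fun _ U => PMF.pure U

theorem eff_kskip : Eff kskip := by
  refine ⟨.skip, 1, fun b κ U C h1 h2 _ => ?_⟩
  simpa [kskip, PMF.pure_map] using spec_skip (frame κ C U)

/-- Run kernels one after the other. -/
def kseqs (L : List Kern) : Kern := L.foldr kseq kskip

def kpush (a : ℕ) (e : Expr) : Kern := fun _ U => PMF.pure (U.push a (e.eval U))

def kset (a : ℕ) (e : Expr) : Kern := fun _ U =>
  PMF.pure (Function.update U a (e.eval U :: (U a).tail))

def kpop (a : ℕ) : Kern := fun _ U => PMF.pure (Function.update U a (U a).tail)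

def kunif (a : ℕ) (e : Expr) : Kern := fun _ U => (unifBelow (e.eval U)).map (U.push a)

theorem eff_kpop (a : ℕ) : Eff (kpop a) := by
  refine ⟨.pop (uR a), 1, fun b κ U C h1 h2 _ => ?_⟩
  have := spec_pop (uR a) (frame κ C U)
  simp only [frame, mem_uR, update_mem_uR] at this
  simpa [kpop, PMF.pure_map, frame] using this

theorem eff_kpush (a : ℕ) (e : Expr) : Eff (kpush a e) := by
  obtain ⟨k, he⟩ := e.spec_compile
  refine ⟨.seq e.compile (.seq (.copy (sR 1) (uR a)) (.pop (sR 1))),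
    ((2 * k + 2 : ℕ) : Polynomial ℕ) * (Polynomial.X + 1), fun b κ U C h1 h2 _ => ?_⟩
  obtain ⟨h3, h4⟩ := he b κ U [] [] C (st []) h2
  have s1 := spec_copy (sR 1) (uR a) (mem U (sys κ [e.eval U] [] C) (st []))
  have s2 := spec_pop (sR 1) (mem (U.push a (e.eval U)) (sys κ [e.eval U] [] C) (st []))
  simp only [State.push, State.top, mem_uR, mem_sR, update_mem_sR, update_mem_uR, update_sys_one,
    sys_one, List.headD_cons, List.tail_cons] at s1 s2
  have := h4.seq_pure (s1.seq_pure s2)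
  rw [kpush, PMF.pure_map]
  refine this.mono ?_
  simp only [Polynomial.eval_mul, Polynomial.eval_natCast, Polynomial.eval_add, Polynomial.eval_X,
    Polynomial.eval_one, Nat.cast_id]
  have : (2 * k + 2) * (b + 1) = 2 * (k * (b + 1)) + 2 * (b + 1) := by ring
  omega

theorem eff_kset (a : ℕ) (e : Expr) : Eff (kset a e) := by
  obtain ⟨k, he⟩ := e.spec_compile
  refine ⟨.seq e.compile (.seq (.pop (uR a)) (.seq (.copy (sR 1) (uR a)) (.pop (sR 1)))),
    ((2 * k + 3 : ℕ) : Polynomial ℕ) * (Polynomial.X + 1), fun b κ U C h1 h2 _ => ?_⟩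
  obtain ⟨h3, h4⟩ := he b κ U [] [] C (st []) h2
  have s0 := spec_pop (uR a) (mem U (sys κ [e.eval U] [] C) (st []))
  have s1 := spec_copy (sR 1) (uR a)
    (mem (Function.update U a (U a).tail) (sys κ [e.eval U] [] C) (st []))
  have s2 := spec_pop (sR 1)
    (mem (Function.update U a (e.eval U :: (U a).tail)) (sys κ [e.eval U] [] C) (st []))
  simp only [State.push, State.top, mem_uR, mem_sR, update_mem_sR, update_mem_uR, update_sys_one,
    sys_one, List.headD_cons, List.tail_cons, Function.update_self, Function.update_idem]
    at s0 s1 s2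
  have := h4.seq_pure (s0.seq_pure (s1.seq_pure s2))
  rw [kset, PMF.pure_map]
  refine this.mono ?_
  simp only [Polynomial.eval_mul, Polynomial.eval_natCast, Polynomial.eval_add, Polynomial.eval_X,
    Polynomial.eval_one, Nat.cast_id]
  have : (2 * k + 3) * (b + 1) = 2 * (k * (b + 1)) + 3 * (b + 1) := by ring
  omega

theorem eff_kunif (a : ℕ) (e : Expr) : Eff (kunif a e) := by
  obtain ⟨k, he⟩ := e.spec_compile
  refine ⟨.seq e.compile (.seq (.unif (sR 1) (uR a)) (.pop (sR 1))),
    ((2 * k + 2 : ℕ) : Polynomial ℕ) * (Polynomial.X + 1), fun b κ U C h1 h2 _ => ?_⟩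
  obtain ⟨h3, h4⟩ := he b κ U [] [] C (st []) h2
  have s1 := spec_unif (sR 1) (uR a) (mem U (sys κ [e.eval U] [] C) (st []))
  have s2 : ∀ s' ∈ ((unifBelow (e.eval U)).map
      fun r => mem (U.push a r) (sys κ [e.eval U] [] C) (st [])).support,
      Spec (.pop (sR 1)) s' 1 (PMF.pure (Function.update s' (sR 1) (s' (sR 1)).tail)) :=
    fun s' _ => spec_pop (sR 1) s'
  have hs : (fun r => (mem U (sys κ [e.eval U] [] C) (st [])).push (uR a) r) =
      fun r => mem (U.push a r) (sys κ [e.eval U] [] C) (st []) := by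
    funext r; simp [State.push]
  rw [show (mem U (sys κ [e.eval U] [] C) (st [])).push (uR a) = _ from hs] at s1
  simp only [State.top, mem_sR, sys_one, List.headD_cons] at s1
  have := h4.seq_pure (s1.seq s2)
  have hD : (kunif a e κ U).map (frame κ C) = ((unifBelow (e.eval U)).map
      fun r => mem (U.push a r) (sys κ [e.eval U] [] C) (st [])).bind fun s' =>
      PMF.pure (Function.update s' (sR 1) (s' (sR 1)).tail) := by
    rw [kunif, PMF.map_comp, PMF.bind_map, map_eq_bind]
    congr 1
    funext r
    simp [frame]
  rw [hD]
  refine this.mono ?_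
  simp only [Polynomial.eval_mul, Polynomial.eval_natCast, Polynomial.eval_add, Polynomial.eval_X,
    Polynomial.eval_one, Nat.cast_id]
  have : (2 * k + 2) * (b + 1) = 2 * (k * (b + 1)) + 2 * (b + 1) := by ring
  omega

/-! ## Moving stacks -/

theorem State.push_top (s : State) (y v : ℕ) : (s.push y v).top y = v := by
  simp [State.push, State.top]

theorem spec_pop_push (y v : ℕ) (s : State) : Spec (.pop y) (s.push y v) 1 (PMF.pure s) := by
  have := spec_pop y (s.push y v)
  simpa [State.push] using this

/-- Run `body` until the stack `r` is empty, using `y` for the test. -/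
def drain (r y : ℕ) (body : Cmd) : Cmd :=
  .seq (.push y 1) (.seq (.while y (.seq (.pop y) (.seq (.isNil r y)
    (.ite y (.seq (.pop y) (.push y 0)) (.seq (.pop y) (.seq body (.push y 1))))))) (.pop y))

/-- The family `σ l p` describes the memory when `l` is still to be processed and `p` has been
processed, most recent entry first. The flag on top of `y` exists only during tests, so `body` runs
on exactly `σ (v :: l) p`. -/
theorem spec_drain {r y : ℕ} {body : Cmd} {T : ℕ} {L : List ℕ} (σ : List ℕ → List ℕ → State)
    (hσ : ∀ l p, σ l p r = l)
    (hbody : ∀ v l p, v ∈ L → Spec body (σ (v :: l) p) T (PMF.pure (σ l (v :: p)))) (p : List ℕ) :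
    Spec (drain r y body) (σ L p) ((L.length + 1) * (T + 12)) (PMF.pure (σ [] (L.reverse ++ p))) := by
  have key : ∀ l p, l ⊆ L → Spec (.while y (.seq (.pop y) (.seq (.isNil r y)
      (.ite y (.seq (.pop y) (.push y 0)) (.seq (.pop y) (.seq body (.push y 1)))))))
      ((σ l p).push y 1) (l.length * (T + 12) + 8)
      (PMF.pure ((σ [] (l.reverse ++ p)).push y 0)) := by
    intro l
    induction l with
    | nil =>
      intro p _
      have s1 := spec_isNil r y (σ [] p)
      rw [hσ] at s1
      have s2 := (spec_pop_push y 1 (σ [] p)).seq_pure (s1.seq_pure (Spec.ite_ne_zero (a := y)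
        (d := .seq (.pop y) (.seq body (.push y 1))) (by simp [State.push_top])
        ((spec_pop_push y 1 (σ [] p)).seq_pure (spec_push y 0 (σ [] p)))))
      have s3 := Spec.while_ne_zero_pure (a := y) (by simp [State.push_top]) s2
        (Spec.while_zero (a := y) (by simp [State.push_top]))
      exact s3.mono (by simp)
    | cons v l ih =>
      intro p hl
      have hv : v ∈ L := hl (by simp)
      have s1 := spec_isNil r y (σ (v :: l) p)
      rw [hσ] at s1
      have s2 := (spec_pop_push y 1 (σ (v :: l) p)).seq_pure (s1.seq_pure (Spec.ite_zero (a := y)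
        (c := .seq (.pop y) (.push y 0)) (by simp [State.push_top])
        ((spec_pop_push y _ (σ (v :: l) p)).seq_pure
          ((hbody v l p hv).seq_pure (spec_push y 1 (σ l (v :: p)))))))
      have s3 := Spec.while_ne_zero_pure (a := y) (by simp [State.push_top]) s2
        (ih (v :: p) fun x hx => hl (by simp [hx]))
      rw [List.reverse_cons, List.append_assoc, List.singleton_append]
      refine s3.mono ?_
      simp only [List.length_cons, Nat.size_one, add_mul]
      omega
  have := (spec_push y 1 (σ L p)).seq_pure ((key L p (List.Subset.refl L)).seq_pure
    (spec_pop_push y 0 (σ [] (L.reverse ++ p))))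
  refine this.mono ?_
  simp only [Nat.size_one, add_mul]
  omega

/-- Move the stack `r` to the stack `r'`, reversing it. -/
def moveCmd (r r' y : ℕ) : Cmd := drain r y (.seq (.copy r r') (.pop r))

theorem drain_time {b T : ℕ} {L : List ℕ} (h : bitSize L ≤ b) :
    (L.length + 1) * T ≤ (b + 1) * T :=
  Nat.mul_le_mul_right _ (by have := length_le_bitSize L; omega)

theorem spec_move {r r' y : ℕ} (hr : r ≠ r') {b : ℕ} (s : State) (hb : bitSize (s r) ≤ b) :
    Spec (moveCmd r r' y) s ((b + 1) * (b + 14))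
      (PMF.pure (Function.update (Function.update s r []) r' ((s r).reverse ++ s r'))) := by
  have := spec_drain (r := r) (y := y) (body := .seq (.copy r r') (.pop r)) (T := b + 2)
    (L := s r) (fun l p => Function.update (Function.update s r l) r' p) (fun l p => by simp [hr])
    (fun v l p hv => by
      have h1 := size_le_of_mem hv
      have s1 := spec_copy r r' (Function.update (Function.update s r (v :: l)) r' p)
      have s2 := spec_pop r (Function.update (Function.update s r (v :: l)) r' (v :: p))
      simp only [State.push, State.top, Function.update_self, Function.update_of_ne hr,
        Function.update_idem, List.headD_cons, List.tail_cons] at s1 s2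
      rw [Function.update_comm hr.symm, Function.update_idem] at s2
      exact (s1.seq_pure s2).mono (by omega)) (s r')
  simp only [Function.update_eq_self] at this
  exact this.mono (drain_time hb)

def clearCmd (r y : ℕ) : Cmd := drain r y (.pop r)

theorem spec_clear {r y : ℕ} {b : ℕ} (s : State) (hb : bitSize (s r) ≤ b) :
    Spec (clearCmd r y) s ((b + 1) * 13) (PMF.pure (Function.update s r [])) := by
  have := spec_drain (r := r) (y := y) (body := .pop r) (T := 1)
    (L := s r) (fun l _ => Function.update s r l) (fun l p => by simp)
    (fun v l p hv => by
      have s2 := spec_pop r (Function.update s r (v :: l))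
      simpa only [Function.update_self, Function.update_idem, List.tail_cons] using s2) []
  simp only [Function.update_eq_self] at this
  exact this.mono (drain_time hb)

def krev (a b : ℕ) : Kern := fun _ U =>
  PMF.pure (Function.update (Function.update U a []) b ((U a).reverse ++ U b))

def kclear (a : ℕ) : Kern := fun _ U => PMF.pure (Function.update U a [])

def kdup (a b : ℕ) : Kern := fun _ U => PMF.pure (Function.update U b (U a ++ U b))

theorem eff_krev {a b : ℕ} (h : a ≠ b) : Eff (krev a b) := by
  refine ⟨moveCmd (uR a) (uR b) (sR 2), (Polynomial.X + 1) * (Polynomial.X + 14),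
    fun n κ U C h1 h2 _ => ?_⟩
  have := spec_move (r := uR a) (r' := uR b) (y := sR 2) (by simpa using h) (frame κ C U)
    (b := n) (by rw [frame_uR]; exact h2 a)
  rw [krev, PMF.pure_map]
  simpa [frame] using this

theorem eff_kclear (a : ℕ) : Eff (kclear a) := by
  refine ⟨clearCmd (uR a) (sR 2), (Polynomial.X + 1) * 13, fun n κ U C h1 h2 _ => ?_⟩
  have := spec_clear (r := uR a) (y := sR 2) (frame κ C U)
    (b := n) (by rw [frame_uR]; exact h2 a)
  rw [kclear, PMF.pure_map]
  simpa [frame] using this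

/-- Only the top of a stack can be read, so the stack is first reversed onto a scratch stack and
then unloaded onto both destinations at once, which also restores the source and the order. -/
theorem eff_kdup {a b : ℕ} (h : a ≠ b) : Eff (kdup a b) := by
  refine ⟨.seq (moveCmd (uR a) (sR 1) (sR 2)) (drain (sR 1) (sR 2)
    (.seq (.copy (sR 1) (uR a)) (.seq (.copy (sR 1) (uR b)) (.pop (sR 1))))),
    2 * (Polynomial.X + 1) * (2 * Polynomial.X + 20), fun n κ U C h1 h2 _ => ?_⟩
  have s0 := spec_move (r := uR a) (r' := sR 1) (y := sR 2) (by simp) (frame κ C U)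
    (b := n) (by rw [frame_uR]; exact h2 a)
  simp only [frame, mem_uR, mem_sR, sys_one, update_mem_uR, update_mem_sR, update_sys_one,
    List.append_nil] at s0
  have s1 := spec_drain (r := sR 1) (y := sR 2)
    (body := .seq (.copy (sR 1) (uR a)) (.seq (.copy (sR 1) (uR b)) (.pop (sR 1))))
    (T := 2 * n + 3) (L := (U a).reverse)
    (fun l p => mem (Function.update (Function.update U a p) b (p ++ U b)) (sys κ l [] C) (st []))
    (fun l p => by simp)
    (fun v l p hv => by
      have h3 := size_le_of_mem (List.mem_reverse.1 hv)
      have h4 := h2 a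
      set V := Function.update (Function.update U a p) b (p ++ U b) with hV
      have hVa : V a = p := by simp [hV, h]
      have hVb : Function.update V a (v :: p) b = p ++ U b := by simp [hV, Ne.symm h]
      have s1 := spec_copy (sR 1) (uR a) (mem V (sys κ (v :: l) [] C) (st []))
      have s2 := spec_copy (sR 1) (uR b)
        (mem (Function.update V a (v :: p)) (sys κ (v :: l) [] C) (st []))
      have s3 := spec_pop (sR 1) (mem (Function.update (Function.update V a (v :: p)) b
        (v :: (p ++ U b))) (sys κ (v :: l) [] C) (st []))
      simp only [State.push, State.top, mem_uR, mem_sR, update_mem_sR, update_mem_uR,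
        update_sys_one, sys_one, List.headD_cons, List.tail_cons, hVa, hVb] at s1 s2 s3
      have hW : Function.update (Function.update V a (v :: p)) b (v :: (p ++ U b)) =
          Function.update (Function.update U a (v :: p)) b (v :: p ++ U b) := by
        funext x
        by_cases hx : x = b
        · subst hx; simp
        · by_cases hx' : x = a
          · subst hx'; simp [hx]
          · simp [hx, hx', hV]
      rw [hW] at s2 s3
      exact (s1.seq_pure (s2.seq_pure s3)).mono (by omega)) []
  simp only [List.nil_append, List.append_nil, List.reverse_reverse] at s1
  have hU : Function.update (Function.update U a []) b (U b) = Function.update U a [] := by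
    rw [Function.update_comm h, Function.update_eq_self]
  rw [hU] at s1
  simp only [Function.update_eq_self] at s1
  have := s0.seq_pure s1
  rw [kdup, PMF.pure_map]
  refine this.mono ?_
  have := drain_time (T := 2 * n + 3 + 12) ((bitSize_reverse (U a)).le.trans (h2 a))
  simp only [Polynomial.eval_mul, Polynomial.eval_add, Polynomial.eval_X, Polynomial.eval_one,
    Polynomial.eval_ofNat]
  nlinarith

/-! ## Subroutines -/

theorem PPT.exists_spec (M : PPT) (κ : ℕ) (x : List ℕ) : ∃ D : PMF State,
    Spec M.prog (init κ x) (M.bound.eval (κ + bitSize x)) D ∧ D.map (fun s => s 0) = M.run κ x := by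
  refine ⟨_, Spec.of_halts (M.halts κ x), ?_⟩
  rw [PPT.run, PMF.map_comp]
  refine map_congr_support _ fun r hr => ?_
  rcases r with _ | r
  · exact absurd hr (M.halts κ x)
  · rfl

theorem PPT.bitSize_le (M : PPT) {κ : ℕ} {x y : List ℕ} (hy : y ∈ (M.run κ x).support) :
    bitSize y ≤ bitSize x + 2 * M.bound.eval (κ + bitSize x) := by
  obtain ⟨D, h1, h2⟩ := M.exists_spec κ x
  rw [← h2, PMF.mem_support_map_iff] at hy
  obtain ⟨s, hs, rfl⟩ := hy
  simpa [init] using h1.bitSize_le hs 0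

/-- Replace a stack by the output of a subroutine on it. -/
def kcall (M : PPT) (a : ℕ) : Kern := fun κ U => (M.run κ (U a)).map (Function.update U a)

def clearAll : ℕ → Cmd
  | 0 => .skip
  | n + 1 => .seq (clearCmd (wR n) (sR 2)) (clearAll n)

theorem spec_clearAll (U S : State) {b : ℕ} : ∀ n (w : State), (∀ x, bitSize (w x) ≤ b) →
    Spec (clearAll n) (mem U S w) (n * ((b + 1) * 13) + 1)
      (PMF.pure (mem U S fun x => if x < n then [] else w x)) := by
  intro n
  induction n with
  | zero => intro w _; simpa [clearAll] using spec_skip (mem U S w)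
  | succ n ih =>
    intro w hw
    have s1 := spec_clear (r := wR n) (y := sR 2) (b := b) (mem U S w) (by simpa using hw n)
    rw [update_mem_wR] at s1
    have s2 := ih (Function.update w n []) fun x => by
      by_cases hx : x = n
      · subst hx; simp
      · simpa [hx] using hw x
    have := s1.seq_pure s2
    have hf : (fun x => if x < n then [] else Function.update w n [] x) =
        fun x => if x < n + 1 then [] else w x := by
      funext x
      by_cases h1 : x < n
      · simp [h1, show x < n + 1 by omega]
      · by_cases h2 : x = n
        · subst h2; simp
        · simp [h1, h2, show ¬ x < n + 1 by omega]
    rw [hf] at this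
    exact this.mono (by rw [add_mul n 1]; omega)

/-- The input is moved twice, because each move reverses it, into the renamed registers, where the
initial state of the subroutine is reproduced. Afterwards the output is moved back and every
register that the subroutine may have touched is emptied, as the next statement expects a clean
frame. -/
theorem eff_kcall (M : PPT) (a : ℕ) : Eff (kcall M a) := by
  refine ⟨.seq (moveCmd (uR a) (sR 1) (sR 2)) (.seq (moveCmd (sR 1) (wR 0) (sR 2))
    (.seq (.copy (sR 0) (wR 1)) (.seq (M.prog.rename wR)
    (.seq (moveCmd (wR 0) (sR 1) (sR 2)) (.seq (moveCmd (sR 1) (uR a) (sR 2))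
    (clearAll (M.prog.regs + 2))))))),
    (let B := 2 * Polynomial.X + 1 + 2 * M.bound.comp (2 * Polynomial.X)
     (2 * ((Polynomial.X + 1) * (Polynomial.X + 14)) + (1 + Polynomial.X) +
      M.bound.comp (2 * Polynomial.X) + 2 * ((B + 1) * (B + 14)) +
      ((M.prog.regs + 2 : ℕ) : Polynomial ℕ) * ((B + 1) * 13) + 1)), fun n κ U C h1 h2 _ => ?_⟩
  obtain ⟨D, hD, hrun⟩ := M.exists_spec κ (U a)
  have hT : M.bound.eval (κ + bitSize (U a)) ≤ M.bound.eval (2 * n) :=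
    polynomial_eval_mono _ (by have := h2 a; omega)
  set T := M.bound.eval (2 * n) with hTdef
  set B := 2 * n + 1 + 2 * T with hB
  replace hD := hD.mono hT
  set U₀ := Function.update U a [] with hU₀
  have s1 := spec_move (r := uR a) (r' := sR 1) (y := sR 2) (by simp) (frame κ C U)
    (b := n) (by rw [frame_uR]; exact h2 a)
  simp only [frame, mem_uR, mem_sR, sys_one, update_mem_uR, update_mem_sR, update_sys_one,
    List.append_nil] at s1
  have s2 := spec_move (r := sR 1) (r' := wR 0) (y := sR 2) (by simp)
    (mem U₀ (sys κ (U a).reverse [] C) (st [])) (b := n) (by simpa using h2 a)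
  simp only [mem_sR, mem_wR, sys_one, update_mem_sR, update_mem_wR, update_sys_one,
    List.reverse_reverse] at s2
  have s3 := spec_copy (sR 0) (wR 1) (mem U₀ (sys κ [] [] C) (Function.update (st []) 0 (U a)))
  have hinit : Function.update (Function.update (st []) 0 (U a)) 1 [κ] = init κ (U a) := by
    funext x
    rcases x with _ | _ | x <;> simp [init, st]
  simp only [State.push, State.top, mem_sR, mem_wR, sys_zero, update_mem_wR, List.headD_cons,
    show st [] 0 = ([] : List ℕ) from rfl,
    show Function.update (st []) 0 (U a) 1 = ([] : List ℕ) from rfl, List.append_nil,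
    hinit] at s2 s3
  have s4 := hD.rename (f := wR) (J := mem U₀ (sys κ [] [] C)) (by simp) (by simp)
  have hκ : κ.size ≤ n := (Nat.size_le.2 (Nat.lt_pow_self (by norm_num))).trans h1
  have s5 : ∀ s' ∈ (D.map (mem U₀ (sys κ [] [] C))).support,
      Spec (.seq (moveCmd (wR 0) (sR 1) (sR 2)) (.seq (moveCmd (sR 1) (uR a) (sR 2))
        (clearAll (M.prog.regs + 2)))) s'
        (2 * ((B + 1) * (B + 14)) + ((M.prog.regs + 2) * ((B + 1) * 13) + 1))
        (PMF.pure (frame κ C (Function.update U a (s' (wR 0))))) := by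
    intro s' hs'
    rw [PMF.mem_support_map_iff] at hs'
    obtain ⟨w, hw, rfl⟩ := hs'
    have hwB : ∀ x, bitSize (w x) ≤ B := by
      intro x
      have h4 := hD.bitSize_le hw x
      -- The largest initial stack is the input, of size at most `n`, or the single entry `κ`, of
      -- size at most `n + 1`. The running time `T` adds at most `2 * T`.
      have h5 : bitSize (init κ (U a) x) ≤ 2 * n + 1 := by
        have := h2 a
        unfold init
        split_ifs <;> simp <;> omega
      omega
    have t1 := spec_move (r := wR 0) (r' := sR 1) (y := sR 2) (by simp)
      (mem U₀ (sys κ [] [] C) w) (b := B) (by simpa using hwB 0)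
    simp only [mem_sR, mem_wR, sys_one, update_mem_sR, update_mem_wR, update_sys_one,
      List.append_nil] at t1
    have t2 := spec_move (r := sR 1) (r' := uR a) (y := sR 2) (by simp)
      (mem U₀ (sys κ (w 0).reverse [] C) (Function.update w 0 [])) (b := B) (by simpa using hwB 0)
    simp only [mem_sR, mem_uR, sys_one, update_mem_sR, update_mem_uR, update_sys_one,
      List.reverse_reverse] at t2
    rw [hU₀, Function.update_self, List.append_nil, Function.update_idem] at t2
    have t3 := spec_clearAll (Function.update U a (w 0)) (sys κ [] [] C) (b := B)
      (M.prog.regs + 2) (Function.update w 0 []) (fun x => by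
        by_cases hx : x = 0
        · subst hx; simp
        · simpa [hx] using hwB x)
    have hclean : (fun x => if x < M.prog.regs + 2 then [] else Function.update w 0 [] x) =
        st [] := by
      funext x
      by_cases hx : x < M.prog.regs + 2
      · simp [hx, st]
      · rw [if_neg hx, Function.update_of_ne (by omega), hD.apply_of_le hw (by omega)]
        simp [init, st, show x ≠ 0 by omega, show x ≠ 1 by omega]
    rw [hclean] at t3
    rw [mem_wR]
    exact (t1.seq_pure (t2.seq_pure t3)).mono (by omega)
  have := s1.seq_pure (s2.seq_pure (s3.seq_pure (s4.seq s5)))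
  have hfin : (kcall M a κ U).map (frame κ C) = (D.map (mem U₀ (sys κ [] [] C))).bind
      fun s' => PMF.pure (frame κ C (Function.update U a (s' (wR 0)))) := by
    rw [kcall, ← hrun, PMF.bind_map, PMF.map_comp, PMF.map_comp, map_eq_bind]
    simp [Function.comp_def]
  rw [hfin]
  refine this.mono ?_
  simp only [Polynomial.eval_mul, Polynomial.eval_add, Polynomial.eval_X, Polynomial.eval_one,
    Polynomial.eval_ofNat, Polynomial.eval_comp, Polynomial.eval_natCast, Nat.cast_id]
  rw [← hTdef, ← hB]
  omega

/-- A polynomial-time kernel is a polynomial-time algorithm. -/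
theorem Eff.exists_ppt {F : Kern} (hF : Eff F) :
    ∃ M : PPT, ∀ κ x, M.run κ x = (F κ (st [x])).map fun U => U 0 := by
  obtain ⟨c, P, hF⟩ := hF
  have key : ∀ κ x, Spec c (init κ x) (P.eval (κ + bitSize x))
      ((F κ (st [x])).map (frame κ [])) := by
    intro κ x
    rw [init_eq_mem]
    refine hF _ κ (st [x]) [] (by omega) (fun a => ?_) trivial
    rcases a with _ | a <;> simp [st]
  refine ⟨⟨c, P, fun κ x => (key κ x).none_notMem le_rfl⟩, fun κ x => ?_⟩
  have h := (key κ x).final (st []) le_rfl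
  have h2 := congrArg (PMF.map fun s : State => s 0) h
  rw [PMF.map_comp, PMF.map_comp] at h2
  have h3 : (F κ (st [x])).map (fun U => U 0) =
      (F κ (st [x])).map ((fun s : State => s 0) ∘ frame κ []) := rfl
  rw [h3, ← h2, PPT.run]
  refine map_congr_support _ fun r _ => ?_
  rcases r with _ | r <;> rfl

/-! ## Loops -/

/-- Run `F` once for every element of a list, pushing the element on the stack `b` first. -/
def kforList (b : ℕ) (F : Kern) : List ℕ → Kern
  | [] => fun _ U => PMF.pure U
  | s :: l => fun κ U => (F κ (U.push b s)).bind (kforList b F l κ)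

/-- Run `F` once for every element of the stack `a`. -/
def kfor (a b : ℕ) (F : Kern) : Kern := fun κ U => kforList b F (U a) κ (Function.update U a [])

/-- The loop elements on the control stack, each preceded by the mark `1`. -/
def marked : List ℕ → List ℕ → List ℕ
  | [], C => 0 :: C
  | s :: l, C => 1 :: s :: marked l C

def forCmd (a b : ℕ) (c : Cmd) : Cmd :=
  .seq (.push (sR 3) 0) (.seq (moveCmd (uR a) (sR 1) (sR 2))
  (.seq (drain (sR 1) (sR 2) (.seq (.copy (sR 1) (sR 3)) (.seq (.push (sR 3) 1) (.pop (sR 1)))))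
  (.seq (.while (sR 3) (.seq (.pop (sR 3)) (.seq (.copy (sR 3) (uR b))
    (.seq (.pop (sR 3)) c)))) (.pop (sR 3)))))

/-- Composing a polynomial size bound with itself once per iteration would give exponential growth.
The growth per iteration is therefore bounded by `G` of the initial size `n`, and the invariant `I`,
which relates the current state to the initial one, supplies whatever is needed for that. Loops may
nest because the loop elements lie on the control stack above an arbitrary `C`. -/
theorem EffOn.for {Pre Pre' : ℕ → State → Prop} {F : Kern} (hF : EffOn Pre' F) (a b : ℕ)
    (I : ℕ → State → State → Prop) (G : Polynomial ℕ)
    (h0 : ∀ κ U, Pre κ U → I κ U (Function.update U a []))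
    (h1 : ∀ κ U₀ U s, I κ U₀ U → s ∈ U₀ a → Pre' κ (U.push b s))
    (h2 : ∀ n κ U₀ U s U', κ ≤ n → (∀ r, bitSize (U₀ r) ≤ n) → I κ U₀ U → s ∈ U₀ a →
      U' ∈ (F κ (U.push b s)).support →
      I κ U₀ U' ∧ ∀ r, bitSize (U' r) ≤ bitSize (U r) + G.eval n) :
    EffOn Pre (kfor a b F) := by
  obtain ⟨c, P, hF⟩ := hF
  refine ⟨forCmd a b c,
    2 * ((Polynomial.X + 1) * (Polynomial.X + 20)) +
      Polynomial.X * (P.comp (2 * Polynomial.X + Polynomial.X * G) + Polynomial.X + 10) + 10,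
    fun n κ U₀ C hκ hn hpre => ?_⟩
  -- At most `n` iterations add `G(n)` each to an initial size of at most `n`; the remaining `n`
  -- accounts for the loop element that is pushed before the body runs.
  set B := 2 * n + n * G.eval n with hB
  have key : ∀ (l : List ℕ) (U : State), l ⊆ U₀ a → l.length ≤ n → I κ U₀ U →
      (∀ r, bitSize (U r) + l.length * G.eval n ≤ n + n * G.eval n) →
      Spec (.while (sR 3) (.seq (.pop (sR 3)) (.seq (.copy (sR 3) (uR b)) (.seq (.pop (sR 3)) c))))
        (frame κ (marked l C) U) (l.length * (P.eval B + n + 10) + 1)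
        ((kforList b F l κ U).map (frame κ (0 :: C))) := by
    intro l
    induction l with
    | nil =>
      intro U _ _ _ _
      rw [kforList, PMF.pure_map]
      exact (Spec.while_zero (by simp [frame, State.top, marked])).mono (by omega)
    | cons s l ih =>
      intro U hl hlen hI hU
      have hs : s ∈ U₀ a := hl (by simp)
      have hsn : s.size + 1 ≤ n := (size_le_of_mem hs).trans (hn a)
      have s1 := spec_pop (sR 3) (frame κ (marked (s :: l) C) U)
      have s2 := spec_copy (sR 3) (uR b) (frame κ (s :: marked l C) U)
      have s3 := spec_pop (sR 3) (frame κ (s :: marked l C) (U.push b s))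
      simp only [frame, marked, State.push, State.top, mem_sR, mem_uR, sys_three, List.tail_cons,
        update_mem_sR, update_sys_three, update_mem_uR, List.headD_cons] at s1 s2 s3
      have hpush : ∀ r, bitSize (U.push b s r) ≤ B := by
        intro r
        have h3 := bitSize_push_le U b s r
        have h4 := hU r
        rw [hB]
        have : bitSize (U r) ≤ n + n * G.eval n := le_trans (Nat.le_add_right _ _) h4
        omega
      have s4 := hF B κ (U.push b s) (marked l C) (by omega) hpush (h1 κ U₀ U s hI hs)
      have hbody := s1.seq_pure (s2.seq_pure (s3.seq_pure s4))
      have := Spec.while_ne_zero (E := fun s' =>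
        (kforList b F l κ (fun r => s' (uR r))).map (frame κ (0 :: C)))
        (T' := l.length * (P.eval B + n + 10) + 1) (a := sR 3) (by simp [State.top]) hbody
        (fun s' hs' => by
          rw [PMF.mem_support_map_iff] at hs'
          obtain ⟨U', hU', rfl⟩ := hs'
          obtain ⟨hI', hg⟩ := h2 n κ U₀ U s U' hκ hn hI hs hU'
          simp only [frame_uR]
          refine ih U' (fun x hx => hl (by simp [hx])) (by simp at hlen; omega) hI' fun r => ?_
          have h5 := hg r
          have h6 := hU r
          simp only [List.length_cons, add_mul, one_mul] at h6
          omega)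
      rw [PMF.bind_map] at this
      simp only [Function.comp_def, frame_uR] at this
      rw [kforList, PMF.map_bind]
      refine this.mono ?_
      simp only [List.length_cons, add_mul, one_mul]
      omega
  have s0 := spec_push (sR 3) 0 (frame κ C U₀)
  have s1 := spec_move (r := uR a) (r' := sR 1) (y := sR 2) (by simp) (frame κ (0 :: C) U₀)
    (b := n) (by rw [frame_uR]; exact hn a)
  -- The second reversal restores the order and at the same time interleaves the marks.
  have s2 := spec_drain (r := sR 1) (y := sR 2)
    (body := .seq (.copy (sR 1) (sR 3)) (.seq (.push (sR 3) 1) (.pop (sR 1))))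
    (T := n + 4) (L := (U₀ a).reverse)
    (fun l p => mem (Function.update U₀ a []) (sys κ l [] (marked p C)) (st []))
    (fun l p => by simp)
    (fun v l p hv => by
      have h3 := size_le_of_mem (List.mem_reverse.1 hv)
      have h4 := hn a
      have s1 := spec_copy (sR 1) (sR 3)
        (mem (Function.update U₀ a []) (sys κ (v :: l) [] (marked p C)) (st []))
      have s2 := spec_push (sR 3) 1
        (mem (Function.update U₀ a []) (sys κ (v :: l) [] (v :: marked p C)) (st []))
      have s3 := spec_pop (sR 1)
        (mem (Function.update U₀ a []) (sys κ (v :: l) [] (marked (v :: p) C)) (st []))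
      simp only [State.push, State.top, mem_sR, update_mem_sR, update_sys_three, update_sys_one,
        sys_one, sys_three, List.headD_cons, List.tail_cons] at s1 s2 s3
      exact (s1.seq_pure (s2.seq_pure s3)).mono (by simp; omega)) []
  have hlen := (length_le_bitSize (U₀ a)).trans (hn a)
  have s3 := key (U₀ a) (Function.update U₀ a []) (List.Subset.refl _) hlen (h0 κ U₀ hpre)
    (fun r => by
      have h4 : bitSize (Function.update U₀ a [] r) ≤ n := by
        by_cases hr : r = a
        · subst hr; simp
        · simpa [hr] using hn r
      exact Nat.add_le_add h4 (Nat.mul_le_mul_right _ hlen))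
  have s4 : ∀ s' ∈ ((kforList b F (U₀ a) κ (Function.update U₀ a [])).map
      (frame κ (0 :: C))).support,
      Spec (.pop (sR 3)) s' 1 (PMF.pure (Function.update s' (sR 3) (s' (sR 3)).tail)) :=
    fun s' _ => spec_pop (sR 3) s'
  simp only [frame, State.push, mem_uR, mem_sR, sys_one, sys_three, update_mem_uR, update_mem_sR,
    update_sys_one, update_sys_three, List.append_nil] at s0 s1
  simp only [List.append_nil, List.reverse_reverse] at s2
  have := s0.seq_pure (s1.seq_pure (s2.seq_pure (s3.seq s4)))
  have hfin : (kfor a b F κ U₀).map (frame κ C) = ((kforList b F (U₀ a) κ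
      (Function.update U₀ a [])).map (frame κ (0 :: C))).bind fun s' =>
        PMF.pure (Function.update s' (sR 3) (s' (sR 3)).tail) := by
    rw [kfor, PMF.bind_map, map_eq_bind]
    simp [Function.comp_def, frame]
  rw [hfin]
  refine this.mono ?_
  have h5 := drain_time (T := n + 4 + 12) ((bitSize_reverse (U₀ a)).le.trans (hn a))
  have h6 : (U₀ a).length * (P.eval B + n + 10) ≤ n * (P.eval B + n + 10) :=
    Nat.mul_le_mul_right _ hlen
  simp only [Polynomial.eval_mul, Polynomial.eval_add, Polynomial.eval_X, Polynomial.eval_one,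
    Polynomial.eval_ofNat, Polynomial.eval_comp, Nat.size_zero]
  rw [← hB]
  nlinarith

/-- A `while` loop with a deterministic body. -/
theorem EffOn.while {Pre Pre' : ℕ → State → Prop} {g h : State → State} (a : ℕ)
    (N : ℕ → State → ℕ) (hg : EffOn Pre' fun _ U => PMF.pure (g U)) (Q : Polynomial ℕ)
    (h1 : ∀ κ U, Pre κ U → ∀ j < N κ U, (g^[j] U).top a ≠ 0 ∧ Pre' κ (g^[j] U))
    (h2 : ∀ κ U, Pre κ U → (g^[N κ U] U).top a = 0 ∧ g^[N κ U] U = h U)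
    (h3 : ∀ n κ U, κ ≤ n → (∀ r, bitSize (U r) ≤ n) → Pre κ U →
      N κ U ≤ Q.eval n ∧ ∀ j < N κ U, ∀ r, bitSize (g^[j] U r) ≤ Q.eval n) :
    EffOn Pre fun _ U => PMF.pure (h U) := by
  obtain ⟨c, P, hg⟩ := hg
  refine ⟨.while (uR a) c, Q * (P.comp (Q + Polynomial.X) + 1) + 1, fun n κ U C hκ hn hpre => ?_⟩
  obtain ⟨hN, hQ⟩ := h3 n κ U hκ hn hpre
  -- Here `k` is the number of iterations still to come, so the induction runs backwards from the
  -- end of the loop.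
  have key : ∀ k, k ≤ N κ U → Spec (.while (uR a) c) (frame κ C (g^[N κ U - k] U))
      (k * (P.eval (Q.eval n + n) + 1) + 1) (PMF.pure (frame κ C (h U))) := by
    intro k
    induction k with
    | zero =>
      intro _
      obtain ⟨h4, h5⟩ := h2 κ U hpre
      rw [h5] at h4
      rw [Nat.sub_zero, h5]
      exact (Spec.while_zero (by simpa [frame, State.top] using h4)).mono (by omega)
    | succ k ih =>
      intro hk
      have hlt : N κ U - (k + 1) < N κ U := by omega
      obtain ⟨h4, h5⟩ := h1 κ U hpre _ hlt
      have s1 := hg (Q.eval n + n) κ (g^[N κ U - (k + 1)] U) C (by omega)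
        (fun r => (hQ _ hlt r).trans (by omega)) h5
      rw [PMF.pure_map, ← Function.iterate_succ_apply' g,
        show (N κ U - (k + 1)).succ = N κ U - k by omega] at s1
      have := Spec.while_ne_zero_pure (a := uR a) (by simpa [frame, State.top] using h4) s1
        (ih (by omega))
      refine this.mono ?_
      rw [add_mul k 1]; omega
  have := key (N κ U) le_rfl
  rw [Nat.sub_self, Function.iterate_zero, id] at this
  rw [PMF.pure_map]
  refine this.mono ?_
  simp only [Polynomial.eval_mul, Polynomial.eval_add, Polynomial.eval_X, Polynomial.eval_one,
    Polynomial.eval_comp]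
  have := Nat.mul_le_mul_right (P.eval (Q.eval n + n) + 1) hN
  omega

/-! ## Unary and binary representations -/

/-- The binary digits of a number, most significant digit first. -/
def digitsMSB (v : ℕ) : List ℕ := (Nat.digits 2 v).reverse

/-- Push the binary digits of `e` on the stack `b`. -/
def kdigits (b : ℕ) (e : Expr) : Kern := fun _ U =>
  PMF.pure (Function.update U b (digitsMSB (e.eval U) ++ U b))

def digitsStep (a b : ℕ) (U : State) : State :=
  Function.update (Function.update U b (U.top a % 2 :: U b)) a (U.top a / 2 :: (U a).tail)

theorem top_update_of_ne {U : State} {a b : ℕ} {l : List ℕ} (h : a ≠ b) :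
    State.top (Function.update U b l) a = U.top a := by
  simp [State.top, h]

theorem top_update_self {U : State} {a : ℕ} {l : List ℕ} :
    State.top (Function.update U a l) a = l.headD 0 := by
  simp [State.top]

theorem digitsStep_iterate {a b : ℕ} (hab : a ≠ b) (U : State) (hU : U a ≠ []) :
    ∀ j ≤ (Nat.digits 2 (U.top a)).length, (digitsStep a b)^[j] U =
      Function.update (Function.update U b (((Nat.digits 2 (U.top a)).take j).reverse ++ U b)) a
        (U.top a / 2 ^ j :: (U a).tail) := by
  intro j
  induction j with
  | zero =>
    intro _
    have : U.top a :: (U a).tail = U a := by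
      cases h : U a with
      | nil => exact absurd h hU
      | cons x l => simp [State.top, h]
    simp [this]
  | succ j ih =>
    intro hj
    have h1 := Nat.getD_digits (U.top a) j (le_refl 2)
    rw [Function.iterate_succ_apply', ih (by omega), digitsStep]
    simp only [top_update_self, List.headD_cons, Function.update_self, List.tail_cons,
      Function.update_of_ne hab.symm]
    rw [List.take_add_one, List.reverse_append, ← h1, List.getD_eq_getElem?_getD,
      List.getElem?_eq_getElem (by omega), Nat.div_div_eq_div_mul, ← pow_succ]
    funext x
    by_cases hx : x = a
    · subst hx; simp
    · by_cases hx' : x = b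
      · subst hx'; simp [hx]
      · simp [hx, hx']

theorem eff_kdigits (b : ℕ) (e : Expr) : Eff (kdigits b e) := by
  -- Any register other than `b` can serve as scratch: the value is pushed on top of its contents
  -- and popped in the end.
  obtain ⟨a, hab⟩ : ∃ a : ℕ, a ≠ b := ⟨b + 1, by omega⟩
  have hstep : Eff fun _ U => PMF.pure (digitsStep a b U) := by
    refine ((eff_kpush b (.var a % 2)).seq (eff_kset a (.var a / 2))).congr fun κ U _ => ?_
    simp only [kseq, kpush, kset, PMF.pure_bind, State.push, Expr.eval_div, Expr.eval_mod,
      Expr.eval_var, Expr.eval_ofNat, top_update_of_ne hab, Function.update_of_ne hab]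
    rfl
  have hlt : ∀ U : State, ∀ j < (Nat.digits 2 (U.top a)).length, U.top a / 2 ^ j ≠ 0 := by
    intro U j hj h
    have := (Nat.lt_digits_length_iff (le_refl 2) (U.top a)).1 hj
    rw [Nat.div_eq_zero_iff] at h
    rcases h with h | h
    · simp at h
    · omega
  have hwhile : EffOn (fun _ U => U a ≠ []) fun _ U => PMF.pure
      (Function.update (Function.update U b (digitsMSB (U.top a) ++ U b)) a (0 :: (U a).tail)) := by
    refine EffOn.while (Pre' := fun _ _ => True) a (fun _ U => (Nat.digits 2 (U.top a)).length)
      hstep (4 * Polynomial.X + 4) ?_ ?_ ?_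
    · intro κ U hU j hj
      rw [digitsStep_iterate hab U hU j hj.le, top_update_self]
      exact ⟨hlt U j hj, trivial⟩
    · intro κ U hU
      have h0 : U.top a / 2 ^ (Nat.digits 2 (U.top a)).length = 0 :=
        Nat.div_eq_of_lt (Nat.lt_base_pow_length_digits (le_refl 2))
      rw [digitsStep_iterate hab U hU _ le_rfl, top_update_self, h0, List.take_length]
      exact ⟨rfl, rfl⟩
    · intro n κ U hκ hn hU
      have hlen : (Nat.digits 2 (U.top a)).length ≤ n := by
        by_contra h
        push Not at h
        have h1 := (Nat.lt_digits_length_iff (le_refl 2) (U.top a)).1 h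
        have h2 := Nat.lt_size.2 h1
        have h3 := (size_head_le (U a)).trans (hn a)
        simp only [State.top] at h2
        omega
      simp only [Polynomial.eval_add, Polynomial.eval_mul, Polynomial.eval_ofNat,
        Polynomial.eval_X]
      refine ⟨by omega, fun j hj r => ?_⟩
      rw [digitsStep_iterate hab U hU j hj.le]
      have hb : bitSize (Nat.digits 2 (U.top a)) ≤ 2 * (Nat.digits 2 (U.top a)).length := by
        have hd : ∀ d ∈ Nat.digits 2 (U.top a), d < 2 := fun d hd => Nat.digits_lt_base (by norm_num) hd
        generalize Nat.digits 2 (U.top a) = L at hd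
        induction L with
        | nil => simp
        | cons d L ih =>
          have h1 := ih fun x hx => hd x (by simp [hx])
          have h2 : d.size ≤ 1 := Nat.size_le.2 (by simpa using hd d (by simp))
          simp only [bitSize_cons, List.length_cons]
          omega
      by_cases hr : r = a
      · subst hr
        simp only [Function.update_self, bitSize_cons]
        have h1 := Nat.size_le_size (Nat.div_le_self (U.top r) (2 ^ j))
        have h2 := (size_head_le (U r)).trans (hn r)
        have h3 := (bitSize_tail_le (U r)).trans (hn r)
        simp only [State.top] at *
        omega
      · rw [Function.update_of_ne hr]
        by_cases hr' : r = b
        · subst hr'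
          rw [Function.update_self, bitSize_append, bitSize_reverse]
          have h1 : bitSize ((Nat.digits 2 (U.top a)).take j) ≤ bitSize (Nat.digits 2 (U.top a)) := by
            conv_rhs => rw [← List.take_append_drop j (Nat.digits 2 (U.top a)), bitSize_append]
            omega
          have h2 := hn r
          omega
        · rw [Function.update_of_ne hr']
          exact (hn r).trans (by omega)
  have hpush : EffOn (fun _ _ => True) (kseq (kpush a e) fun _ U => PMF.pure
      (Function.update (Function.update U b (digitsMSB (U.top a) ++ U b)) a (0 :: (U a).tail))) :=
    EffOn.seq (eff_kpush a e) hwhile fun κ U U' _ h => by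
      rw [kpush, PMF.mem_support_pure_iff] at h
      subst h
      simp [State.push]
  refine (Eff.seq hpush (eff_kpop a)).congr fun κ U _ => ?_
  simp only [kseq, kpush, kpop, kdigits, PMF.pure_bind, State.push_top]
  congr 1
  funext x
  by_cases hx : x = a
  · subst hx; simp [State.push, hab]
  · by_cases hx' : x = b
    · subst hx'; simp [State.push, hx]
    · simp [State.push, hx, hx']

/-- Push `N κ` zeros on the stack `b`, using the stack `a` as scratch space. -/
def kunary (N : ℕ → ℕ) (a b : ℕ) : Kern := fun κ U =>
  PMF.pure (Function.update (Function.update U a []) b (List.replicate (N κ) 0 ++ U b))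

def unaryStep (a b : ℕ) (U : State) : State :=
  Function.update (Function.update U b (0 :: U b)) a ((U.top a - 1) :: (U a).tail)

theorem unaryStep_iterate {a b : ℕ} (hab : a ≠ b) (U : State) (hU : U a ≠ []) (j : ℕ) :
    (unaryStep a b)^[j] U =
      Function.update (Function.update U b (List.replicate j 0 ++ U b)) a
        ((U.top a - j) :: (U a).tail) := by
  induction j with
  | zero =>
    have : U.top a :: (U a).tail = U a := by
      cases h : U a with
      | nil => exact absurd h hU
      | cons x l => simp [State.top, h]
    simp [this]
  | succ j ih =>
    rw [Function.iterate_succ_apply', ih, unaryStep]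
    simp only [top_update_self, List.headD_cons, Function.update_self, List.tail_cons,
      Function.update_of_ne hab.symm, Nat.sub_sub, List.replicate_succ, List.cons_append]
    funext x
    by_cases hx : x = a
    · subst hx; simp
    · by_cases hx' : x = b
      · subst hx'; simp [hx]
      · simp [hx, hx']

/-- Replace a stack by the value of a function of the security parameter. -/
def kconst (N : ℕ → ℕ) (a : ℕ) : Kern := fun κ U => PMF.pure (Function.update U a [N κ])

theorem eff_kconst {N : ℕ → ℕ} (hN : PolyTimeComputable N) (a : ℕ) : Eff (kconst N a) := by
  obtain ⟨M, hM⟩ := hN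
  refine ((eff_kclear a).seq (eff_kcall M a)).congr fun κ U _ => ?_
  simp [kseq, kclear, kcall, hM, kconst, PMF.pure_map]

/-- The loop runs `N κ` times, which may be exponential in the length of `N κ`; this is where
polynomial boundedness is needed in addition to computability. -/
theorem eff_kunary {N : ℕ → ℕ} (hN : PolyTimeComputable N) (hN' : PolyBounded N) {a b : ℕ}
    (hab : a ≠ b) : Eff (kunary N a b) := by
  obtain ⟨P, hP⟩ := hN'
  have hstep : Eff fun _ U => PMF.pure (unaryStep a b U) := by
    refine ((eff_kpush b 0).seq (eff_kset a (.var a - 1))).congr fun κ U _ => ?_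
    simp only [kseq, kpush, kset, PMF.pure_bind, State.push, Expr.eval_sub,
      Expr.eval_var, Expr.eval_ofNat, top_update_of_ne hab, Function.update_of_ne hab]
    rfl
  have hwhile : EffOn (fun κ U => U a = [N κ]) fun κ U => PMF.pure
      (Function.update (Function.update U b (List.replicate (U.top a) 0 ++ U b)) a
        (0 :: (U a).tail)) := by
    refine EffOn.while (Pre' := fun _ _ => True) a (fun _ U => U.top a)
      hstep (4 * Polynomial.X + 4 + P) ?_ ?_ ?_
    · intro κ U hU j hj
      rw [unaryStep_iterate hab U (by simp [hU]), top_update_self]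
      exact ⟨by simp; omega, trivial⟩
    · intro κ U hU
      rw [unaryStep_iterate hab U (by simp [hU]), top_update_self, Nat.sub_self]
      exact ⟨rfl, rfl⟩
    · intro n κ U hκ hn hU
      have htop : U.top a = N κ := by simp [State.top, hU]
      have hle : N κ ≤ P.eval n := (hP κ).trans (polynomial_eval_mono P hκ)
      simp only [Polynomial.eval_add, Polynomial.eval_mul, Polynomial.eval_ofNat,
        Polynomial.eval_X, htop]
      refine ⟨by omega, fun j hj r => ?_⟩
      rw [unaryStep_iterate hab U (by simp [hU])]
      by_cases hr : r = a
      · subst hr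
        simp only [Function.update_self, bitSize_cons]
        have h1 := Nat.size_le_size (Nat.sub_le (U.top r) j)
        have h2 := (size_head_le (U r)).trans (hn r)
        have h3 := (bitSize_tail_le (U r)).trans (hn r)
        simp only [State.top] at *
        omega
      · rw [Function.update_of_ne hr]
        by_cases hr' : r = b
        · subst hr'
          rw [Function.update_self, bitSize_append]
          have h1 : bitSize (List.replicate j 0) = j := by simp [bitSize]
          have h2 := hn r
          omega
        · rw [Function.update_of_ne hr']
          exact (hn r).trans (by omega)
  have h2 : EffOn (fun _ _ => True) (kseq (kconst N a) fun κ U => PMF.pure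
      (Function.update (Function.update U b (List.replicate (U.top a) 0 ++ U b)) a
        (0 :: (U a).tail))) :=
    EffOn.seq (eff_kconst hN a) hwhile fun κ U U' _ h => by
      rw [kconst, PMF.mem_support_pure_iff] at h
      subst h
      simp
  refine (Eff.seq h2 (eff_kpop a)).congr fun κ U _ => ?_
  simp only [kseq, kconst, kpop, kunary, PMF.pure_bind, top_update_self]
  congr 1
  funext x
  by_cases hx : x = a
  · subst hx; simp [hab]
  · by_cases hx' : x = b
    · subst hx'; simp [hx]
    · simp [hx, hx']

/-! ## Evaluating kernels on explicit states -/

theorem st_pad (k : ℕ) (x : List ℕ) : st [x] = st (x :: List.replicate k []) := by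
  funext a
  rcases a with _ | a
  · rfl
  · by_cases h : a < k <;> simp [st, h]

theorem st_top (L : List (List ℕ)) (a : ℕ) : (st L).top a = (L.getD a []).headD 0 := rfl

theorem kpush_st {L : List (List ℕ)} {a : ℕ} (e : Expr) (κ : ℕ) (h : a < L.length) :
    kpush a e κ (st L) = PMF.pure (st (L.set a (e.eval (st L) :: L.getD a []))) := by
  rw [kpush, State.push, update_st _ _ _ h, st_apply]

theorem kset_st {L : List (List ℕ)} {a : ℕ} (e : Expr) (κ : ℕ) (h : a < L.length) :
    kset a e κ (st L) = PMF.pure (st (L.set a (e.eval (st L) :: (L.getD a []).tail))) := by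
  rw [kset, update_st _ _ _ h, st_apply]

theorem kpop_st {L : List (List ℕ)} {a : ℕ} (κ : ℕ) (h : a < L.length) :
    kpop a κ (st L) = PMF.pure (st (L.set a (L.getD a []).tail)) := by
  rw [kpop, update_st _ _ _ h, st_apply]

theorem kclear_st {L : List (List ℕ)} {a : ℕ} (κ : ℕ) (h : a < L.length) :
    kclear a κ (st L) = PMF.pure (st (L.set a [])) := by
  rw [kclear, update_st _ _ _ h]

theorem kconst_st {L : List (List ℕ)} {a : ℕ} (N : ℕ → ℕ) (κ : ℕ) (h : a < L.length) :
    kconst N a κ (st L) = PMF.pure (st (L.set a [N κ])) := by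
  rw [kconst, update_st _ _ _ h]

theorem krev_st {L : List (List ℕ)} {a b : ℕ} (κ : ℕ) (ha : a < L.length) (hb : b < L.length) :
    krev a b κ (st L) =
      PMF.pure (st ((L.set a []).set b ((L.getD a []).reverse ++ L.getD b []))) := by
  rw [krev, update_st _ _ _ ha, update_st _ _ _ (by simpa using hb), st_apply, st_apply]

theorem kdup_st {L : List (List ℕ)} {a b : ℕ} (κ : ℕ) (hb : b < L.length) :
    kdup a b κ (st L) = PMF.pure (st (L.set b (L.getD a [] ++ L.getD b []))) := by
  rw [kdup, update_st _ _ _ hb, st_apply, st_apply]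

theorem kunary_st {L : List (List ℕ)} {a b : ℕ} (N : ℕ → ℕ) (κ : ℕ) (ha : a < L.length)
    (hb : b < L.length) : kunary N a b κ (st L) =
      PMF.pure (st ((L.set a []).set b (List.replicate (N κ) 0 ++ L.getD b []))) := by
  rw [kunary, update_st _ _ _ ha, update_st _ _ _ (by simpa using hb), st_apply]

theorem kdigits_st {L : List (List ℕ)} {b : ℕ} (e : Expr) (κ : ℕ)
    (hb : b < L.length) : kdigits b e κ (st L) =
      PMF.pure (st (L.set b (digitsMSB (e.eval (st L)) ++ L.getD b []))) := by
  rw [kdigits, update_st _ _ _ hb, st_apply]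

theorem kunif_st {L : List (List ℕ)} {a : ℕ} (e : Expr) (κ : ℕ) (h : a < L.length) :
    kunif a e κ (st L) = (unifBelow (e.eval (st L))).bind fun r =>
      PMF.pure (st (L.set a (r :: L.getD a []))) := by
  rw [kunif, map_eq_bind]
  simp only [State.push, update_st _ _ _ h, st_apply]

theorem kcall_st {L : List (List ℕ)} {a : ℕ} (M : PPT) (κ : ℕ) (h : a < L.length) :
    kcall M a κ (st L) = (M.run κ (L.getD a [])).bind fun y => PMF.pure (st (L.set a y)) := by
  rw [kcall, map_eq_bind]
  simp only [update_st _ _ _ h, st_apply]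

theorem kfor_st {L : List (List ℕ)} {a b : ℕ} (F : Kern) (κ : ℕ) (h : a < L.length) :
    kfor a b F κ (st L) = kforList b F (L.getD a []) κ (st (L.set a [])) := by
  rw [kfor, update_st _ _ _ h, st_apply]

@[simp] theorem kseqs_nil (κ : ℕ) (U : State) : kseqs [] κ U = PMF.pure U := rfl

@[simp] theorem kseqs_cons (F : Kern) (L : List Kern) (κ : ℕ) (U : State) :
    kseqs (F :: L) κ U = (F κ U).bind (kseqs L κ) := rfl

theorem eff_kseqs_nil : Eff (kseqs []) := eff_kskip

theorem eff_kseqs_cons {F : Kern} {L : List Kern} (hF : Eff F) (hL : Eff (kseqs L)) :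
    Eff (kseqs (F :: L)) := hF.seq hL

theorem kforList_append (b : ℕ) (F : Kern) (l l' : List ℕ) (κ : ℕ) (U : State) :
    kforList b F (l ++ l') κ U = (kforList b F l κ U).bind (kforList b F l' κ) := by
  induction l generalizing U with
  | nil => simp [kforList]
  | cons s l ih =>
    simp only [List.cons_append, kforList, PMF.bind_bind]
    congr 1
    funext V
    exact ih V

/-- Independent samples from a family of distributions. -/
def piPMF {α : Type} : (k : ℕ) → (Fin k → PMF α) → PMF (Fin k → α)
  | 0, _ => PMF.pure Fin.elim0
  | k + 1, f => (f 0).bind fun a => (piPMF k fun j => f j.succ).map fun v =>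
      (Fin.cons a v : Fin (k + 1) → α)

/-- A loop that pushes independent results. -/
theorem kforList_push {β : Type} {b κ : ℕ} {F : Kern} (σ : List β → State) (D : ℕ → PMF β)
    (hF : ∀ s p, F κ ((σ p).push b s) = (D s).map fun r => σ (r :: p)) :
    ∀ {n : ℕ} (s : Fin n → ℕ) (p : List β), kforList b F (List.ofFn s).reverse κ (σ p) =
      (piPMF n fun j => D (s j)).map fun v => σ (List.ofFn v ++ p) := by
  intro n
  induction n with
  | zero => intro s p; simp [kforList, piPMF, PMF.pure_map]
  | succ n ih =>
    intro s p
    rw [List.ofFn_succ, List.reverse_cons, kforList_append, ih, piPMF, PMF.bind_map, PMF.map_bind]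
    simp only [Function.comp_def, kforList, hF, PMF.bind_pure, map_eq_bind, PMF.bind_bind,
      PMF.pure_bind]
    -- The loop draws the sample of index 0 last, whereas `piPMF` draws it first; independent draws
    -- may be exchanged.
    rw [PMF.bind_comm]
    simp

theorem replicate_eq_reverse_ofFn (n : ℕ) :
    List.replicate n 0 = (List.ofFn fun _ : Fin n => 0).reverse := by
  simp

/-! ## Modular exponentiation -/

/-- The summand `1 - m` vanishes for `m > 0` and makes the modulus 1 for `m = 0`. Reduction modulo 0
would return the number unchanged, and repeated squaring would then take exponential time on inputs
with `m = 0`, where the program has to halt as well. -/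
theorem size_mod_modulus_le (x m : ℕ) : (x % (m * m + (1 - m))).size ≤ 2 * m.size + 2 := by
  have hpos : 0 < m * m + (1 - m) := by
    rcases Nat.eq_zero_or_pos m with rfl | h
    · simp
    · have := Nat.mul_pos h h; omega
  have h1 : (x % (m * m + (1 - m))).size ≤ (m * m + (1 - m)).size :=
    Nat.size_le_size (Nat.mod_lt _ hpos).le
  have h2 := size_add_le (m * m) (1 - m)
  have h3 := size_mul_le m m
  rcases Nat.eq_zero_or_pos m with rfl | h
  · exact h1.trans (by simp)
  · rw [Nat.sub_eq_zero_of_le h, Nat.size_zero] at h2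
    rw [Nat.sub_eq_zero_of_le h] at h1 ⊢
    omega

/-- The modulus `m²` (and `1` for `m = 0`). -/
def sqExpr (a : ℕ) : Expr := .var a * .var a + (1 - .var a)

/-- One step of square-and-multiply: stack 1 holds the base, 2 the number whose square is the
modulus, 3 the accumulator and 4 the current bit. For a bit `s`, the factor `(1 - s) + s * r` is `r
^ s`. -/
def powBody : Kern := kseqs [kset 3 ((.var 3 * .var 3 % sqExpr 2 *
  ((1 - .var 4) + .var 4 * .var 1)) % sqExpr 2), kpop 4]

theorem powBody_apply (κ : ℕ) (U : State) (s : ℕ) : powBody κ (U.push 4 s) = PMF.pure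
    (Function.update U 3 ((U.top 3 * U.top 3 % (U.top 2 * U.top 2 + (1 - U.top 2)) *
      ((1 - s) + s * U.top 1)) % (U.top 2 * U.top 2 + (1 - U.top 2)) :: (U 3).tail)) := by
  simp only [powBody, kseqs_cons, kset, kpop, kseqs_nil, PMF.pure_bind, sqExpr, Expr.eval_mod,
    Expr.eval_mul, Expr.eval_add, Expr.eval_sub, Expr.eval_var, Expr.eval_ofNat]
  congr 1
  funext x
  by_cases h3 : x = 3
  · subst h3; simp [State.push, State.top]
  · by_cases h4 : x = 4
    · subst h4; simp [State.push]
    · simp [State.push, h3, h4]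


theorem bitSize_update_cons_tail_le (U : State) (a v r : ℕ) :
    bitSize (Function.update U a (v :: (U a).tail) r) ≤ bitSize (U r) + (v.size + 1) := by
  by_cases h : r = a
  · subst h
    have := bitSize_tail_le (U r)
    simp; omega
  · simp [h]

theorem top_size_le {U : State} {n : ℕ} (h : ∀ r, bitSize (U r) ≤ n) (a : ℕ) :
    (U.top a).size ≤ n := (size_head_le _).trans (h a)

/-- The invariant fixes the modulus, so each new accumulator is bounded in terms of the initial
state only, however large the previous one was. -/
theorem eff_kfor_powBody : Eff (kfor 0 4 powBody) := by
  have hbody : Eff powBody :=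
    eff_kseqs_cons (eff_kset _ _) (eff_kseqs_cons (eff_kpop _) eff_kseqs_nil)
  refine EffOn.for hbody 0 4 (fun _ U₀ U => U.top 2 = U₀.top 2) (2 * Polynomial.X + 4)
    (fun κ U _ => by simp [State.top]) (fun _ _ _ _ _ _ => trivial) ?_
  intro n κ U₀ U s U' _ hn hI _ hU'
  rw [powBody_apply, PMF.mem_support_pure_iff] at hU'
  subst hU'
  refine ⟨by rw [← hI]; simp [State.top], fun r => ?_⟩
  refine (bitSize_update_cons_tail_le U 3 _ r).trans ?_
  have h1 := size_mod_modulus_le (U.top 3 * U.top 3 % (U.top 2 * U.top 2 + (1 - U.top 2)) *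
      ((1 - s) + s * U.top 1)) (U.top 2)
  have h2 := top_size_le hn 2
  rw [← hI] at h2
  simp only [Polynomial.eval_add, Polynomial.eval_mul, Polynomial.eval_ofNat, Polynomial.eval_X]
  omega

/-- Horner's rule in the exponent. The induction is on the digits with the least significant one
first; that digit is processed last, and `d + 2 * e` in the exponent is one squaring followed by one
multiplication by `r ^ d`. -/
theorem kforList_powBody (κ : ℕ) (U : State) (hU : U.top 3 = 1) (L : List ℕ)
    (hL : ∀ d ∈ L, d < 2) : ∃ x, kforList 4 powBody L.reverse κ U =
      PMF.pure (Function.update U 3 (x :: (U 3).tail)) ∧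
      x ≡ U.top 1 ^ Nat.ofDigits 2 L [MOD U.top 2 * U.top 2 + (1 - U.top 2)] := by
  induction L with
  | nil =>
    refine ⟨(U 3).headD 0, ?_, ?_⟩
    · have : U 3 ≠ [] := by rintro h; simp [State.top, h] at hU
      simp only [List.reverse_nil, kforList]
      congr 1
      cases h : U 3 with
      | nil => exact absurd h this
      | cons x l => rw [← h]; simp [h]
    · rw [State.top] at hU
      rw [hU]; simp [Nat.ModEq]
  | cons d L ih =>
    obtain ⟨x, h1, h2⟩ := ih fun d hd => hL d (by simp [hd])
    simp only [List.reverse_cons, kforList_append, h1, PMF.pure_bind, kforList, powBody_apply]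
    simp only [top_update_self, top_update_of_ne (show (2 : ℕ) ≠ 3 by norm_num),
      top_update_of_ne (show (1 : ℕ) ≠ 3 by norm_num), List.headD_cons, Function.update_idem,
      Function.update_self, List.tail_cons]
    refine ⟨_, rfl, ?_⟩
    set N := U.top 2 * U.top 2 + (1 - U.top 2)
    have hd : (1 - d) + d * U.top 1 = U.top 1 ^ d := by
      have := hL d (by simp)
      interval_cases d <;> simp
    rw [hd, Nat.ofDigits_cons, pow_add, mul_comm (_ ^ _) (_ ^ _), pow_mul', pow_two]
    exact (Nat.mod_modEq _ _).trans (((Nat.mod_modEq _ _).trans (h2.mul h2)).mul_right _)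

/-- On input `[r, m]`, compute `r ^ m` modulo `m²`. -/
theorem exists_powMod : ∃ M : PPT, ∀ κ r m, 0 < m →
    M.run κ [r, m] = PMF.pure [r ^ m % (m * m)] := by
  obtain ⟨M, hM⟩ := Eff.exists_ppt (F := kseqs [kpush 1 (.var 0), kpop 0, kpush 2 (.var 0),
      kclear 0, kdigits 0 (.var 2), kpush 3 1, kfor 0 4 powBody, kpush 0 (.var 3 % sqExpr 2)])
    (eff_kseqs_cons (eff_kpush _ _) <| eff_kseqs_cons (eff_kpop _) <|
      eff_kseqs_cons (eff_kpush _ _) <| eff_kseqs_cons (eff_kclear _) <|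
      eff_kseqs_cons (eff_kdigits _ _) <| eff_kseqs_cons (eff_kpush _ _) <|
      eff_kseqs_cons eff_kfor_powBody <| eff_kseqs_cons (eff_kpush _ _) eff_kseqs_nil)
  refine ⟨M, fun κ r m hm => ?_⟩
  rw [hM, st_pad 5]
  simp [kpush_st, kpop_st, kclear_st, kdigits_st, kfor_st, st_top]
  obtain ⟨x, h1, h2⟩ := kforList_powBody κ (st [[], [r], [m], [1], [], []]) rfl (Nat.digits 2 m)
    (fun d hd => Nat.digits_lt_base (by norm_num) hd)
  have hN : (st [[], [r], [m], [1], [], []]).top 2 * (st [[], [r], [m], [1], [], []]).top 2 +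
      (1 - (st [[], [r], [m], [1], [], []]).top 2) = m * m := by
    simp [st_top]; omega
  rw [hN, Nat.ofDigits_digits] at h2
  rw [digitsMSB, h1, update_st _ _ _ (by simp)]
  simp [kpush_st, sqExpr, st_top, st_apply, PMF.pure_map]
  rw [Nat.sub_eq_zero_of_le hm, Nat.add_zero]
  exact congrArg (fun z => PMF.pure [z]) h2

/-! ## Growth of stacks -/

theorem bitSize_update_le (U : State) (a : ℕ) (l : List ℕ) (r : ℕ) :
    bitSize (Function.update U a l r) ≤ bitSize (U r) + bitSize l := by
  by_cases h : r = a
  · subst h; simp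
  · simp [h]

theorem bitSize_update_append_le (U : State) (a : ℕ) (l : List ℕ) (r : ℕ) :
    bitSize (Function.update U a (l ++ U a) r) ≤ bitSize (U r) + bitSize l := by
  by_cases h : r = a
  · subst h; simp; omega
  · simp [h]

theorem PPT.exists_bitSize_le (M : PPT) : ∃ Q : Polynomial ℕ, ∀ n κ x y, κ ≤ n →
    bitSize x ≤ n → y ∈ (M.run κ x).support → bitSize y ≤ Q.eval n := by
  refine ⟨Polynomial.X + 2 * M.bound.comp (2 * Polynomial.X), fun n κ x y h1 h2 hy => ?_⟩
  have h3 := M.bitSize_le hy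
  have h4 := polynomial_eval_mono M.bound (show κ + bitSize x ≤ 2 * n by omega)
  simp only [Polynomial.eval_add, Polynomial.eval_mul, Polynomial.eval_ofNat, Polynomial.eval_X,
    Polynomial.eval_comp]
  omega

theorem PolyTimeComputable.exists_size_le {N : ℕ → ℕ} (hN : PolyTimeComputable N) :
    ∃ Q : Polynomial ℕ, ∀ n κ, κ ≤ n → (N κ).size + 1 ≤ Q.eval n := by
  obtain ⟨M, hM⟩ := hN
  obtain ⟨Q, hQ⟩ := M.exists_bitSize_le
  refine ⟨Q, fun n κ h => ?_⟩
  simpa using hQ n κ [] [N κ] h (by simp) (by simp [hM])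

/-! ## Vectors of random bits -/

/-- The vector is returned in reverse because `kforList_push` consumes a reversed list, so that its
pushes produce the results in the right order. -/
theorem exists_bits {n : ℕ → ℕ} (hn : PolyTimeComputable n) (hn' : PolyBounded n) :
    ∃ M : PPT, ∀ κ x, M.run κ x =
      (piPMF (n κ) fun _ => unifBelow 2).map fun v => (List.ofFn v).reverse := by
  have happ : ∀ (κ : ℕ) (U : State) (s : ℕ), kseqs [kunif 0 2, kpop 3] κ (U.push 3 s) =
      (unifBelow 2).map fun r => U.push 0 r := by
    intro κ U s
    simp only [kseqs_cons, kseqs_nil, kunif, kpop, map_eq_bind, PMF.bind_bind, PMF.pure_bind,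
      Expr.eval_ofNat]
    congr 1
    funext r
    congr 1
    funext x
    rcases x with _ | _ | _ | _ | x <;> simp [State.push]
  have hfor : Eff (kfor 2 3 (kseqs [kunif 0 2, kpop 3])) := by
    refine EffOn.for (eff_kseqs_cons (eff_kunif _ _) (eff_kseqs_cons (eff_kpop _) eff_kseqs_nil)) 2 3
      (fun _ _ _ => True) 3 (fun _ _ _ => trivial) (fun _ _ _ _ _ _ => trivial) ?_
    intro m κ U₀ U s U' _ _ _ _ hU'
    rw [happ, PMF.mem_support_map_iff] at hU'
    obtain ⟨v, hv, rfl⟩ := hU'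
    refine ⟨trivial, fun r => (bitSize_push_le U 0 v r).trans ?_⟩
    have h1 := size_unifBelow hv
    have h2 : Nat.size 2 = 2 := by simpa using Nat.size_pow (n := 1)
    simp only [Polynomial.eval_ofNat]
    omega
  obtain ⟨M, hM⟩ := Eff.exists_ppt (F := kseqs [kclear 0, kunary n 1 2,
      kfor 2 3 (kseqs [kunif 0 2, kpop 3]), krev 0 1, kdup 1 0])
    (eff_kseqs_cons (eff_kclear _) <| eff_kseqs_cons (eff_kunary hn hn' (by norm_num)) <|
      eff_kseqs_cons hfor <| eff_kseqs_cons (eff_krev (by norm_num)) <|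
      eff_kseqs_cons (eff_kdup (by norm_num)) eff_kseqs_nil)
  refine ⟨M, fun κ x => ?_⟩
  have hpush := kforList_push (b := 3) (κ := κ) (F := kseqs [kunif 0 2, kpop 3])
    (fun p => st [p, [], [], []]) (fun _ => unifBelow 2) (fun s p => by
      rw [happ]
      simp only [State.push, update_st _ _ _ (show 0 < [p, [], [], []].length by simp)]
      rfl) (fun _ : Fin (n κ) => 0) []
  rw [← replicate_eq_reverse_ofFn] at hpush
  rw [hM, st_pad 3]
  simp [kclear_st, kunary_st, kfor_st, hpush, krev_st, kdup_st, map_eq_bind,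
    st_apply]

/-! ## Ciphertexts -/

/-- A ciphertext and the offset which it masks. -/
def ctPair (m c s : ℕ) : PMF (ℕ × ℕ) :=
  (unifBelow m).bind fun o => (unifBelow m).map fun r =>
    (((1 - s) + s * c) * (1 + m * (m - o)) * (r ^ m % (m * m)) % (m * m), o)

/-- In `ctPair`, for a bit `s`, the first factor is `c ^ s`, the second is `(1 + m) ^ (m - o)`
modulo `m²`, and the third is the blinding factor. With `c` an encryption of `β` and `r` a unit, the
product encrypts `s * β - o`. -/
theorem exists_ct : ∃ M : PPT, ∀ κ s m c, 0 < m →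
    M.run κ [s, m, c] = (ctPair m c s).map fun x => [x.1, x.2] := by
  obtain ⟨E, hE⟩ := exists_powMod
  obtain ⟨M, hM⟩ := Eff.exists_ppt (F := kseqs [kpush 1 (.var 0), kpop 0, kpush 2 (.var 0),
      kpop 0, kpush 3 (.var 0), kclear 0, kunif 4 (.var 2), kpush 5 (.var 2), kunif 5 (.var 2),
      kcall E 5, kpush 0 (.var 4), kpush 0 ((((1 - .var 1) + .var 1 * .var 3) *
        (1 + .var 2 * (.var 2 - .var 4)) * .var 5) % (.var 2 * .var 2))])
    (eff_kseqs_cons (eff_kpush _ _) <| eff_kseqs_cons (eff_kpop _) <|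
      eff_kseqs_cons (eff_kpush _ _) <| eff_kseqs_cons (eff_kpop _) <|
      eff_kseqs_cons (eff_kpush _ _) <| eff_kseqs_cons (eff_kclear _) <|
      eff_kseqs_cons (eff_kunif _ _) <| eff_kseqs_cons (eff_kpush _ _) <|
      eff_kseqs_cons (eff_kunif _ _) <| eff_kseqs_cons (eff_kcall _ _) <|
      eff_kseqs_cons (eff_kpush _ _) <| eff_kseqs_cons (eff_kpush _ _) eff_kseqs_nil)
  refine ⟨M, fun κ s m c hm => ?_⟩
  rw [hM, st_pad 6]
  simp [kpush_st, kpop_st, kclear_st, kunif_st, kcall_st, st_top, hE _ _ _ hm, ctPair, map_eq_bind,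
    st_apply]

/-- The loop body that appends one ciphertext. -/
def ctBody (M : PPT) : Kern := kseqs [kclear 6, kpush 6 (.var 2), kpush 6 (.var 1),
  kpush 6 (.var 5), kcall M 6, kpush 3 (.var 6), kpop 6, kpush 4 (.var 6), kclear 6, kpop 5]

theorem ctBody_apply (M : PPT) (κ : ℕ) (U : State) (s : ℕ) : ctBody M κ (U.push 5 s) =
    (M.run κ [s, U.top 1, U.top 2]).map fun y =>
      State.push (State.push (Function.update U 6 []) 3 (y.headD 0)) 4 (y.tail.headD 0) := by
  simp only [ctBody, kseqs_cons, kseqs_nil, kclear, kpush, kcall, kpop, map_eq_bind, PMF.bind_bind,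
    PMF.pure_bind]
  congr 1
  funext y
  congr 1
  funext x
  rcases x with _ | _ | _ | _ | _ | _ | _ | x <;> simp [State.push, State.top]

theorem eff_ctLoop (M : PPT) : Eff (kfor 0 5 (ctBody M)) := by
  obtain ⟨Q, hQ⟩ := M.exists_bitSize_le
  have hbody : Eff (ctBody M) :=
    eff_kseqs_cons (eff_kclear _) <| eff_kseqs_cons (eff_kpush _ _) <|
      eff_kseqs_cons (eff_kpush _ _) <| eff_kseqs_cons (eff_kpush _ _) <|
      eff_kseqs_cons (eff_kcall _ _) <| eff_kseqs_cons (eff_kpush _ _) <|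
      eff_kseqs_cons (eff_kpop _) <| eff_kseqs_cons (eff_kpush _ _) <|
      eff_kseqs_cons (eff_kclear _) <| eff_kseqs_cons (eff_kpop _) eff_kseqs_nil
  refine EffOn.for hbody 0 5
    (fun _ U₀ U => U.top 1 = U₀.top 1 ∧ U.top 2 = U₀.top 2)
    -- The subroutine receives three numbers of at most `n` bits each, with separators. Two entries
    -- of its output are pushed, each with one more separator.
    (2 * Q.comp (3 * Polynomial.X + 3) + 2) (fun κ U _ => by simp [State.top])
    (fun _ _ _ _ _ _ => trivial) ?_
  intro n κ U₀ U s U' hκ hn hI hs hU'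
  rw [ctBody_apply, PMF.mem_support_map_iff] at hU'
  obtain ⟨y, hy, rfl⟩ := hU'
  refine ⟨by rw [← hI.1, ← hI.2]; simp [State.top, State.push], fun r => ?_⟩
  have h1 := top_size_le hn 1
  have h2 := top_size_le hn 2
  have h3 := (size_le_of_mem hs).trans (hn 0)
  rw [hI.1, hI.2] at hy
  have h4 := hQ (3 * n + 3) κ _ y (by omega) (by simp; omega) hy
  have h5 := bitSize_push_le (State.push (Function.update U 6 []) 3 (y.headD 0)) 4 (y.tail.headD 0) r
  have h6 := bitSize_push_le (Function.update U 6 []) 3 (y.headD 0) r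
  have h7 := bitSize_update_le U 6 [] r
  have h8 := size_head_le y
  have h9 := (size_head_le y.tail).trans (bitSize_tail_le y)
  simp only [Polynomial.eval_add, Polynomial.eval_mul, Polynomial.eval_ofNat, Polynomial.eval_comp,
    Polynomial.eval_X]
  rw [bitSize_nil] at h7
  omega

/-- The hint request and the offset, for a given vector. -/
def hintList {k : ℕ} (m n : ℕ) (v : Fin k → ℕ × ℕ) : List ℕ :=
  m :: n :: (List.ofFn fun j => (v j).1) ++ n :: List.ofFn fun j => (v j).2

theorem exists_cts {n : ℕ → ℕ} (hn : PolyTimeComputable n) :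
    ∃ M : PPT, ∀ κ (k m c : ℕ) (s : Fin k → ℕ), 0 < m →
      M.run κ (m :: c :: (List.ofFn s).reverse) =
        (piPMF k fun j => ctPair m c (s j)).map fun v => hintList m (n κ) v := by
  obtain ⟨E, hE⟩ := exists_ct
  obtain ⟨M, hM⟩ := Eff.exists_ppt (F := kseqs [kpush 1 (.var 0), kpop 0, kpush 2 (.var 0),
      kpop 0, kfor 0 5 (ctBody E), kconst n 7, kpush 4 (.var 7), krev 3 6, krev 6 4,
      kpush 4 (.var 7), kpush 4 (.var 1), kdup 4 0])
    (eff_kseqs_cons (eff_kpush _ _) <| eff_kseqs_cons (eff_kpop _) <|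
      eff_kseqs_cons (eff_kpush _ _) <| eff_kseqs_cons (eff_kpop _) <|
      eff_kseqs_cons (eff_ctLoop _) <| eff_kseqs_cons (eff_kconst hn _) <|
      eff_kseqs_cons (eff_kpush _ _) <| eff_kseqs_cons (eff_krev (by norm_num)) <|
      eff_kseqs_cons (eff_krev (by norm_num)) <| eff_kseqs_cons (eff_kpush _ _) <|
      eff_kseqs_cons (eff_kpush _ _) <| eff_kseqs_cons (eff_kdup (by norm_num)) eff_kseqs_nil)
  refine ⟨M, fun κ k m c s hm => ?_⟩
  have hpush := kforList_push (b := 5) (κ := κ) (F := ctBody E)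
    (fun p => st [[], [m], [c], p.map Prod.fst, p.map Prod.snd, [], [], []]) (ctPair m c)
    (fun s p => by
      rw [ctBody_apply, st_top, st_top]
      simp [hE _ _ _ _ hm, State.push, update_st, st_apply, PMF.map_comp, Function.comp_def]) s []
  rw [hM, st_pad 7]
  simp only [List.map_nil, List.append_nil] at hpush
  simp [kpush_st, kpop_st, st_top, kfor_st, hpush, kconst_st, krev_st, kdup_st,
    Function.comp_def, hintList, map_eq_bind, st_apply, List.map_ofFn]

/-! ## Learning-with-errors samples -/

/-- The inner product modulo `q`, computed step by step. -/
def dotMod (q : ℕ) (l : List (ℕ × ℕ)) : ℕ := l.foldr (fun x acc => (acc + x.1 * x.2) % q) 0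

/-- The loop body that samples one entry of a row and updates the inner product. -/
def dotBody (q : ℕ → ℕ) : Kern := kseqs [kconst q 2, kunif 3 (.var 2),
  kset 4 ((.var 4 + .var 3 * .var 5) % .var 2), kpop 5]

theorem dotBody_apply (q : ℕ → ℕ) (κ : ℕ) (U : State) (s : ℕ) : dotBody q κ (U.push 5 s) =
    (unifBelow (q κ)).map fun a => Function.update (State.push (Function.update U 2 [q κ]) 3 a) 4
      ((U.top 4 + a * s) % q κ :: (U 4).tail) := by
  simp only [dotBody, kseqs_cons, kseqs_nil, kconst, kunif, kset, kpop, map_eq_bind,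
    PMF.bind_bind, PMF.pure_bind]
  congr 1
  funext y
  congr 1
  funext x
  rcases x with _ | _ | _ | _ | _ | _ | x <;> simp [State.push, State.top]

/-- Since `q` is positive, the reduced accumulator is never longer than `q`, whatever its length was
before. -/
theorem eff_dotLoop {q : ℕ → ℕ} (hq : PolyTimeComputable q) (hq0 : ∀ κ, 0 < q κ) :
    Eff (kfor 0 5 (dotBody q)) := by
  obtain ⟨Q, hQ⟩ := hq.exists_size_le
  have hbody : Eff (dotBody q) := eff_kseqs_cons (eff_kconst hq _) <|
    eff_kseqs_cons (eff_kunif _ _) <| eff_kseqs_cons (eff_kset _ _) <|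
    eff_kseqs_cons (eff_kpop _) eff_kseqs_nil
  refine EffOn.for hbody 0 5 (fun _ _ _ => True) (3 * Q) (fun _ _ _ => trivial)
    (fun _ _ _ _ _ _ => trivial) ?_
  intro n κ U₀ U s U' hκ hn hI hs hU'
  rw [dotBody_apply, PMF.mem_support_map_iff] at hU'
  obtain ⟨a, ha, rfl⟩ := hU'
  refine ⟨trivial, fun r => ?_⟩
  have h1 := hQ n κ hκ
  have h2 := size_unifBelow ha
  have h3 := Nat.size_le_size (Nat.mod_lt (U.top 4 + a * s) (hq0 κ)).le
  have h4 := bitSize_update_cons_tail_le (State.push (Function.update U 2 [q κ]) 3 a) 4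
    ((U.top 4 + a * s) % q κ) r
  have h5 := bitSize_push_le (Function.update U 2 [q κ]) 3 a r
  have h6 := bitSize_update_le U 2 [q κ] r
  have h7 : State.push (Function.update U 2 [q κ]) 3 a 4 = U 4 := by simp [State.push]
  rw [h7] at h4
  simp only [bitSize_cons, bitSize_nil] at h6
  simp only [Polynomial.eval_mul, Polynomial.eval_ofNat]
  omega

/-- One row of the public matrix and the corresponding entry of the LWE vector, which is an LWE
sample for `t = 1` and uniform for `t = 0`. -/
def lweRow (q t : ℕ) (E : PMF ℕ) {k : ℕ} (s : Fin k → ℕ) : PMF ((Fin k → ℕ) × ℕ) :=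
  (piPMF k fun j => (unifBelow q).map fun a => (a, s j)).bind fun a =>
  E.bind fun e => (unifBelow q).map fun u =>
  (fun j => (a j).1, (t * (dotMod q (List.ofFn a) + e) + (1 - t) * u) % q)

/-- One program serves both types of samples: the error and the uniform value are always drawn, and
`t` selects between them arithmetically. This lets the reductions choose the type at random. -/
theorem exists_lweRow {q n : ℕ → ℕ} (hq : PolyTimeComputable q) (hq0 : ∀ κ, 0 < q κ)
    (hn : PolyTimeComputable n) (E : PPT) :
    ∃ M : PPT, ∀ κ t k (s : Fin k → ℕ), M.run κ (t :: (List.ofFn s).reverse) =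
      (lweRow (q κ) t ((E.run κ []).map fun y => y.headD 0) s).map fun x =>
        x.2 :: n κ :: List.ofFn x.1 := by
  obtain ⟨M, hM⟩ := Eff.exists_ppt (F := kseqs [kpush 1 (.var 0), kpop 0, kconst q 2, kpush 4 0,
      kfor 0 5 (dotBody q), kcall E 6, kunif 8 (.var 2), kconst n 7, kpush 3 (.var 7),
      kpush 3 ((.var 1 * (.var 4 + .var 6) + (1 - .var 1) * .var 8) % .var 2), kdup 3 0])
    (eff_kseqs_cons (eff_kpush _ _) <| eff_kseqs_cons (eff_kpop _) <|
      eff_kseqs_cons (eff_kconst hq _) <| eff_kseqs_cons (eff_kpush _ _) <|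
      eff_kseqs_cons (eff_dotLoop hq hq0) <| eff_kseqs_cons (eff_kcall _ _) <|
      eff_kseqs_cons (eff_kunif _ _) <| eff_kseqs_cons (eff_kconst hn _) <|
      eff_kseqs_cons (eff_kpush _ _) <| eff_kseqs_cons (eff_kpush _ _) <|
      eff_kseqs_cons (eff_kdup (by norm_num)) eff_kseqs_nil)
  refine ⟨M, fun κ t k s => ?_⟩
  have hpush := kforList_push (b := 5) (κ := κ) (F := dotBody q)
    (fun p => st [[], [t], [q κ], p.map Prod.fst, [dotMod (q κ) p], [], [], [], []])
    (fun s => (unifBelow (q κ)).map fun a => (a, s))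
    (fun s p => by
      rw [dotBody_apply]
      simp [State.push, update_st, st_apply, st_top, PMF.map_comp, Function.comp_def, dotMod]) s []
  simp only [List.map_nil, List.append_nil] at hpush
  rw [show dotMod (q κ) [] = 0 from rfl] at hpush
  rw [hM, st_pad 8]
  simp [kpush_st, kpop_st, st_top, kfor_st, hpush, kconst_st, kcall_st, kunif_st, kdup_st,
    Function.comp_def, lweRow, map_eq_bind, st_apply, List.map_ofFn]

/-- The loop body that appends one row. -/
def rowBody (M : PPT) : Kern := kseqs [kclear 6, kdup 0 6, kcall M 6, kpush 4 (.var 6), kpop 6,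
  kclear 7, krev 6 7, krev 7 3, kpop 5]

theorem rowBody_apply (M : PPT) (κ : ℕ) (U : State) (s : ℕ) : rowBody M κ (U.push 5 s) =
    (M.run κ (U 0)).map fun y => Function.update (State.push (Function.update
      (Function.update U 6 []) 7 []) 4 (y.headD 0)) 3 (y.tail ++ U 3) := by
  simp only [rowBody, kseqs_cons, kseqs_nil, kclear, kdup, kcall, kpush, kpop, krev, map_eq_bind,
    PMF.bind_bind, PMF.pure_bind]
  have h0 : Function.update (Function.update (U.push 5 s) 6 []) 6
      ((Function.update (U.push 5 s) 6 []) 0 ++ (Function.update (U.push 5 s) 6 []) 6) 6 = U 0 := by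
    simp [State.push]
  rw [h0]
  congr 1
  funext y
  congr 1
  funext x
  rcases x with _ | _ | _ | _ | _ | _ | _ | _ | x <;> simp [State.push, State.top]

/-- Every iteration calls the subroutine on the same input, stack 0, so its output length is bounded
by the initial size. -/
theorem eff_rowLoop (M : PPT) : Eff (kfor 1 5 (rowBody M)) := by
  obtain ⟨Q, hQ⟩ := M.exists_bitSize_le
  have hbody : Eff (rowBody M) :=
    eff_kseqs_cons (eff_kclear _) <| eff_kseqs_cons (eff_kdup (by norm_num)) <|
      eff_kseqs_cons (eff_kcall _ _) <| eff_kseqs_cons (eff_kpush _ _) <|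
      eff_kseqs_cons (eff_kpop _) <| eff_kseqs_cons (eff_kclear _) <|
      eff_kseqs_cons (eff_krev (by norm_num)) <| eff_kseqs_cons (eff_krev (by norm_num)) <|
      eff_kseqs_cons (eff_kpop _) eff_kseqs_nil
  refine EffOn.for hbody 1 5 (fun _ U₀ U => U 0 = U₀ 0) (2 * Q + 1) (fun κ U _ => by simp)
    (fun _ _ _ _ _ _ => trivial) ?_
  intro n κ U₀ U s U' hκ hn hI hs hU'
  rw [rowBody_apply, PMF.mem_support_map_iff] at hU'
  obtain ⟨y, hy, rfl⟩ := hU'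
  refine ⟨by rw [← hI]; simp [State.push], fun r => ?_⟩
  have h1 := hQ n κ _ y hκ (by rw [hI]; exact hn 0) hy
  set V := State.push (Function.update (Function.update U 6 []) 7 []) 4 (y.headD 0) with hV
  have h2 := bitSize_update_append_le V 3 y.tail r
  have h3 : bitSize (V r) ≤ _ :=
    bitSize_push_le (Function.update (Function.update U 6 []) 7 []) 4 (y.headD 0) r
  have h4 := bitSize_update_le (Function.update U 6 []) 7 [] r
  have h5 := bitSize_update_le U 6 [] r
  have h6 := size_head_le y
  have h7 := bitSize_tail_le y
  have h8 : V 3 = U 3 := by simp [hV, State.push]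
  rw [h8] at h2
  simp only [Polynomial.eval_add, Polynomial.eval_mul, Polynomial.eval_ofNat, Polynomial.eval_one]
  rw [bitSize_nil] at h4 h5
  omega

/-- The encoding of a matrix, given by its rows, and of a vector. -/
def lweList {d : ℕ} (n : ℕ) {k : ℕ} (v : Fin d → (Fin k → ℕ) × ℕ) : List ℕ :=
  d :: (List.ofFn fun i => n :: List.ofFn (v i).1).flatten ++ d :: List.ofFn fun i => (v i).2

theorem exists_lwe {q n d : ℕ → ℕ} (hq : PolyTimeComputable q) (hq0 : ∀ κ, 0 < q κ)
    (hn : PolyTimeComputable n) (hd : PolyTimeComputable d) (hd' : PolyBounded d) (E : PPT) :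
    ∃ M : PPT, ∀ κ t k (s : Fin k → ℕ), M.run κ (t :: (List.ofFn s).reverse) =
      (piPMF (d κ) fun _ => lweRow (q κ) t ((E.run κ []).map fun y => y.headD 0) s).map
        fun v => lweList (n κ) v := by
  obtain ⟨R, hR⟩ := exists_lweRow hq hq0 hn E
  obtain ⟨M, hM⟩ := Eff.exists_ppt (F := kseqs [kunary d 2 1, kfor 1 5 (rowBody R), kconst d 2,
      kpush 4 (.var 2), krev 3 6, krev 6 4, kpush 4 (.var 2), kclear 0, kdup 4 0])
    (eff_kseqs_cons (eff_kunary hd hd' (by norm_num)) <| eff_kseqs_cons (eff_rowLoop R) <|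
      eff_kseqs_cons (eff_kconst hd _) <| eff_kseqs_cons (eff_kpush _ _) <|
      eff_kseqs_cons (eff_krev (by norm_num)) <| eff_kseqs_cons (eff_krev (by norm_num)) <|
      eff_kseqs_cons (eff_kpush _ _) <| eff_kseqs_cons (eff_kclear _) <|
      eff_kseqs_cons (eff_kdup (by norm_num)) eff_kseqs_nil)
  refine ⟨M, fun κ t k s => ?_⟩
  have hpush := kforList_push (b := 5) (κ := κ) (F := rowBody R)
    (fun p : List ((Fin k → ℕ) × ℕ) => st [t :: (List.ofFn s).reverse, [], [],
      (p.map fun x => n κ :: List.ofFn x.1).flatten, p.map Prod.snd, [], [], []])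
    (fun _ => lweRow (q κ) t ((E.run κ []).map fun y => y.headD 0) s)
    (fun _ p => by
      rw [rowBody_apply, st_apply, st_apply, List.getD_cons_zero, hR, PMF.map_comp]
      simp [State.push, update_st, st_apply, Function.comp_def]) (fun _ : Fin (d κ) => 0) []
  rw [← replicate_eq_reverse_ofFn] at hpush
  simp only [List.map_nil, List.append_nil, List.flatten_nil] at hpush
  rw [hM, st_pad 7]
  simp [kpush_st, st_top, kfor_st, kunary_st, hpush, kconst_st, krev_st, kclear_st, kdup_st,
    Function.comp_def, lweList, map_eq_bind, st_apply, List.map_ofFn]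

/-! ## Running the adversary on a view -/

/-- The loop body that moves one entry of the LWE vector, adding `Δ` to the entry number `i`. -/
def addBody (q : ℕ → ℕ) : Kern := kseqs [kset 6 (.var 6 - 1), kconst q 7,
  kpush 0 ((.var 3 + .var 8 * (1 - ((.var 6 - .var 2) + (.var 2 - .var 6)))) % .var 7),
  kpop 3, kpop 10]

theorem addBody_apply (q : ℕ → ℕ) (κ : ℕ) (U : State) (s : ℕ) : addBody q κ (U.push 10 s) =
    PMF.pure (Function.update (State.push (Function.update (Function.update U 6
      ((U.top 6 - 1) :: (U 6).tail)) 7 [q κ]) 0 ((U.top 3 + U.top 8 *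
        (1 - ((U.top 6 - 1 - U.top 2) + (U.top 2 - (U.top 6 - 1))))) % q κ)) 3 (U 3).tail) := by
  simp only [addBody, kseqs_cons, kseqs_nil, kset, kconst, kpush, kpop, PMF.pure_bind]
  congr 1
  funext x
  rcases x with _ | _ | _ | _ | _ | _ | _ | _ | _ | _ | _ | x <;> simp [State.push, State.top]

theorem eff_addLoop {q : ℕ → ℕ} (hq : PolyTimeComputable q) (hq0 : ∀ κ, 0 < q κ) :
    Eff (kfor 5 10 (addBody q)) := by
  obtain ⟨Q, hQ⟩ := hq.exists_size_le
  have hbody : Eff (addBody q) := eff_kseqs_cons (eff_kset _ _) <|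
    eff_kseqs_cons (eff_kconst hq _) <| eff_kseqs_cons (eff_kpush _ _) <|
    eff_kseqs_cons (eff_kpop _) <| eff_kseqs_cons (eff_kpop _) eff_kseqs_nil
  refine EffOn.for hbody 5 10 (fun _ U₀ U => U.top 6 ≤ U₀.top 6) (2 * Q + Polynomial.X + 1)
    (fun κ U _ => by simp [State.top]) (fun _ _ _ _ _ _ => trivial) ?_
  intro n κ U₀ U s U' hκ hn hI hs hU'
  rw [addBody_apply, PMF.mem_support_pure_iff] at hU'
  subst hU'
  refine ⟨?_, fun r => ?_⟩
  · refine le_trans ?_ hI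
    simp [State.top, State.push]
  set w := U.top 3 + U.top 8 * (1 - ((U.top 6 - 1 - U.top 2) + (U.top 2 - (U.top 6 - 1))))
  have h1 := hQ n κ hκ
  have h2 := Nat.size_le_size (Nat.mod_lt w (hq0 κ)).le
  set V₁ := Function.update U 6 ((U.top 6 - 1) :: (U 6).tail)
  set V₂ := Function.update V₁ 7 [q κ] with hV₂
  set V₃ := State.push V₂ 0 (w % q κ) with hV₃
  have h3 : bitSize (V₁ r) ≤ _ := bitSize_update_cons_tail_le U 6 (U.top 6 - 1) r
  have h4 : bitSize (V₂ r) ≤ _ := bitSize_update_le V₁ 7 [q κ] r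
  have h5 : bitSize (V₃ r) ≤ _ := bitSize_push_le V₂ 0 (w % q κ) r
  have h6 : bitSize (Function.update V₃ 3 (U 3).tail r) ≤ bitSize (V₃ r) := by
    by_cases hr : r = 3
    · subst hr
      have : V₃ 3 = U 3 := by simp [hV₃, State.push, hV₂, V₁]
      rw [Function.update_self, this]
      exact bitSize_tail_le _
    · rw [Function.update_of_ne hr]
  have h7 := Nat.size_le_size ((Nat.sub_le (U.top 6) 1).trans hI)
  have h8 := top_size_le hn 6
  simp only [bitSize_cons, bitSize_nil] at h4
  simp only [Polynomial.eval_add, Polynomial.eval_mul, Polynomial.eval_ofNat, Polynomial.eval_X,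
    Polynomial.eval_one]
  omega

/-- Add `Δ` to the entry number `i`, modulo `q`. -/
def addAt {k : ℕ} (q Δ i : ℕ) (y : Fin k → ℕ) : Fin k → ℕ :=
  fun j => (y j + if (j : ℕ) = i then Δ else 0) % q

/-- The vector lies reversed on stack 3, so its entries appear in order of decreasing index while
the counter on stack 6 counts down; it is decremented before use and then equals the current index.
Pushing the results restores the order. -/
theorem kforList_addBody (q : ℕ → ℕ) (κ i Δ : ℕ) (H rest : List ℕ) (p4 p9 : List ℕ) :
    ∀ (k : ℕ) (y : Fin k → ℕ) (p : List ℕ), kforList 10 (addBody q) (List.replicate k 0) κ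
      (st [p, H, [i], (List.ofFn y).reverse ++ rest, p4, [], [k], [q κ], [Δ], p9, []]) =
      PMF.pure (st [List.ofFn (addAt (q κ) Δ i y) ++ p, H, [i], rest, p4, [], [0], [q κ], [Δ], p9,
        []]) := by
  intro k
  induction k with
  | zero => intro y p; simp [kforList]
  | succ k ih =>
    intro y p
    rw [List.replicate_succ]
    simp only [kforList, addBody_apply, PMF.pure_bind]
    -- With truncated subtraction the sum in brackets is the distance of `k` and `i`, so the
    -- expression is an equality test. The same device normalises the adversary's output to a bit in
    -- `bitOf_eq`.
    have h1 : (1 : ℕ) - ((k - i) + (i - k)) = if k = i then 1 else 0 := by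
      split_ifs <;> omega
    simp only [State.push, st_top, List.getD_cons_zero, List.getD_cons_succ, List.headD_cons,
      Nat.add_sub_cancel, h1, List.ofFn_succ', List.concat_eq_append, List.reverse_append,
      List.reverse_singleton, List.cons_append, List.nil_append, st_apply, List.tail_cons]
    simp only [update_st, List.length_cons, List.length_nil, List.set_cons_succ,
      List.set_cons_zero, Nat.reduceAdd, Nat.reduceLT, st_apply, List.getD_cons_zero]
    rw [ih]
    simp [addAt]
    rfl

/-- Whether an output is `1`. -/
def bitOf (y : List ℕ) : ℕ := if y.head? = some 1 then 1 else 0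

theorem bitOf_eq (y : List ℕ) : 1 - ((y.headD 0 - 1) + (1 - y.headD 0)) = bitOf y := by
  unfold bitOf
  cases y with
  | nil => simp
  | cons a l => simp; split_ifs <;> omega

/-- Replace the registers `x, H, [i]` by the output of the adversary on the view which consists of
the LWE sample `x`, shifted by a multiple of the `i`-th unit vector, and the hint `H`. -/
def attack (P : Params) (A : PPT) : Kern := kseqs [krev 0 3, kunary P.d₀ 4 5, kconst P.d₀ 6,
  kconst P.q 7, kconst P.p 9, kpush 8 ((2 * .var 7 + .var 9) / (2 * .var 9)),
  kfor 5 10 (addBody P.q), kpop 3, kconst P.d₀ 6, kpush 0 (.var 6),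
  krev 1 4, krev 4 0, krev 3 0, kcall A 0, kpush 1 (1 - ((.var 0 - 1) + (1 - .var 0))), kclear 0,
  kpush 0 (.var 1)]

theorem eff_attack {P : Params} (hP : P.Efficient) (A : PPT) : Eff (attack P A) :=
  eff_kseqs_cons (eff_krev (by norm_num)) <|
  eff_kseqs_cons (eff_kunary hP.d₀_comp hP.d₀_bound (by norm_num)) <|
  eff_kseqs_cons (eff_kconst hP.d₀_comp _) <| eff_kseqs_cons (eff_kconst hP.q_comp _) <|
  eff_kseqs_cons (eff_kconst hP.p_comp _) <| eff_kseqs_cons (eff_kpush _ _) <|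
  eff_kseqs_cons (eff_addLoop hP.q_comp P.q_pos) <| eff_kseqs_cons (eff_kpop _) <|
  eff_kseqs_cons (eff_kconst hP.d₀_comp _) <| eff_kseqs_cons (eff_kpush _ _) <|
  eff_kseqs_cons (eff_krev (by norm_num)) <| eff_kseqs_cons (eff_krev (by norm_num)) <|
  eff_kseqs_cons (eff_krev (by norm_num)) <| eff_kseqs_cons (eff_kcall _ _) <|
  eff_kseqs_cons (eff_kpush _ _) <| eff_kseqs_cons (eff_kclear _) <|
  eff_kseqs_cons (eff_kpush _ _) eff_kseqs_nil

/-- The view of the adversary on the LWE sample `(a, y)` and the hint `H`. -/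
def viewList {d : ℕ} (q Δ i : ℕ) (a H : List ℕ) (y : Fin d → ℕ) : List ℕ :=
  a ++ H ++ d :: List.ofFn (addAt q Δ i y)

/-- The scaling factor as a natural number. -/
def Params.scaleNat (P : Params) (κ : ℕ) : ℕ := (2 * P.q κ + P.p κ) / (2 * P.p κ)

theorem attack_st (P : Params) (A : PPT) (κ i : ℕ) (a H : List ℕ) (y : Fin (P.d₀ κ) → ℕ) :
    (attack P A κ (st [a ++ P.d₀ κ :: List.ofFn y, H, [i], [], [], [], [], [], [], [], []])).map
      (fun U => U 0) =
    (A.run κ (viewList (P.q κ) (P.scaleNat κ) i a H y)).map fun z => [bitOf z] := by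
  have hadd := kforList_addBody P.q κ i (P.scaleNat κ) H (P.d₀ κ :: a.reverse) [] [P.p κ]
    (P.d₀ κ) y []
  rw [attack]
  simp [kpush_st, st_top, kfor_st, kunary_st, kconst_st, krev_st, map_eq_bind, ← Params.scaleNat.eq_def] at hadd ⊢
  rw [hadd]
  simp [kpush_st, kpop_st, st_top, kconst_st, krev_st, kclear_st, kcall_st, viewList,
    st_apply, ← bitOf_eq]

/-! ## The reductions -/

/-- The adversary's output bit on a simulated view.  The ciphertexts are derived from `c`. -/
def simBit (P : Params) (A : PPT) (κ : ℕ) (E : PMF ℕ) (i m c t : ℕ) : PMF ℕ :=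
  (piPMF (P.n κ) fun _ => unifBelow 2).bind fun s =>
  (piPMF (P.n κ) fun j => ctPair m c (s j)).bind fun v =>
  (piPMF (P.d₀ κ) fun _ => lweRow (P.q κ) t E s).bind fun w =>
  (A.run κ (viewList (P.q κ) (P.scaleNat κ) i
    (P.d₀ κ :: (List.ofFn fun i => P.n κ :: List.ofFn (w i).1).flatten)
    (hintList m (P.n κ) v) fun i => (w i).2)).map bitOf

theorem exists_simBit {P : Params} (hP : P.Efficient) (A E : PPT) : ∃ M : PPT, ∀ κ i m c t,
    0 < m → M.run κ [i, m, c, t] =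
      (simBit P A κ ((E.run κ []).map fun y => y.headD 0) i m c t).map fun z => [z] := by
  obtain ⟨S, hS⟩ := exists_bits hP.n_comp hP.n_bound
  obtain ⟨C, hC⟩ := exists_cts hP.n_comp
  obtain ⟨L, hL⟩ := exists_lwe hP.q_comp P.q_pos hP.n_comp hP.d₀_comp hP.d₀_bound E
  obtain ⟨M, hM⟩ := Eff.exists_ppt (F := kseqs [kpush 2 (.var 0), kpop 0, kpush 3 (.var 0),
      kpop 0, kpush 4 (.var 0), kpop 0, kpush 5 (.var 0), kclear 0, kcall S 0, kdup 0 1,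
      kpush 1 (.var 4), kpush 1 (.var 3), kcall C 1, kpush 0 (.var 5), kcall L 0, kclear 3,
      kclear 4, kclear 5, attack P A])
    (eff_kseqs_cons (eff_kpush _ _) <| eff_kseqs_cons (eff_kpop _) <|
      eff_kseqs_cons (eff_kpush _ _) <| eff_kseqs_cons (eff_kpop _) <|
      eff_kseqs_cons (eff_kpush _ _) <| eff_kseqs_cons (eff_kpop _) <|
      eff_kseqs_cons (eff_kpush _ _) <| eff_kseqs_cons (eff_kclear _) <|
      eff_kseqs_cons (eff_kcall _ _) <| eff_kseqs_cons (eff_kdup (by norm_num)) <|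
      eff_kseqs_cons (eff_kpush _ _) <| eff_kseqs_cons (eff_kpush _ _) <|
      eff_kseqs_cons (eff_kcall _ _) <| eff_kseqs_cons (eff_kpush _ _) <|
      eff_kseqs_cons (eff_kcall _ _) <| eff_kseqs_cons (eff_kclear _) <|
      eff_kseqs_cons (eff_kclear _) <| eff_kseqs_cons (eff_kclear _) <|
      eff_kseqs_cons (eff_attack hP A) eff_kseqs_nil)
  refine ⟨M, fun κ i m c t hm => ?_⟩
  have hA : ∀ (v : Fin (P.n κ) → ℕ × ℕ) (w : Fin (P.d₀ κ) → (Fin (P.n κ) → ℕ) × ℕ), _ :=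
    fun v w => attack_st P A κ i
    (P.d₀ κ :: (List.ofFn fun i => P.n κ :: List.ofFn (w i).1).flatten) (hintList m (P.n κ) v)
    fun i => (w i).2
  rw [hM, st_pad 10]
  simp [kpush_st, kpop_st, st_top, kclear_st, kcall_st, kdup_st, hS, hC _ _ _ _ _ hm, hL,
    map_eq_bind, simBit, lweList] at hA ⊢
  simp only [hA]

/-- The adversary's output bit if the LWE sample is `(a, y)` and the ciphertexts encrypt `-o`. -/
def givenBit (P : Params) (A : PPT) (κ i m : ℕ) (a : List ℕ) (y : Fin (P.d₀ κ) → ℕ) : PMF ℕ :=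
  (piPMF (P.n κ) fun _ => ctPair m 1 0).bind fun v =>
  (A.run κ (viewList (P.q κ) (P.scaleNat κ) i a (hintList m (P.n κ) v) y)).map bitOf

theorem exists_givenBit {P : Params} (hP : P.Efficient) (A : PPT) : ∃ M : PPT,
    ∀ κ i m a (y : Fin (P.d₀ κ) → ℕ), 0 < m →
      M.run κ (i :: m :: (a ++ P.d₀ κ :: List.ofFn y)) =
        (givenBit P A κ i m a y).map fun z => [z] := by
  obtain ⟨C, hC⟩ := exists_cts hP.n_comp
  obtain ⟨M, hM⟩ := Eff.exists_ppt (F := kseqs [kpush 2 (.var 0), kpop 0, kpush 3 (.var 0),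
      kpop 0, kunary P.n 4 1, kpush 1 1, kpush 1 (.var 3), kcall C 1, kclear 3, attack P A])
    (eff_kseqs_cons (eff_kpush _ _) <| eff_kseqs_cons (eff_kpop _) <|
      eff_kseqs_cons (eff_kpush _ _) <| eff_kseqs_cons (eff_kpop _) <|
      eff_kseqs_cons (eff_kunary hP.n_comp hP.n_bound (by norm_num)) <|
      eff_kseqs_cons (eff_kpush _ _) <| eff_kseqs_cons (eff_kpush _ _) <|
      eff_kseqs_cons (eff_kcall _ _) <| eff_kseqs_cons (eff_kclear _) <|
      eff_kseqs_cons (eff_attack hP A) eff_kseqs_nil)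
  refine ⟨M, fun κ i m a y hm => ?_⟩
  have hA : ∀ v : Fin (P.n κ) → ℕ × ℕ, _ := fun v =>
    attack_st P A κ i a (hintList m (P.n κ) v) y
  have hC' := hC κ (P.n κ) m 1 (fun _ => 0) hm
  rw [← replicate_eq_reverse_ofFn] at hC'
  rw [hM, st_pad 10]
  simp [kpush_st, kpop_st, st_top, kclear_st, kcall_st, kunary_st, hC',
    map_eq_bind, givenBit] at hA ⊢
  simp only [hA]

/-- The first adversary of the attack on the Paillier cryptosystem asks for the messages `0`
and `1`. -/
theorem exists_messages : ∃ M : PPT, ∀ κ m, M.run κ [m] = PMF.pure [0, 1, m] := by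
  obtain ⟨M, hM⟩ := Eff.exists_ppt (F := kseqs [kpush 0 1, kpush 0 0])
    (eff_kseqs_cons (eff_kpush _ _) <| eff_kseqs_cons (eff_kpush _ _) eff_kseqs_nil)
  refine ⟨M, fun κ m => ?_⟩
  rw [hM]
  simp [kpush_st, st_apply, PMF.pure_map]

/-- The modulus computed from the output of the key generation. -/
def modulusOf (y : List ℕ) : ℕ := y.headD 0 * y.tail.headD 0

/-- Sample a modulus on the stack `8`. -/
def kmodulus (G : PPT) : Kern := kseqs [kclear 6, kcall G 6, kpush 7 (.var 6), kpop 6,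
  kset 8 (.var 7 * .var 6), kclear 6, kclear 7]

theorem eff_kmodulus (G : PPT) : Eff (kmodulus G) :=
  eff_kseqs_cons (eff_kclear _) <| eff_kseqs_cons (eff_kcall _ _) <|
  eff_kseqs_cons (eff_kpush _ _) <| eff_kseqs_cons (eff_kpop _) <|
  eff_kseqs_cons (eff_kset _ _) <| eff_kseqs_cons (eff_kclear _) <|
  eff_kseqs_cons (eff_kclear _) eff_kseqs_nil

theorem kmodulus_st (G : PPT) (κ : ℕ) (l0 l1 l2 l3 l4 l5 l8 l9 l10 : List ℕ) :
    kmodulus G κ (st [l0, l1, l2, l3, l4, l5, [], [], l8, l9, l10]) =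
      (G.run κ []).bind fun y =>
        PMF.pure (st [l0, l1, l2, l3, l4, l5, [], [], modulusOf y :: l8.tail, l9, l10]) := by
  simp [kmodulus, kclear_st, kcall_st, kpush_st, kpop_st, kset_st, st_top, modulusOf]

/-- The attack on the Paillier cryptosystem: compare the bit obtained from the challenge with the
bit obtained from a ciphertext of the random bit `t`. -/
theorem exists_cpaAttack {P : Params} (hP : P.Efficient) (S G : PPT) : ∃ M : PPT, ∀ κ c m,
    M.run κ [c, m] = (unifBelow (P.d₀ κ)).bind fun i => (unifBelow 2).bind fun t =>
      (S.run κ [i, m, c, 1]).bind fun z => (G.run κ []).bind fun y =>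
      (S.run κ [i, modulusOf y, 1 + t * modulusOf y, 1]).bind fun w =>
      PMF.pure [(z.headD 0 + w.headD 0 + t) % 2] := by
  obtain ⟨M, hM⟩ := Eff.exists_ppt (F := kseqs [kpush 1 (.var 0), kpop 0, kpush 2 (.var 0),
      kclear 0, kconst P.d₀ 3, kunif 4 (.var 3), kunif 5 2, kpush 0 1, kpush 0 (.var 1),
      kpush 0 (.var 2), kpush 0 (.var 4), kcall S 0, kmodulus G, kpush 9 1,
      kpush 9 (1 + .var 5 * .var 8), kpush 9 (.var 8), kpush 9 (.var 4), kcall S 9,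
      kpush 10 ((.var 0 + .var 9 + .var 5) % 2), kclear 0, kpush 0 (.var 10)])
    (eff_kseqs_cons (eff_kpush _ _) <| eff_kseqs_cons (eff_kpop _) <|
      eff_kseqs_cons (eff_kpush _ _) <| eff_kseqs_cons (eff_kclear _) <|
      eff_kseqs_cons (eff_kconst hP.d₀_comp _) <| eff_kseqs_cons (eff_kunif _ _) <|
      eff_kseqs_cons (eff_kunif _ _) <| eff_kseqs_cons (eff_kpush _ _) <|
      eff_kseqs_cons (eff_kpush _ _) <| eff_kseqs_cons (eff_kpush _ _) <|
      eff_kseqs_cons (eff_kpush _ _) <| eff_kseqs_cons (eff_kcall _ _) <|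
      eff_kseqs_cons (eff_kmodulus _) <| eff_kseqs_cons (eff_kpush _ _) <|
      eff_kseqs_cons (eff_kpush _ _) <| eff_kseqs_cons (eff_kpush _ _) <|
      eff_kseqs_cons (eff_kpush _ _) <| eff_kseqs_cons (eff_kcall _ _) <|
      eff_kseqs_cons (eff_kpush _ _) <| eff_kseqs_cons (eff_kclear _) <|
      eff_kseqs_cons (eff_kpush _ _) eff_kseqs_nil)
  refine ⟨M, fun κ c m => ?_⟩
  rw [hM, st_pad 10]
  simp [kpush_st, kpop_st, st_top, kclear_st, kcall_st, kconst_st, kunif_st, kmodulus_st,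
    map_eq_bind, st_apply]

/-- The attack on LWE: compare the bit obtained from the challenge with the bit obtained from a
self-made sample of type `t`. -/
theorem exists_lweAttack {P : Params} (hP : P.Efficient) (S X G : PPT) : ∃ M : PPT, ∀ κ x,
    M.run κ x = (unifBelow (P.d₀ κ)).bind fun i => (unifBelow 2).bind fun t =>
      (G.run κ []).bind fun y => (X.run κ (i :: modulusOf y :: x)).bind fun z =>
      (G.run κ []).bind fun y => (S.run κ [i, modulusOf y, 1, t]).bind fun w =>
      PMF.pure [(z.headD 0 + w.headD 0 + t) % 2] := by
  obtain ⟨M, hM⟩ := Eff.exists_ppt (F := kseqs [kconst P.d₀ 3, kunif 4 (.var 3), kunif 5 2,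
      kmodulus G, kpush 0 (.var 8), kpush 0 (.var 4), kcall X 0, kmodulus G, kpush 9 (.var 5),
      kpush 9 1, kpush 9 (.var 8), kpush 9 (.var 4), kcall S 9,
      kpush 10 ((.var 0 + .var 9 + .var 5) % 2), kclear 0, kpush 0 (.var 10)])
    (eff_kseqs_cons (eff_kconst hP.d₀_comp _) <| eff_kseqs_cons (eff_kunif _ _) <|
      eff_kseqs_cons (eff_kunif _ _) <| eff_kseqs_cons (eff_kmodulus _) <|
      eff_kseqs_cons (eff_kpush _ _) <| eff_kseqs_cons (eff_kpush _ _) <|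
      eff_kseqs_cons (eff_kcall _ _) <| eff_kseqs_cons (eff_kmodulus _) <|
      eff_kseqs_cons (eff_kpush _ _) <| eff_kseqs_cons (eff_kpush _ _) <|
      eff_kseqs_cons (eff_kpush _ _) <| eff_kseqs_cons (eff_kpush _ _) <|
      eff_kseqs_cons (eff_kcall _ _) <|
      eff_kseqs_cons (eff_kpush _ _) <| eff_kseqs_cons (eff_kclear _) <|
      eff_kseqs_cons (eff_kpush _ _) eff_kseqs_nil)
  refine ⟨M, fun κ x => ?_⟩
  rw [hM, st_pad 10]
  simp [kpush_st, st_top, kclear_st, kcall_st, kconst_st, kunif_st, kmodulus_st,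
    map_eq_bind, st_apply]

open scoped NNReal ENNReal

/-! ## Statistical distance -/

/-- The expectation of a nonnegative function. -/
def expect {α : Type} (μ : PMF α) (f : α → ℝ≥0∞) : ℝ≥0∞ := ∑' x, μ x * f x

section

variable {α β : Type}

theorem expect_pure (a : α) (f : α → ℝ≥0∞) : expect (PMF.pure a) f = f a := by
  rw [expect, tsum_eq_single a]
  · simp
  · intro b hb
    simp [hb]

theorem expect_bind (μ : PMF α) (k : α → PMF β) (f : β → ℝ≥0∞) :
    expect (μ.bind k) f = expect μ fun a => expect (k a) f := by
  simp only [expect, PMF.bind_apply, ← ENNReal.tsum_mul_right, ← ENNReal.tsum_mul_left]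
  rw [ENNReal.tsum_comm]
  simp only [mul_assoc]

theorem expect_map (μ : PMF α) (g : α → β) (f : β → ℝ≥0∞) :
    expect (μ.map g) f = expect μ fun a => f (g a) := by
  rw [map_eq_bind, expect_bind]
  exact congrArg _ (funext fun a => expect_pure _ _)

theorem expect_const (μ : PMF α) (c : ℝ≥0∞) : expect μ (fun _ => c) = c := by
  rw [expect, ENNReal.tsum_mul_right, μ.tsum_coe, one_mul]

theorem expect_add (μ : PMF α) (f g : α → ℝ≥0∞) :
    expect μ (fun a => f a + g a) = expect μ f + expect μ g := by
  simp only [expect, mul_add, ENNReal.tsum_add]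

theorem expect_mono {μ : PMF α} {f g : α → ℝ≥0∞} (h : ∀ a ∈ μ.support, f a ≤ g a) :
    expect μ f ≤ expect μ g := by
  refine ENNReal.tsum_le_tsum fun a => ?_
  by_cases ha : μ a = 0
  · simp [ha]
  · exact mul_le_mul_right (h a ((μ.mem_support_iff a).2 ha)) _

theorem expect_indicator (μ : PMF α) (S : Set α) :
    expect μ (S.indicator 1) = μ.toOuterMeasure S := by
  rw [PMF.toOuterMeasure_apply]
  refine tsum_congr fun a => ?_
  by_cases ha : a ∈ S <;> simp [ha]

theorem expect_single [DecidableEq α] (μ : PMF α) (a : α) :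
    expect μ (fun x => if x = a then 1 else 0) = μ a := by
  rw [expect, tsum_eq_single a] <;> simp +contextual

/-- The statistical distance of two distributions is at most `ε`. -/
def Close (ε : ℝ≥0) (μ ν : PMF α) : Prop :=
  ∀ f : α → ℝ≥0∞, (∀ a, f a ≤ 1) → expect μ f ≤ expect ν f + ε

namespace Close

theorem refl (μ : PMF α) : Close 0 μ μ := fun f _ => by simp

/-- The definition is one-sided, but applying it to the complementary test `1 - f` gives the other
inequality. -/
theorem symm {ε : ℝ≥0} {μ ν : PMF α} (h : Close ε μ ν) : Close ε ν μ := by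
  intro f hf
  have hcompl : ∀ ρ : PMF α, expect ρ f + expect ρ (fun a => 1 - f a) = 1 := fun ρ => by
    rw [← expect_add]
    simp only [add_tsub_cancel_of_le (hf _), expect_const]
  have h1 := h (fun a => 1 - f a) fun a => (tsub_le_self : 1 - f a ≤ 1)
  have hfin : expect μ (fun a => 1 - f a) ≠ ∞ :=
    ne_top_of_le_ne_top ENNReal.one_ne_top (le_add_self.trans (hcompl μ).le)
  refine (ENNReal.add_le_add_iff_right hfin).1 ?_
  calc expect ν f + expect μ (fun a => 1 - f a)
      ≤ expect ν f + (expect ν (fun a => 1 - f a) + ε) := by gcongr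
    _ = expect μ f + ε + expect μ (fun a => 1 - f a) := by
      rw [← add_assoc, hcompl, add_right_comm, hcompl]

theorem mono {ε δ : ℝ≥0} {μ ν : PMF α} (h : Close ε μ ν) (hεδ : ε ≤ δ) : Close δ μ ν :=
  fun f hf => (h f hf).trans (by gcongr)

theorem trans {ε δ : ℝ≥0} {μ ν ρ : PMF α} (h : Close ε μ ν) (h' : Close δ ν ρ) :
    Close (ε + δ) μ ρ := fun f hf => by
  refine (h f hf).trans ?_
  rw [ENNReal.coe_add, add_comm (ε : ℝ≥0∞), ← add_assoc]
  gcongr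
  exact h' f hf

/-- For a test `f` with values at most 1, the function sending `a` to the expectation of `f` under
`k a` is again such a test. The second error needs to be controlled only on the support of `ν`. -/
theorem bind {ε δ : ℝ≥0} {μ ν : PMF α} {k l : α → PMF β} (h : Close ε μ ν)
    (h' : ∀ a ∈ ν.support, Close δ (k a) (l a)) : Close (ε + δ) (μ.bind k) (ν.bind l) := by
  intro f hf
  have hk : ∀ a, expect (k a) f ≤ 1 := fun a =>
    (expect_mono fun b _ => hf b).trans (expect_const _ _).le
  rw [expect_bind, expect_bind]
  refine (h _ hk).trans ?_
  rw [ENNReal.coe_add, add_comm (ε : ℝ≥0∞), ← add_assoc]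
  gcongr
  rw [← expect_const ν (δ : ℝ≥0∞), ← expect_add]
  exact expect_mono fun a ha => h' a ha f hf

theorem bind_right {δ : ℝ≥0} (μ : PMF α) {k l : α → PMF β}
    (h : ∀ a ∈ μ.support, Close δ (k a) (l a)) : Close δ (μ.bind k) (μ.bind l) := by
  simpa using (refl μ).bind h

theorem bind_left {ε : ℝ≥0} {μ ν : PMF α} (h : Close ε μ ν) (k : α → PMF β) :
    Close ε (μ.bind k) (ν.bind k) := by
  simpa using h.bind fun a _ => refl (k a)

theorem map {ε : ℝ≥0} {μ ν : PMF α} (h : Close ε μ ν) (g : α → β) :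
    Close ε (μ.map g) (ν.map g) := by
  simpa only [map_eq_bind] using h.bind_left _

theorem piPMF {ε : ℝ≥0} : ∀ {k : ℕ} {D D' : Fin k → PMF α}, (∀ j, Close ε (D j) (D' j)) →
    Close (k * ε) (piPMF k D) (piPMF k D')
  | 0, _, _, _ => by simpa [ZipPIR.piPMF] using refl _
  | k + 1, D, D', h => by
    have h1 := (h 0).bind fun a _ =>
      (piPMF (k := k) fun j => h j.succ).map fun v => (Fin.cons a v : Fin (k + 1) → α)
    rw [ZipPIR.piPMF, ZipPIR.piPMF]
    convert h1 using 1
    push_cast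
    ring

theorem abs_sub_apply_le {ε : ℝ≥0} {μ ν : PMF α} (h : Close ε μ ν) (a : α) :
    |(μ a).toReal - (ν a).toReal| ≤ ε := by
  classical
  have key : ∀ {μ ν : PMF α}, Close ε μ ν → (μ a).toReal ≤ (ν a).toReal + ε := by
    intro μ ν h
    have h1 := h (fun x => if x = a then 1 else 0) fun x => by split_ifs <;> simp
    rw [expect_single, expect_single] at h1
    have h2 := ENNReal.toReal_mono (ENNReal.add_ne_top.2 ⟨ν.apply_ne_top a, ENNReal.coe_ne_top⟩) h1
    rwa [ENNReal.toReal_add (ν.apply_ne_top a) ENNReal.coe_ne_top, ENNReal.coe_toReal] at h2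
  rw [abs_le]
  constructor <;> linarith [key h, key h.symm]

/-- The statistical distance is witnessed by events. -/
theorem of_toOuterMeasure {ε : ℝ≥0} {μ ν : PMF α}
    (h : ∀ S : Set α, (μ.toOuterMeasure S).toReal ≤ (ν.toOuterMeasure S).toReal + ε) :
    Close ε μ ν := by
  intro f hf
  -- The event on which `μ` exceeds `ν` is the best test: pointwise, `(μ - ν) * f` is at most `μ -
  -- ν` on `S` and at most 0 elsewhere.
  set S : Set α := {a | ν a < μ a}
  have hS : expect μ (S.indicator 1) ≤ expect ν (S.indicator 1) + ε := by
    have hfin : ∀ ρ : PMF α, ρ.toOuterMeasure S ≠ ∞ := fun ρ => by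
      rw [← expect_indicator]
      refine ne_top_of_le_ne_top ENNReal.one_ne_top ((expect_mono fun a _ => ?_).trans
        (expect_const ρ 1).le)
      exact Set.indicator_le_self' (fun _ _ => zero_le) _
    rw [expect_indicator, expect_indicator, ← ENNReal.toReal_le_toReal (hfin μ)
      (ENNReal.add_ne_top.2 ⟨hfin ν, ENNReal.coe_ne_top⟩),
      ENNReal.toReal_add (hfin ν) ENNReal.coe_ne_top, ENNReal.coe_toReal]
    exact h S
  have hfin : expect ν (S.indicator 1) ≠ ∞ := by
    refine ne_top_of_le_ne_top ENNReal.one_ne_top ((expect_mono fun a _ => ?_).trans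
      (expect_const ν 1).le)
    exact Set.indicator_le_self' (fun _ _ => zero_le) _
  refine (ENNReal.add_le_add_iff_right hfin).1 ?_
  have h1 : expect μ f + expect ν (S.indicator 1) ≤ expect ν f + expect μ (S.indicator 1) := by
    simp only [expect, ← ENNReal.tsum_add]
    refine ENNReal.tsum_le_tsum fun a => ?_
    by_cases ha : a ∈ S
    · obtain ⟨d, hd⟩ := exists_add_of_le (le_of_lt (show ν a < μ a from ha))
      simp only [ha, Set.indicator_of_mem, Pi.one_apply, mul_one, hd]
      calc (ν a + d) * f a + ν a = ν a * f a + (ν a + d * f a) := by ring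
        _ ≤ ν a * f a + (ν a + d * 1) := by gcongr; exact hf a
        _ = _ := by rw [mul_one]
    · simp only [ha, not_false_eq_true, Set.indicator_of_notMem, mul_zero, add_zero]
      exact mul_le_mul_left (not_lt.1 ha) _
  refine h1.trans ?_
  rw [add_assoc, add_comm _ (expect ν (S.indicator 1))]
  gcongr

end Close

theorem EfficientlySamplable.exists_close {D : ℕ → PMF (List ℕ)} (h : EfficientlySamplable D) :
    ∃ M : PPT, ∃ ε : ℕ → ℝ≥0, Negligible (fun κ => (ε κ : ℝ)) ∧
      ∀ κ, Close (ε κ) (M.run κ []) (D κ) := by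
  obtain ⟨M, ε, hε, h⟩ := h
  have h0 : ∀ κ, 0 ≤ ε κ := fun κ => (abs_nonneg _).trans (h κ ∅)
  refine ⟨M, fun κ => ⟨ε κ, h0 κ⟩, hε, fun κ => Close.of_toOuterMeasure fun S => ?_⟩
  have := (abs_le.1 (h κ S)).2
  change _ ≤ _ + ε κ
  linarith

/-! ## Independent and uniform samples -/

theorem iid_eq_piPMF (D : PMF α) : ∀ k, iid D k = piPMF k fun _ => D
  | 0 => rfl
  | k + 1 => by rw [iid, piPMF, iid_eq_piPMF D k]

theorem piPMF_apply : ∀ {k : ℕ} (D : Fin k → PMF α) (v : Fin k → α),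
    piPMF k D v = ∏ j, D j (v j)
  | 0, D, v => by
    rw [piPMF, Subsingleton.elim v Fin.elim0]
    simp
  | k + 1, D, v => by
    classical
    rw [piPMF, PMF.bind_apply, tsum_eq_single (v 0), Fin.prod_univ_succ,
      ← piPMF_apply (fun j => D j.succ) (fun j => v j.succ)]
    · congr 1
      rw [PMF.map_apply, tsum_eq_single fun j => v j.succ]
      · rw [if_pos]
        exact (Fin.cons_self_tail v).symm
      · intro w hw
        rw [if_neg]
        intro hvw
        exact hw (funext fun j => by simpa using (congrFun hvw j.succ).symm)
    · intro a ha
      rw [PMF.map_apply, ENNReal.tsum_eq_zero.2, mul_zero]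
      intro w
      rw [if_neg]
      rintro rfl
      simp at ha

theorem uniformOfFintype_pi [Fintype α] [Nonempty α] (k : ℕ) :
    PMF.uniformOfFintype (Fin k → α) = piPMF k fun _ => PMF.uniformOfFintype α := by
  classical
  ext v
  simp [piPMF_apply, ENNReal.inv_pow]

theorem piPMF_bind : ∀ {k : ℕ} (D : Fin k → PMF α) (F : Fin k → α → PMF β),
    (piPMF k fun j => (D j).bind (F j)) = (piPMF k D).bind fun v => piPMF k fun j => F j (v j)
  | 0, D, F => by simp [piPMF]
  | k + 1, D, F => by
    simp only [piPMF, PMF.bind_bind, map_eq_bind, PMF.pure_bind, Fin.cons_zero, Fin.cons_succ]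
    congr 1
    funext a
    rw [piPMF_bind (fun j => D j.succ) fun j => F j.succ]
    simp only [PMF.bind_bind]
    rw [PMF.bind_comm (F 0 a)]

theorem piPMF_pure : ∀ {k : ℕ} (v : Fin k → α), (piPMF k fun j => PMF.pure (v j)) = PMF.pure v
  | 0, v => by rw [piPMF, Subsingleton.elim v]
  | k + 1, v => by
    rw [piPMF, piPMF_pure fun j => v j.succ, PMF.pure_bind, PMF.pure_map]
    exact congrArg _ (Fin.cons_self_tail v)

theorem piPMF_map {k : ℕ} (D : Fin k → PMF α) (g : Fin k → α → β) :
    (piPMF k fun j => (D j).map (g j)) = (piPMF k D).map fun v j => g j (v j) := by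
  simp only [map_eq_bind]
  rw [piPMF_bind D fun j a => PMF.pure (g j a)]
  simp only [piPMF_pure]

theorem uniformOfFintype_map_equiv [Fintype α] [Nonempty α] [Fintype β] [Nonempty β] (e : α ≃ β) :
    (PMF.uniformOfFintype α).map e = PMF.uniformOfFintype β := by
  classical
  ext b
  rw [PMF.map_apply, tsum_eq_single (e.symm b)]
  · simp [Fintype.card_congr e]
  · intro a ha
    rw [if_neg]
    rintro rfl
    simp at ha

theorem unifBelow_eq {N : ℕ} (hN : 0 < N) : ∃ h : (Finset.range N).Nonempty,
    unifBelow N = PMF.uniformOfFinset (Finset.range N) h := by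
  have h : (Finset.range N).Nonempty := Finset.nonempty_range_iff.2 hN.ne'
  exact ⟨h, by rw [unifBelow, dif_pos h]⟩

theorem unifBelow_eq_map_val (N : ℕ) [NeZero N] :
    unifBelow N = (PMF.uniformOfFintype (ZMod N)).map ZMod.val := by
  classical
  obtain ⟨h, hu⟩ := unifBelow_eq (Nat.pos_of_ne_zero (NeZero.ne N))
  rw [hu]
  ext x
  rw [PMF.map_apply, PMF.uniformOfFinset_apply]
  by_cases hx : x < N
  · rw [if_pos (Finset.mem_range.2 hx), tsum_eq_single (x : ZMod N)]
    · simp [ZMod.val_cast_of_lt hx, ZMod.card]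
    · intro a ha
      rw [if_neg]
      rintro rfl
      simp at ha
  · rw [if_neg (by simpa using hx), eq_comm, ENNReal.tsum_eq_zero]
    intro a
    rw [if_neg]
    rintro rfl
    exact hx a.val_lt

theorem unifBelow_two : unifBelow 2 =
    (PMF.uniformOfFintype Bool).map fun b => if b then 1 else 0 := by
  rw [unifBelow_eq_map_val, ← uniformOfFintype_map_equiv
    (show Bool ≃ ZMod 2 from finTwoEquiv.symm), PMF.map_comp]
  congr 1
  funext b
  cases b <;> rfl

/-- A uniform element of a set is statistically close to a uniform element of a large subset. -/
theorem close_uniformOfFintype [Fintype α] [Nonempty α] [Fintype β] [Nonempty β] (g : α → β)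
    (hg : Function.Injective g) {ε : ℝ≥0}
    (h : (Fintype.card β : ℝ) ≤ Fintype.card α + ε * Fintype.card β) :
    Close ε (PMF.uniformOfFintype β) ((PMF.uniformOfFintype α).map g) := by
  classical
  intro f hf
  set C := (Finset.univ \ Finset.univ.image g : Finset β)
  have hcard : Fintype.card α + C.card = Fintype.card β := by
    have h1 := Finset.card_sdiff_add_card_eq_card (Finset.subset_univ (Finset.univ.image g))
    rw [Finset.card_image_of_injective _ hg, Finset.card_univ, Finset.card_univ] at h1
    rw [← h1, add_comm]
  have hC : (C.card : ℝ≥0∞) ≤ ε * Fintype.card β := by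
    have h1 : (C.card : ℝ≥0) ≤ ε * Fintype.card β := by
      rw [← NNReal.coe_le_coe]
      push_cast
      have : (Fintype.card α + C.card : ℝ) = Fintype.card β := by exact_mod_cast hcard
      linarith
    exact_mod_cast h1
  -- The points outside the image of `g` contribute at most 1 each, and by `hC` they form a fraction
  -- of at most `ε`.
  have hsum : ∑ b, f b ≤ ∑ a, f (g a) + C.card := by
    rw [← Finset.sum_sdiff (Finset.subset_univ (Finset.univ.image g)), add_comm,
      Finset.sum_image fun a _ b _ hab => hg hab]
    gcongr
    refine (Finset.sum_le_card_nsmul _ _ 1 fun b _ => hf b).trans ?_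
    simp [C]
  rw [expect_map]
  simp only [expect, tsum_fintype, PMF.uniformOfFintype_apply, ← Finset.mul_sum]
  have h0 : (Fintype.card β : ℝ≥0∞) ≠ 0 := by simp
  calc (Fintype.card β : ℝ≥0∞)⁻¹ * ∑ b, f b
      ≤ (Fintype.card β : ℝ≥0∞)⁻¹ * (∑ a, f (g a) + ε * Fintype.card β) := by
        gcongr
        exact hsum.trans (by gcongr)
    _ = (Fintype.card β : ℝ≥0∞)⁻¹ * ∑ a, f (g a) + ε := by
        rw [mul_add, mul_comm (ε : ℝ≥0∞), ← mul_assoc, ENNReal.inv_mul_cancel h0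
          (ENNReal.natCast_ne_top _), one_mul]
    _ ≤ (Fintype.card α : ℝ≥0∞)⁻¹ * ∑ a, f (g a) + ε := by
        gcongr
        omega

end

/-! ## The Paillier cryptosystem -/

namespace PaillierKey

variable (K : PaillierKey)

instance : NeZero (K.m ^ 2) := ⟨pow_ne_zero _ (NeZero.ne _)⟩

theorem one_lt_m : 1 < K.m :=
  K.p_prime.one_lt.trans_le (Nat.le_mul_of_pos_right _ K.q_prime.pos)

theorem coprime_p_q : K.p.Coprime K.q := (Nat.coprime_primes K.p_prime K.q_prime).2 K.p_ne_q

theorem totient_m : K.m.totient = (K.p - 1) * (K.q - 1) := by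
  rw [m, Nat.totient_mul K.coprime_p_q, Nat.totient_prime K.p_prime, Nat.totient_prime K.q_prime]

theorem coprime_lam : K.lam.Coprime K.m :=
  (Nat.Coprime.coprime_dvd_right (Nat.lcm_dvd (dvd_mul_right _ _) (dvd_mul_left _ _))
    K.coprime).symm

theorem natCast_mul_eq {x y : ℕ} (h : (x : ZMod K.m) = y) :
    ((K.m : ZMod (K.m ^ 2)) * x) = K.m * y := by
  rw [ZMod.natCast_eq_natCast_iff] at h
  have : ((K.m * x : ℕ) : ZMod (K.m ^ 2)) = (K.m * y : ℕ) := by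
    rw [ZMod.natCast_eq_natCast_iff, pow_two]
    exact Nat.ModEq.mul_left' _ h
  simpa using this

/-- If `m` divides `x - y`, then `m²` divides `x ^ m - y ^ m`. Together with `natCast_mul_eq` this
makes a ciphertext independent of the chosen representatives of message and randomness. -/
theorem natCast_pow_eq {x y : ℕ} (h : (x : ZMod K.m) = y) :
    (x : ZMod (K.m ^ 2)) ^ K.m = (y : ZMod (K.m ^ 2)) ^ K.m := by
  have h1 : (K.m : ℤ) ∣ (x : ℤ) - y := by
    rw [← ZMod.intCast_zmod_eq_zero_iff_dvd]
    push_cast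
    rw [h, sub_self]
  have h2 := dvd_sub_pow_of_dvd_sub h1 1
  rw [← sub_eq_zero]
  have h3 : (((x : ℤ) ^ K.m - (y : ℤ) ^ K.m : ℤ) : ZMod (K.m ^ 2)) = 0 := by
    rw [ZMod.intCast_zmod_eq_zero_iff_dvd]
    simpa using h2
  simpa using h3

theorem natCast_mul_self : (K.m : ZMod (K.m ^ 2)) * K.m = 0 := by
  rw [← pow_two, ← Nat.cast_pow, ZMod.natCast_self]

theorem one_add_pow (k : ℕ) : (1 + (K.m : ZMod (K.m ^ 2))) ^ k = 1 + K.m * k := by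
  induction k with
  | zero => simp
  | succ k ih =>
    rw [pow_succ _ k, ih]
    push_cast
    linear_combination (k : ZMod (K.m ^ 2)) * K.natCast_mul_self

/-- Encryption with given randomness. -/
def encWith (μ : ZMod K.m) (r : (ZMod K.m)ˣ) : ZMod (K.m ^ 2) :=
  (1 + (K.m : ZMod (K.m ^ 2))) ^ μ.val * (((r : ZMod K.m).val : ZMod (K.m ^ 2))) ^ K.m

theorem enc_eq (μ : ZMod K.m) :
    K.enc μ = (PMF.uniformOfFintype (ZMod K.m)ˣ).map (K.encWith μ) := by
  change PMF.map _ ((PMF.uniformOfFintype (ZMod K.m)ˣ).map fun r : (ZMod K.m)ˣ => (r : ZMod K.m)) = _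
  rw [PMF.map_comp]
  rfl

theorem encWith_eq {μ : ZMod K.m} {r : (ZMod K.m)ˣ} {x y : ℕ} (hx : (x : ZMod K.m) = μ)
    (hy : (y : ZMod K.m) = r) :
    K.encWith μ r = (1 + K.m * x) * (y : ZMod (K.m ^ 2)) ^ K.m := by
  rw [encWith, one_add_pow, K.natCast_mul_eq (show ((μ.val : ℕ) : ZMod K.m) = x by simp [hx]),
    K.natCast_pow_eq (show (((r : ZMod K.m).val : ℕ) : ZMod K.m) = y by simp [hy])]

theorem encWith_mul (μ ν : ZMod K.m) (r s : (ZMod K.m)ˣ) :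
    K.encWith μ r * K.encWith ν s = K.encWith (μ + ν) (r * s) := by
  rw [K.encWith_eq (μ := μ + ν) (r := r * s) (x := μ.val + ν.val)
    (y := (r : ZMod K.m).val * (s : ZMod K.m).val) (by simp) (by simp), encWith, encWith,
    one_add_pow, one_add_pow]
  push_cast
  rw [mul_pow]
  linear_combination (μ.val * ν.val * ((r : ZMod K.m).val : ZMod (K.m ^ 2)) ^ K.m *
    ((s : ZMod K.m).val : ZMod (K.m ^ 2)) ^ K.m) * K.natCast_mul_self

theorem encWith_zero_one : K.encWith 0 1 = 1 := by
  rw [K.encWith_eq (x := 0) (y := 1) (by simp) (by simp)]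
  simp

theorem encWith_pow (μ : ZMod K.m) (r : (ZMod K.m)ˣ) (k : ℕ) :
    K.encWith μ r ^ k = K.encWith (k * μ) (r ^ k) := by
  induction k with
  | zero => simp [encWith_zero_one]
  | succ k ih =>
    rw [pow_succ _ k, ih, encWith_mul, Nat.cast_succ, add_mul, one_mul, pow_succ r k]

/-- Fermat's little theorem modulo each of the two primes, combined by the Chinese remainder
theorem. -/
theorem unit_pow_lam (r : (ZMod K.m)ˣ) : r ^ K.lam = 1 := by
  have key : ∀ P : ℕ, P.Prime → P ∣ K.m → P - 1 ∣ K.lam →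
      (((r ^ K.lam : (ZMod K.m)ˣ) : ZMod K.m).val : ZMod P) = 1 := by
    intro P hP hPm hlam
    have := Fact.mk hP
    have hcast : ∀ x : ZMod K.m, (x.val : ZMod P) = ZMod.castHom hPm (ZMod P) x := fun x => by
      rw [ZMod.natCast_val, ZMod.castHom_apply]
    rw [hcast, Units.val_pow_eq_pow_val, map_pow]
    obtain ⟨d, hd⟩ := hlam
    rw [hd, pow_mul, ZMod.pow_card_sub_one_eq_one, one_pow]
    exact (r.isUnit.map (ZMod.castHom hPm (ZMod P))).ne_zero
  have hp := key K.p K.p_prime (dvd_mul_right _ _) (Nat.dvd_lcm_left _ _)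
  have hq := key K.q K.q_prime (dvd_mul_left _ _) (Nat.dvd_lcm_right _ _)
  rw [← Nat.cast_one, ZMod.natCast_eq_natCast_iff] at hp hq
  have h := (Nat.modEq_and_modEq_iff_modEq_mul K.coprime_p_q).1 ⟨hp, hq⟩
  rw [← m, ← ZMod.natCast_eq_natCast_iff] at h
  ext
  simpa using h

/-- Raising to the power Λ removes the randomness, as `r ^ Λ = 1` modulo `m` and only this residue
class matters. What remains is `1 + m * (Λ μ mod m)`, which is smaller than `m²`, so `L` reads off
`Λ μ`, and Λ is invertible modulo `m`. -/
theorem dec_encWith (μ : ZMod K.m) (r : (ZMod K.m)ˣ) : K.dec (K.encWith μ r) = μ := by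
  have hm := K.one_lt_m
  have h1 : K.encWith μ r ^ K.lam = ((1 + K.m * (K.lam * μ).val : ℕ) : ZMod (K.m ^ 2)) := by
    rw [encWith_pow, unit_pow_lam, K.encWith_eq (x := (K.lam * μ).val) (y := 1) (by simp) (by simp)]
    simp
  have h2 : 1 + K.m * (K.lam * μ).val < K.m ^ 2 := by
    have := (K.lam * μ).val_lt
    nlinarith
  rw [dec, h1, ZMod.val_natCast_of_lt h2, Nat.add_sub_cancel_left,
    Nat.mul_div_cancel_left _ (by omega), ZMod.natCast_zmod_val, mul_right_comm,
    ZMod.coe_mul_inv_eq_one _ K.coprime_lam, one_mul]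

/-- Decryption recovers the message. Reducing the ciphertext modulo `m` leaves `r ^ m`, and the
`m`-th power map is injective on units because `m` is coprime to the group order (P-1)(Q-1). -/
theorem encWith_injective : Function.Injective fun x : ZMod K.m × (ZMod K.m)ˣ =>
    K.encWith x.1 x.2 := by
  rintro ⟨μ, r⟩ ⟨ν, s⟩ h
  dsimp only at h
  have hμ : μ = ν := by rw [← K.dec_encWith μ r, h, dec_encWith]
  subst hμ
  have hcast : ∀ t : (ZMod K.m)ˣ, ZMod.castHom (dvd_pow_self K.m two_ne_zero) (ZMod K.m)
      (K.encWith μ t) = t ^ K.m := by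
    intro t
    rw [encWith, map_mul, map_pow, map_pow, map_add, map_natCast, map_natCast, map_one,
      ZMod.natCast_self, add_zero, one_pow, one_mul, ZMod.natCast_zmod_val]
  have hpow : r ^ K.m = s ^ K.m := by
    ext
    push_cast
    rw [← hcast, ← hcast, h]
  have hcop : (Nat.card (ZMod K.m)ˣ).Coprime K.m := by
    rw [Nat.card_eq_fintype_card, ZMod.card_units_eq_totient, totient_m]
    exact K.coprime.symm
  rw [(powCoprime hcop).injective hpow]

/-- A bound for the probability that a uniform element is not invertible. -/
def err : ℝ≥0 := (K.p : ℝ≥0)⁻¹ + (K.q : ℝ≥0)⁻¹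

/-- The number of non-units is P + Q - 1. -/
theorem card_le : (K.m : ℝ) ≤ Fintype.card (ZMod K.m)ˣ + K.err * K.m := by
  have hp := K.p_prime.one_lt
  have hq := K.q_prime.one_lt
  rw [ZMod.card_units_eq_totient, totient_m, err, m, Nat.cast_mul, Nat.cast_mul,
    Nat.cast_sub hp.le, Nat.cast_sub hq.le]
  have hp' : (K.p : ℝ) ≠ 0 := by positivity
  have hq' : (K.q : ℝ) ≠ 0 := by positivity
  push_cast
  have : ((K.p : ℝ)⁻¹ + (K.q : ℝ)⁻¹) * (K.p * K.q) = K.q + K.p := by field_simp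
  rw [this]
  linarith

theorem close_units : Close K.err (PMF.uniformOfFintype (ZMod K.m))
    ((PMF.uniformOfFintype (ZMod K.m)ˣ).map fun r : (ZMod K.m)ˣ => (r : ZMod K.m)) :=
  close_uniformOfFintype _ Units.val_injective (by simp only [ZMod.card]; exact K.card_le)

theorem close_encWith : Close K.err (PMF.uniformOfFintype (ZMod (K.m ^ 2)))
    ((PMF.uniformOfFintype (ZMod K.m × (ZMod K.m)ˣ)).map fun x => K.encWith x.1 x.2) :=
  close_uniformOfFintype _ K.encWith_injective (by
    -- There are `m * φ(m)` valid ciphertexts among `m²` elements, the same proportion as that of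
    -- the units modulo `m`; hence the same error.
    have := mul_le_mul_of_nonneg_left K.card_le (Nat.cast_nonneg K.m : (0 : ℝ) ≤ K.m)
    simp only [ZMod.card, Fintype.card_prod]
    push_cast
    linarith)

end PaillierKey

theorem uniformOfFintype_prod {α β : Type} [Fintype α] [Nonempty α] [Fintype β] [Nonempty β] :
    PMF.uniformOfFintype (α × β) = (PMF.uniformOfFintype α).bind fun a =>
      (PMF.uniformOfFintype β).map fun b => (a, b) := by
  classical
  ext ⟨a, b⟩
  rw [PMF.bind_apply, tsum_eq_single a, PMF.map_apply, tsum_eq_single b]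
  · simp [ENNReal.mul_inv]
  · intro b' hb
    rw [if_neg]
    simpa using hb.symm
  · intro a' ha
    rw [PMF.map_apply, ENNReal.tsum_eq_zero.2, mul_zero]
    intro b'
    rw [if_neg]
    simp [ha.symm]

namespace PaillierKey

variable (K : PaillierKey)

/-- A ciphertext of a message masked by a uniform offset, and the offset. -/
def maskedPair (β : ZMod K.m) : PMF (ℕ × ℕ) :=
  (PMF.uniformOfFintype (ZMod K.m)).bind fun o => (PMF.uniformOfFintype (ZMod K.m)ˣ).map fun r =>
    ((K.encWith (β - o) r).val, o.val)

/-- On genuine ciphertexts decryption returns the message `μ`, and for uniform `μ` the offset `o = β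
- μ` is uniform too; in terms of `o` the message is `β - o`. Only the non-ciphertexts cost
something. -/
theorem close_decrypted (β : ZMod K.m) : Close K.err
    ((PMF.uniformOfFintype (ZMod (K.m ^ 2))).map fun c => (c.val, (β - K.dec c).val))
    (K.maskedPair β) := by
  convert K.close_encWith.map fun c => (c.val, (β - K.dec c).val) using 1
  rw [uniformOfFintype_prod, maskedPair]
  conv_lhs => rw [← uniformOfFintype_map_equiv (Equiv.subLeft β)]
  simp only [map_eq_bind, PMF.bind_bind, PMF.pure_bind, dec_encWith, Equiv.subLeft_apply,
    sub_sub_cancel]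

/-- Homomorphic rerandomisation: multiplying by a fresh encryption of `-o` turns the unknown
randomness `r₁` into `r₁ * r`, which is uniform if `r` is a uniform unit. The error arises because
the program draws `r` from all residues modulo `m`. -/
theorem close_ctPair {c s : ℕ} (β : ZMod K.m) (r₀ : (ZMod K.m)ˣ) (hs : s = 0 ∨ s = 1)
    (hc : (c : ZMod (K.m ^ 2)) = K.encWith β r₀) :
    Close K.err (ctPair K.m c s) (K.maskedPair (s * β)) := by
  obtain ⟨r₁, hr⟩ : ∃ r₁ : (ZMod K.m)ˣ,
      (((1 - s) + s * c : ℕ) : ZMod (K.m ^ 2)) = K.encWith (s * β) r₁ := by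
    rcases hs with rfl | rfl
    · exact ⟨1, by simp [encWith_zero_one]⟩
    · exact ⟨r₀, by simp [hc]⟩
  rw [ctPair, maskedPair, unifBelow_eq_map_val, PMF.bind_map]
  refine Close.bind_right _ fun o _ => ?_
  rw [Function.comp_apply]
  convert (K.close_units.map ZMod.val).map fun r => (((1 - s) + s * c) * (1 + K.m * (K.m - o.val)) *
    (r ^ K.m % (K.m * K.m)) % (K.m * K.m), o.val) using 1
  conv_lhs => rw [← uniformOfFintype_map_equiv (Equiv.mulLeft r₁)]
  rw [PMF.map_comp, PMF.map_comp, PMF.map_comp]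
  congr 1
  funext r
  simp only [Function.comp_apply, Equiv.coe_mulLeft, Prod.mk.injEq, and_true]
  have h1 : K.encWith (s * β - o) (r₁ * r) = K.encWith (s * β) r₁ * K.encWith (-o) r := by
    rw [encWith_mul, sub_eq_add_neg]
  have h2 : K.encWith (-o) r = ((1 + K.m * (K.m - o.val) : ℕ) : ZMod (K.m ^ 2)) *
      (((r : ZMod K.m).val ^ K.m : ℕ) : ZMod (K.m ^ 2)) := by
    rw [K.encWith_eq (x := K.m - o.val) (y := (r : ZMod K.m).val)
      (by rw [Nat.cast_sub o.val_lt.le]; simp) (by simp)]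
    push_cast
    rfl
  rw [h1, h2, ← hr, ← mul_assoc, ← Nat.cast_mul, ← Nat.cast_mul, ZMod.val_natCast, pow_two]
  exact (Nat.mul_mod_mod _ _ _).symm

/-- A prime with at least `ℓ ≥ 1` bits is at least `2 ^ (ℓ - 1)`, so each inverse costs a factor 2,
and there are two of them; `ℓ = 0` is trivial. -/
theorem err_le {ℓ : ℕ} (hp : ℓ ≤ K.p.size) (hq : ℓ ≤ K.q.size) :
    K.err ≤ 4 * (2 ^ ℓ)⁻¹ := by
  have key : ∀ {x : ℕ}, 0 < x → ℓ ≤ x.size → (x : ℝ≥0)⁻¹ ≤ 2 * (2 ^ ℓ)⁻¹ := by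
    intro x hx h
    have h1 : 2 ^ ℓ ≤ 2 * x := by
      rcases ℓ with _ | ℓ
      · omega
      · rw [pow_succ, mul_comm]
        exact Nat.mul_le_mul_left _ (Nat.lt_size.1 h)
    have h2 : (2 : ℝ≥0) ^ ℓ ≤ 2 * x := by exact_mod_cast h1
    rw [← div_eq_mul_inv, inv_le_comm₀ (by positivity) (by positivity), inv_div,
      div_le_iff₀ (by positivity), mul_comm]
    exact h2
  calc K.err ≤ 2 * (2 ^ ℓ)⁻¹ + 2 * (2 ^ ℓ)⁻¹ :=
        add_le_add (key K.p_prime.pos hp) (key K.q_prime.pos hq)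
    _ = 4 * (2 ^ ℓ)⁻¹ := by ring

end PaillierKey

/-! ## Output bits -/

theorem bitOf_singleton (x : ℕ) : bitOf [x % 2] = x % 2 := by
  rcases Nat.mod_two_eq_zero_or_one x with h | h <;> simp [bitOf, h]

theorem PPT.prOne_eq (M : PPT) (κ : ℕ) (D : PMF (List ℕ)) :
    M.prOne κ D = (((D.bind (M.run κ)).map bitOf) 1).toReal := by
  rw [PPT.prOne, ← PMF.toOuterMeasure_apply_singleton, PMF.toOuterMeasure_map_apply]
  congr 3
  ext y
  simp [bitOf]

/-- A distribution on `{0, 1}`. -/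
def IsBit (μ : PMF ℕ) : Prop := ∀ x ∈ μ.support, x < 2

theorem isBit_map_bitOf (μ : PMF (List ℕ)) : IsBit (μ.map bitOf) := by
  intro x hx
  obtain ⟨y, _, rfl⟩ := (PMF.mem_support_map_iff _ _ _).1 hx
  unfold bitOf
  split_ifs <;> norm_num

theorem IsBit.bind {α : Type} {μ : PMF α} {f : α → PMF ℕ} (h : ∀ a, IsBit (f a)) :
    IsBit (μ.bind f) := by
  intro x hx
  obtain ⟨a, _, ha⟩ := (PMF.mem_support_bind_iff _ _ _).1 hx
  exact h a x ha

theorem IsBit.apply_zero {μ : PMF ℕ} (h : IsBit μ) : (μ 0).toReal = 1 - (μ 1).toReal := by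
  have h1 := μ.tsum_coe
  rw [tsum_eq_sum (s := Finset.range 2)] at h1
  · have h2 := congrArg ENNReal.toReal h1
    simp only [Finset.sum_range_succ, Finset.sum_range_zero, zero_add] at h2
    rw [ENNReal.toReal_add (μ.apply_ne_top _) (μ.apply_ne_top _), ENNReal.toReal_one] at h2
    linarith
  · intro x hx
    by_contra h0
    exact hx (Finset.mem_range.2 (h x ((μ.mem_support_iff x).2 h0)))

theorem IsBit.bind_apply {μ : PMF ℕ} (h : IsBit μ) (f : ℕ → PMF ℕ) (x : ℕ) :
    ((μ.bind f) x).toReal = (1 - (μ 1).toReal) * (f 0 x).toReal +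
      (μ 1).toReal * (f 1 x).toReal := by
  rw [PMF.bind_apply, tsum_eq_sum (s := Finset.range 2)]
  · simp only [Finset.sum_range_succ, Finset.sum_range_zero, zero_add]
    rw [ENNReal.toReal_add (ENNReal.mul_ne_top (μ.apply_ne_top _) (PMF.apply_ne_top _ _))
      (ENNReal.mul_ne_top (μ.apply_ne_top _) (PMF.apply_ne_top _ _)), ENNReal.toReal_mul,
      ENNReal.toReal_mul, h.apply_zero]
  · intro y hy
    have : μ y = 0 := by
      by_contra h0
      exact hy (Finset.mem_range.2 (h y ((μ.mem_support_iff y).2 h0)))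
    rw [this, zero_mul]

theorem unifBelow_bind_apply {N : ℕ} (hN : 0 < N) (f : ℕ → PMF ℕ) (x : ℕ) :
    (((unifBelow N).bind f) x).toReal = (∑ i ∈ Finset.range N, (f i x).toReal) / N := by
  obtain ⟨h, hu⟩ := unifBelow_eq hN
  rw [hu, PMF.bind_apply, tsum_eq_sum (s := Finset.range N), ENNReal.toReal_sum, Finset.sum_div]
  · refine Finset.sum_congr rfl fun i hi => ?_
    rw [ENNReal.toReal_mul, PMF.uniformOfFinset_apply, if_pos hi]
    simp [div_eq_inv_mul]
  · exact fun i _ => ENNReal.mul_ne_top (PMF.apply_ne_top _ _) (PMF.apply_ne_top _ _)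
  · intro y hy
    rw [PMF.uniformOfFinset_apply, if_neg hy, zero_mul]

/-- Compare a sample from the world `b` with a sample from a random world, for a random index. -/
def parityGame (d : ℕ) (D : ℕ → ℕ → PMF ℕ) (b : ℕ) : PMF ℕ :=
  (unifBelow d).bind fun i => (unifBelow 2).bind fun t => (D b i).bind fun z =>
  (D t i).bind fun w => PMF.pure ((z + w + t) % 2)

/-- For fixed `i`, with `p b` the probability of the bit 1 in world `b`, averaging over `t` makes
the output probability affine in `p b` with slope `p 1 - p 0`. The difference between the two
challenges is thus the square `(p 1 - p 0)²`, and squares do not cancel when averaged over `i`. -/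
theorem parityGame_sub {d : ℕ} (hd : 0 < d) {D : ℕ → ℕ → PMF ℕ} (hD : ∀ b i, IsBit (D b i)) :
    (parityGame d D 1 1).toReal - (parityGame d D 0 1).toReal =
      (∑ i ∈ Finset.range d, ((D 1 i 1).toReal - (D 0 i 1).toReal) ^ 2) / d := by
  rw [parityGame, parityGame, unifBelow_bind_apply hd, unifBelow_bind_apply hd, ← sub_div,
    ← Finset.sum_sub_distrib]
  congr 1
  refine Finset.sum_congr rfl fun i _ => ?_
  rw [unifBelow_bind_apply Nat.two_pos, unifBelow_bind_apply Nat.two_pos]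
  simp only [Finset.sum_range_succ, Finset.sum_range_zero, (hD _ _).bind_apply, PMF.pure_apply]
  norm_num
  ring

/-- A single square is at most the sum of all of them, which is `d` times the advantage. -/
theorem abs_sub_le_sqrt_parityGame {d : ℕ} {D : ℕ → ℕ → PMF ℕ} (hD : ∀ b i, IsBit (D b i))
    {i : ℕ} (hi : i < d) {a : ℝ}
    (ha : |(parityGame d D 1 1).toReal - (parityGame d D 0 1).toReal| ≤ a) :
    |(D 1 i 1).toReal - (D 0 i 1).toReal| ≤ √(d * a) := by
  have hd : 0 < d := by omega
  have hd' : (0 : ℝ) < d := by exact_mod_cast hd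
  refine Real.abs_le_sqrt ?_
  have h1 := (le_abs_self _).trans ha
  rw [parityGame_sub hd hD, div_le_iff₀ hd', mul_comm] at h1
  exact (Finset.single_le_sum (f := fun i => ((D 1 i 1).toReal - (D 0 i 1).toReal) ^ 2)
    (fun i _ => sq_nonneg _) (Finset.mem_range.2 hi)).trans h1

/-! ## Negligible functions -/

theorem Negligible.add {f g : ℕ → ℝ} (hf : Negligible f) (hg : Negligible g) :
    Negligible fun κ => f κ + g κ := SuperpolynomialDecay.add hf hg

theorem Negligible.const_mul {f : ℕ → ℝ} (hf : Negligible f) (c : ℝ) :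
    Negligible fun κ => c * f κ := SuperpolynomialDecay.const_mul hf c

theorem Negligible.polyBounded_mul {f : ℕ → ℝ} (hf : Negligible f) {n : ℕ → ℕ}
    (hn : PolyBounded n) : Negligible fun κ => n κ * f κ := by
  obtain ⟨Q, hQ⟩ := hn
  refine SuperpolynomialDecay.trans_abs_le
    (SuperpolynomialDecay.polynomial_mul hf (Q.map (Nat.castRingHom ℝ))) fun κ => ?_
  rw [abs_mul]
  refine (mul_le_mul_of_nonneg_right ?_ (abs_nonneg _)).trans (abs_mul _ _).ge
  have h1 : ((Q.map (Nat.castRingHom ℝ)).eval (κ : ℝ)) = ((Q.eval κ : ℕ) : ℝ) := by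
    simp
  rw [h1, Nat.abs_cast, Nat.abs_cast]
  exact_mod_cast hQ κ

theorem Negligible.sqrt {f : ℕ → ℝ} (hf : Negligible f) : Negligible fun κ => √(f κ) := by
  intro N
  -- Decay of `f` against the power `2 * N` gives decay of the square root against the power `N`.
  have h := (Real.continuous_sqrt.tendsto 0).comp (hf (2 * N))
  rw [Real.sqrt_zero] at h
  refine h.congr fun κ => ?_
  simp only [Function.comp_apply]
  rw [Real.sqrt_mul (by positivity), mul_comm 2 N, pow_mul, Real.sqrt_sq (by positivity)]

theorem negligible_two_pow_inv : Negligible fun κ => ((2 : ℝ) ^ κ)⁻¹ := by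
  intro N
  have h := tendsto_pow_const_div_const_pow_of_one_lt N (one_lt_two : (1 : ℝ) < 2)
  simpa [div_eq_mul_inv] using h

/-! ## Learning-with-errors samples as distributions of vectors -/

/-- A binary vector as a vector of natural numbers. -/
def bitNat {k : ℕ} (s : Fin k → Bool) : Fin k → ℕ := fun j => if s j then 1 else 0

theorem piPMF_unifBelow_two (k : ℕ) : (piPMF k fun _ => unifBelow 2) =
    (PMF.uniformOfFintype (Fin k → Bool)).map bitNat := by
  rw [uniformOfFintype_pi, unifBelow_two]
  exact piPMF_map _ _

theorem natCast_dotMod (q : ℕ) {k : ℕ} (a : Fin k → ℕ × ℕ) :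
    (dotMod q (List.ofFn a) : ZMod q) = ∑ j, ((a j).1 : ZMod q) * (a j).2 := by
  induction k with
  | zero => simp [dotMod]
  | succ k ih =>
    have h : dotMod q (List.ofFn a) =
        (dotMod q (List.ofFn fun j => a j.succ) + (a 0).1 * (a 0).2) % q := by
      rw [List.ofFn_succ]
      rfl
    rw [h, ZMod.natCast_mod, Nat.cast_add, ih, Fin.sum_univ_succ, Nat.cast_mul, add_comm]

namespace Params

variable (P : Params) (κ : ℕ)

/-- The error distribution on representatives. -/
def errorNat : PMF ℕ := (P.errorDist κ).map ZMod.val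

/-- The matrices and vectors of the two types of LWE samples. -/
abbrev LWEPair (P : Params) (κ : ℕ) : Type :=
  Matrix (Fin (P.d₀ κ)) (Fin (P.n κ)) (ZMod (P.q κ)) × (Fin (P.d₀ κ) → ZMod (P.q κ))

/-- The rows of a matrix and the entries of a vector, as natural numbers. -/
def rows (x : P.LWEPair κ) : Fin (P.d₀ κ) → (Fin (P.n κ) → ℕ) × ℕ :=
  fun i => (fun j => (x.1 i j).val, (x.2 i).val)

/-- LWE samples for a given key (`t = 1`) or uniform samples. -/
def lweGiven (t : ℕ) (s : Fin (P.n κ) → Bool) : PMF (P.LWEPair κ) :=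
  (P.matrixDist κ).bind fun A =>
  if t = 1 then (iid (P.errorDist κ) (P.d₀ κ)).map fun e =>
    (A, A.mulVec (bits (ZMod (P.q κ)) s) + e)
  else (PMF.uniformOfFintype (Fin (P.d₀ κ) → ZMod (P.q κ))).map fun u => (A, u)

theorem matrixDist_eq : P.matrixDist κ =
    piPMF (P.d₀ κ) fun _ => piPMF (P.n κ) fun _ => PMF.uniformOfFintype (ZMod (P.q κ)) := by
  rw [← uniformOfFintype_pi, ← uniformOfFintype_pi]
  rfl

theorem lweRow_one (s : Fin (P.n κ) → Bool) : lweRow (P.q κ) 1 (P.errorNat κ) (bitNat s) =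
    (piPMF (P.n κ) fun _ => PMF.uniformOfFintype (ZMod (P.q κ))).bind fun a =>
      (P.errorDist κ).map fun e => (fun j => (a j).val,
        (∑ j, a j * bits (ZMod (P.q κ)) s j + e).val) := by
  have h : (piPMF (P.n κ) fun j => (unifBelow (P.q κ)).map fun a => (a, bitNat s j)) =
      (piPMF (P.n κ) fun _ => PMF.uniformOfFintype (ZMod (P.q κ))).map fun a j =>
        ((a j).val, bitNat s j) := by
    rw [← piPMF_map (fun _ => PMF.uniformOfFintype (ZMod (P.q κ)))
      fun j a => (ZMod.val a, bitNat s j)]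
    simp only [unifBelow_eq_map_val, PMF.map_comp]
    rfl
  rw [lweRow, h, PMF.bind_map]
  congr 1
  funext a
  simp only [Function.comp_apply, one_mul, Nat.sub_self, zero_mul, add_zero, errorNat,
    map_eq_bind, PMF.bind_bind, PMF.pure_bind, PMF.bind_const]
  congr 1
  funext e
  rw [← ZMod.val_natCast, Nat.cast_add, natCast_dotMod]
  simp [bitNat, bits]

theorem lweRow_zero (s : Fin (P.n κ) → ℕ) (E : PMF ℕ) : lweRow (P.q κ) 0 E s =
    (piPMF (P.n κ) fun _ => PMF.uniformOfFintype (ZMod (P.q κ))).bind fun a =>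
      (PMF.uniformOfFintype (ZMod (P.q κ))).map fun u => (fun j => (a j).val, u.val) := by
  have h : (piPMF (P.n κ) fun j => (unifBelow (P.q κ)).map fun a => (a, s j)) =
      (piPMF (P.n κ) fun _ => PMF.uniformOfFintype (ZMod (P.q κ))).map fun a j =>
        ((a j).val, s j) := by
    rw [← piPMF_map (fun _ => PMF.uniformOfFintype (ZMod (P.q κ)))
      fun j a => (ZMod.val a, s j)]
    simp only [unifBelow_eq_map_val, PMF.map_comp]
    rfl
  rw [lweRow, h, PMF.bind_map]
  congr 1
  funext a
  simp only [Function.comp_apply, zero_mul, zero_add, Nat.sub_zero, one_mul, PMF.bind_const,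
    unifBelow_eq_map_val, PMF.map_comp]
  congr 1
  funext u
  simp [Nat.mod_eq_of_lt u.val_lt]

theorem piPMF_lweRow {t : ℕ} (ht : t < 2) (s : Fin (P.n κ) → Bool) :
    (piPMF (P.d₀ κ) fun _ => lweRow (P.q κ) t (P.errorNat κ) (bitNat s)) =
      (P.lweGiven κ t s).map (P.rows κ) := by
  interval_cases t
  · simp only [lweRow_zero]
    rw [piPMF_bind, lweGiven, PMF.map_bind]
    refine (congrArg (fun μ : PMF (Fin (P.d₀ κ) → Fin (P.n κ) → ZMod (P.q κ)) => PMF.bind μ _)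
      (P.matrixDist_eq κ).symm).trans (congrArg (PMF.bind (P.matrixDist κ)) (funext fun A => ?_))
    rw [piPMF_map (fun _ => PMF.uniformOfFintype (ZMod (P.q κ)))
      fun i u => (fun j => (A i j).val, ZMod.val u), ← uniformOfFintype_pi]
    simp only [zero_ne_one, if_false, PMF.map_comp]
    rfl
  · simp only [lweRow_one]
    rw [piPMF_bind, lweGiven, PMF.map_bind]
    refine (congrArg (fun μ : PMF (Fin (P.d₀ κ) → Fin (P.n κ) → ZMod (P.q κ)) => PMF.bind μ _)
      (P.matrixDist_eq κ).symm).trans (congrArg (PMF.bind (P.matrixDist κ)) (funext fun A => ?_))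
    rw [piPMF_map (fun _ => P.errorDist κ)
      fun i e => (fun j => (A i j).val, (∑ j, A i j * bits (ZMod (P.q κ)) s j + e).val),
      ← iid_eq_piPMF]
    simp only [if_true, PMF.map_comp]
    rfl

/-- The two types of LWE samples. -/
def lwePair (t : ℕ) : PMF (P.LWEPair κ) := (P.secretDist κ).bind (P.lweGiven κ t)

theorem lweReal_eq : P.lweReal κ = (P.lwePair κ 1).map fun x => encMat x.1 ++ encVec x.2 := by
  rw [lwePair, lweReal, PMF.bind_comm, PMF.map_bind]
  congr 1
  funext s
  rw [lweGiven, PMF.map_bind]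
  simp only [if_true, PMF.map_comp]
  rfl

theorem lwePair_zero : P.lwePair κ 0 = (P.matrixDist κ).bind fun A =>
    (PMF.uniformOfFintype (Fin (P.d₀ κ) → ZMod (P.q κ))).map fun u => (A, u) := by
  have h : P.lweGiven κ 0 = fun _ => (P.matrixDist κ).bind fun A =>
      (PMF.uniformOfFintype (Fin (P.d₀ κ) → ZMod (P.q κ))).map fun u => (A, u) := by
    funext s
    simp [lweGiven]
  rw [lwePair, h, PMF.bind_const]

theorem lweUniform_eq : P.lweUniform κ =
    (P.lwePair κ 0).map fun x => encMat x.1 ++ encVec x.2 := by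
  rw [lwePair_zero, lweUniform, PMF.map_bind]
  simp only [PMF.map_comp]
  rfl

/-- Rounding is the floor of `q / p + 1 / 2`, which for natural numbers is the integer quotient of
`2 * q + p` by `2 * p`. -/
theorem scale_eq : P.scale κ = P.scaleNat κ := by
  have hp : (0 : ℚ) < P.p κ := by exact_mod_cast P.p_pos κ
  rw [scale, round_eq, scaleNat, ← Nat.floor_div_eq_div (K := ℚ), ← Int.natCast_floor_eq_floor
    (by positivity)]
  congr 2
  push_cast
  field_simp

theorem viewList_eq (x : P.LWEPair κ) (i : Fin (P.d₀ κ)) (H : List ℕ) :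
    viewList (P.q κ) (P.scaleNat κ) i (P.d₀ κ :: (List.ofFn fun i => P.n κ ::
      List.ofFn (P.rows κ x i).1).flatten) H (fun i => (P.rows κ x i).2) =
      encMat x.1 ++ H ++ encVec (x.2 + Pi.single i (P.scale κ : ZMod (P.q κ))) := by
  have h : (addAt (P.q κ) (P.scaleNat κ) i fun i => (P.rows κ x i).2) =
      fun j => ((x.2 + Pi.single i (P.scale κ : ZMod (P.q κ)) : Fin (P.d₀ κ) → ZMod (P.q κ)) j).val := by
    funext j
    rw [addAt, ← ZMod.val_natCast, scale_eq]
    congr 1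
    by_cases hj : j = i
    · subst hj
      simp [rows]
    · simp [rows, hj, Fin.val_ne_of_ne hj]
  rw [viewList, h]
  rfl

end Params

/-! ## The games -/

theorem bind_comm₃ {α β γ δ : Type} (p : PMF α) (q : PMF β) (r : PMF γ)
    (f : α → β → γ → PMF δ) :
    (p.bind fun a => q.bind fun b => r.bind fun c => f a b c) =
      r.bind fun c => q.bind fun b => p.bind fun a => f a b c := by
  rw [PMF.bind_comm]
  simp only [fun b => PMF.bind_comm p r (fun a c => f a b c)]
  rw [PMF.bind_comm]

section

variable (P : Params) (A : PPT) (κ : ℕ)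

/-- The adversary's output bit on a view with masked ciphertexts from `V` and LWE samples
from `W`. -/
def gameBit (i m : ℕ) (V : ℕ → PMF (ℕ × ℕ))
    (W : (Fin (P.n κ) → Bool) → PMF (Fin (P.d₀ κ) → (Fin (P.n κ) → ℕ) × ℕ)) : PMF ℕ :=
  (P.secretDist κ).bind fun s => (piPMF (P.n κ) fun j => V (bitNat s j)).bind fun v =>
  (W s).bind fun w => (A.run κ (viewList (P.q κ) (P.scaleNat κ) i
    (P.d₀ κ :: (List.ofFn fun i => P.n κ :: List.ofFn (w i).1).flatten)
    (hintList m (P.n κ) v) fun i => (w i).2)).map bitOf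

theorem simBit_eq (E : PMF ℕ) (i m c t : ℕ) : simBit P A κ E i m c t =
    gameBit P A κ i m (ctPair m c) fun s =>
      piPMF (P.d₀ κ) fun _ => lweRow (P.q κ) t E (bitNat s) := by
  rw [simBit, piPMF_unifBelow_two, PMF.bind_map]
  rfl

variable {P A κ} in
theorem close_gameBit {ε δ : ℝ≥0} {i m : ℕ} {V V' : ℕ → PMF (ℕ × ℕ)}
    {W W' : (Fin (P.n κ) → Bool) → PMF (Fin (P.d₀ κ) → (Fin (P.n κ) → ℕ) × ℕ)}
    (hV : ∀ s, s = 0 ∨ s = 1 → Close ε (V s) (V' s)) (hW : ∀ s, Close δ (W s) (W' s)) :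
    Close (P.n κ * ε + δ) (gameBit P A κ i m V W) (gameBit P A κ i m V' W') := by
  refine Close.bind_right _ fun s _ => Close.bind (Close.piPMF fun j => hV _ ?_)
    fun v _ => (hW s).bind_left _
  unfold bitNat
  split_ifs <;> simp

/-- The output bit if the ciphertexts encrypt the masked multiple by `b` of the LWE key, and the
LWE samples are of type `t`. -/
def idealBit (K : PaillierKey) (b t i : ℕ) : PMF ℕ :=
  gameBit P A κ i K.m (fun s => K.maskedPair (s * (b : ZMod K.m)))
    fun s => (P.lweGiven κ t s).map (P.rows κ)

variable {P A κ} in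
theorem close_simBit {K : PaillierKey} {E : PMF ℕ} {c b t i : ℕ} {ε : ℝ≥0}
    (hE : Close ε E (P.errorNat κ)) (r : (ZMod K.m)ˣ)
    (hc : (c : ZMod (K.m ^ 2)) = K.encWith b r) (ht : t < 2) :
    Close (P.n κ * K.err + P.d₀ κ * ε) (simBit P A κ E i K.m c t) (idealBit P A κ K b t i) := by
  rw [simBit_eq]
  refine close_gameBit (fun s hs => K.close_ctPair _ r hs hc) fun s => ?_
  rw [← P.piPMF_lweRow κ ht]
  exact Close.piPMF fun _ => Close.bind_right _ fun a _ => hE.bind_left _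

/-- The game with a fresh key. -/
def world (gen : KeyGen) (b t i : ℕ) : PMF ℕ :=
  (gen κ).bind fun K => idealBit P A κ K b t i

theorem isBit_world (gen : KeyGen) (b t i : ℕ) : IsBit (world P A κ gen b t i) :=
  IsBit.bind fun _ => IsBit.bind fun _ => IsBit.bind fun _ => IsBit.bind fun _ =>
    isBit_map_bitOf _

/-- The independent draws are reordered so that the key `s` comes first. For fixed `s` the
ciphertexts and the LWE samples are independent, and the pairs of ciphertext and offset are
independent over the coordinates. -/
theorem view_eq (gen : KeyGen) (i : Fin (P.d₀ κ)) :
    ((P.view gen κ i).bind (A.run κ)).map bitOf = (gen κ).bind fun K => gameBit P A κ i K.m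
      (fun s => (PMF.uniformOfFintype (ZMod (K.m ^ 2))).map fun c =>
        (c.val, (s * ((1 : ℕ) : ZMod K.m) - K.dec c).val))
      fun s => (P.lweGiven κ 1 s).map (P.rows κ) := by
  have h : ((P.view gen κ i).bind (A.run κ)).map bitOf = (gen κ).bind fun K =>
      (P.matrixDist κ).bind fun M =>
      (PMF.uniformOfFintype (Fin (P.n κ) → ZMod (K.m ^ 2))).bind fun c =>
      (P.secretDist κ).bind fun s => (iid (P.errorDist κ) (P.d₀ κ)).bind fun e =>
      (A.run κ (encMat M ++ K.m :: encVec c ++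
        encVec (Params.bits (ZMod K.m) s - fun j => K.dec (c j)) ++
        encVec (M.mulVec (Params.bits (ZMod (P.q κ)) s) + e +
          Pi.single i (P.scale κ : ZMod (P.q κ))))).map bitOf := by
    rw [PMF.bind_comm]
    simp only [Params.view, Params.setup, Params.query, map_eq_bind, PMF.bind_bind, PMF.pure_bind]
    rfl
  rw [h]
  congr 1
  funext K
  rw [bind_comm₃, gameBit]
  congr 1
  funext s
  rw [piPMF_map (fun _ => PMF.uniformOfFintype (ZMod (K.m ^ 2))) fun j c =>
    (c.val, (bitNat s j * ((1 : ℕ) : ZMod K.m) - K.dec c).val), ← uniformOfFintype_pi, PMF.bind_map]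
  congr 1
  funext c
  simp only [Function.comp_apply, Params.lweGiven, if_true, map_eq_bind, PMF.bind_bind,
    PMF.pure_bind]
  congr 1
  funext M
  congr 1
  funext e
  rw [P.viewList_eq κ (M, M.mulVec (Params.bits (ZMod (P.q κ)) s) + e)]
  have h1 : hintList K.m (P.n κ) (fun j => ((c j).val,
      (bitNat s j * ((1 : ℕ) : ZMod K.m) - K.dec (c j)).val)) =
      K.m :: encVec c ++ encVec (Params.bits (ZMod K.m) s - fun j => K.dec (c j)) := by
    simp [hintList, encVec, bitNat, Params.bits]
  rw [h1]
  simp only [List.append_assoc]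

theorem close_view {gen : KeyGen} {δ : ℝ≥0} (hδ : ∀ K ∈ (gen κ).support, K.err ≤ δ)
    (i : Fin (P.d₀ κ)) : Close (P.n κ * δ) (((P.view gen κ i).bind (A.run κ)).map bitOf)
      (world P A κ gen 1 1 i) := by
  rw [view_eq]
  refine Close.bind_right _ fun K hK => Close.mono (close_gameBit
    (fun s _ => K.close_decrypted _) fun s => Close.refl _) ?_
  rw [add_zero]
  gcongr
  exact hδ K hK

/-- The output bit for a given LWE sample, if the ciphertexts encrypt masked zeros. -/
def idealGiven (K : PaillierKey) (i : ℕ) (x : P.LWEPair κ) : PMF ℕ :=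
  (piPMF (P.n κ) fun _ => K.maskedPair 0).bind fun v =>
  (A.run κ (viewList (P.q κ) (P.scaleNat κ) i (encMat x.1) (hintList K.m (P.n κ) v)
    fun i => (x.2 i).val)).map bitOf

/-- With `b = 0` the ciphertexts encrypt `-o` and carry no information about `s`. The game is then a
randomised function of the LWE pair alone, as a reduction to LWE requires. -/
theorem world_zero (gen : KeyGen) (t i : ℕ) : world P A κ gen 0 t i =
    (P.lwePair κ t).bind fun x => (gen κ).bind fun K => idealGiven P A κ K i x := by
  rw [PMF.bind_comm, world]
  congr 1
  funext K
  rw [Params.lwePair, PMF.bind_bind, idealBit, gameBit]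
  congr 1
  funext s
  simp only [Nat.cast_zero, mul_zero, idealGiven]
  rw [PMF.bind_comm, PMF.bind_map]
  rfl

/-- One-time pad: translation by `Δ u_i` permutes the vectors `u`, so the shifted uniform vector is
uniform for every index. -/
theorem world_zero_zero (gen : KeyGen) (i j : Fin (P.d₀ κ)) :
    world P A κ gen 0 0 i = world P A κ gen 0 0 j := by
  have key : ∀ i : Fin (P.d₀ κ), world P A κ gen 0 0 i = (P.matrixDist κ).bind fun M =>
      (PMF.uniformOfFintype (Fin (P.d₀ κ) → ZMod (P.q κ))).bind fun u => (gen κ).bind fun K =>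
      (piPMF (P.n κ) fun _ => K.maskedPair 0).bind fun v =>
      (A.run κ (encMat M ++ hintList K.m (P.n κ) v ++ encVec u)).map bitOf := by
    intro i
    rw [world_zero, Params.lwePair_zero, PMF.bind_bind]
    congr 1
    funext M
    rw [PMF.bind_map]
    conv_rhs => rw [← uniformOfFintype_map_equiv (Equiv.addRight
      (Pi.single i (P.scale κ : ZMod (P.q κ)) : Fin (P.d₀ κ) → ZMod (P.q κ))), PMF.bind_map]
    congr 1
    funext u
    simp only [Function.comp_apply, idealGiven]
    congr 1
    funext K
    congr 1
    funext v
    exact congrArg (fun l => (A.run κ l).map bitOf) (P.viewList_eq κ (M, u) i _)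
  rw [key, key]

end

/-! ## The reductions win if the games differ -/

/-- `S` simulates the adversary's output bit, with errors from `E`. -/
def Simulates (P : Params) (A E S : PPT) : Prop := ∀ κ i m c t, 0 < m → S.run κ [i, m, c, t] =
  (simBit P A κ ((E.run κ []).map fun y => y.headD 0) i m c t).map fun z => [z]

/-- `X` computes the adversary's output bit for a given LWE sample. -/
def SimulatesGiven (P : Params) (A X : PPT) : Prop :=
  ∀ κ i m a (y : Fin (P.d₀ κ) → ℕ), 0 < m →
    X.run κ (i :: m :: (a ++ P.d₀ κ :: List.ofFn y)) = (givenBit P A κ i m a y).map fun z => [z]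

section

variable {P : Params} {A E S X G : PPT} {κ : ℕ} {gen : KeyGen} {δ ε ρ : ℝ≥0}

theorem close_simulation (hS : Simulates P A E S)
    (hE : Close ε ((E.run κ []).map fun y => y.headD 0) (P.errorNat κ)) {K : PaillierKey}
    (hK : K.err ≤ δ) {c b t i : ℕ} (r : (ZMod K.m)ˣ)
    (hc : (c : ZMod (K.m ^ 2)) = K.encWith b r) (ht : t < 2) (f : ℕ → PMF ℕ) :
    Close (P.n κ * δ + P.d₀ κ * ε) ((S.run κ [i, K.m, c, t]).bind fun z => f (z.headD 0))
      ((idealBit P A κ K b t i).bind f) := by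
  rw [hS _ _ _ _ _ (NeZero.pos K.m), PMF.bind_map]
  refine Close.bind_left (Close.mono (close_simBit hE r hc ht) ?_) _
  gcongr

theorem close_keyGen (hG : Close ρ (G.run κ []) ((gen κ).map fun K => [K.p, K.q]))
    {f : ℕ → PMF ℕ} {g : PaillierKey → PMF ℕ} {ε : ℝ≥0}
    (h : ∀ K ∈ (gen κ).support, Close ε (f K.m) (g K)) :
    Close (ρ + ε) ((G.run κ []).bind fun y => f (modulusOf y)) ((gen κ).bind g) := by
  refine (hG.bind_left _).trans ?_
  rw [PMF.bind_map]
  exact Close.bind_right _ h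

/-- The output of the attack on the Paillier cryptosystem. -/
theorem close_cpaAttack (hS : Simulates P A E S)
    (hE : Close ε ((E.run κ []).map fun y => y.headD 0) (P.errorNat κ))
    (hG : Close ρ (G.run κ []) ((gen κ).map fun K => [K.p, K.q]))
    (hδ : ∀ K ∈ (gen κ).support, K.err ≤ δ) {A₁ M : PPT}
    (hA₁ : ∀ κ m, A₁.run κ [m] = PMF.pure [0, 1, m])
    (hM : ∀ κ c m, M.run κ [c, m] = (unifBelow (P.d₀ κ)).bind fun i => (unifBelow 2).bind fun t =>
      (S.run κ [i, m, c, 1]).bind fun z => (G.run κ []).bind fun y =>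
      (S.run κ [i, modulusOf y, 1 + t * modulusOf y, 1]).bind fun w =>
      PMF.pure [(z.headD 0 + w.headD 0 + t) % 2]) (b : Bool) :
    Close (P.n κ * δ + P.d₀ κ * ε + (ρ + (P.n κ * δ + P.d₀ κ * ε)))
      (((indCPAChallenge gen A₁ κ b).bind (M.run κ)).map bitOf)
      (parityGame (P.d₀ κ) (fun b i => world P A κ gen b 1 i) (if b then 1 else 0)) := by
  set β : ℕ := if b then 1 else 0 with hβ
  have h1 : ((indCPAChallenge gen A₁ κ b).bind (M.run κ)).map bitOf =
      (gen κ).bind fun K => (PMF.uniformOfFintype (ZMod K.m)ˣ).bind fun r =>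
      (unifBelow (P.d₀ κ)).bind fun i => (unifBelow 2).bind fun t =>
      (S.run κ [i, K.m, (K.encWith β r).val, 1]).bind fun z => (G.run κ []).bind fun y =>
      (S.run κ [i, modulusOf y, 1 + t * modulusOf y, 1]).bind fun w =>
      PMF.pure ((z.headD 0 + w.headD 0 + t) % 2) := by
    have hb : ∀ m : ℕ, (if b then [0, 1, m].getD 1 0 else [0, 1, m].getD 0 0) = β := by
      intro m
      cases b <;> rfl
    simp only [indCPAChallenge, hA₁, hb, PaillierKey.enc_eq, map_eq_bind, PMF.bind_bind,
      PMF.pure_bind, List.drop_succ_cons, List.drop_zero, hM, bitOf_singleton]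
  -- A dummy draw of the challenge randomness, removed by `PMF.bind_const`, gives both games the
  -- same shape, so that they can be compared draw by draw. The key of the self-made sample is
  -- fresh, as the two worlds in `parityGame` are independent.
  have h2 : parityGame (P.d₀ κ) (fun b i => world P A κ gen b 1 i) β =
      (gen κ).bind fun K => (PMF.uniformOfFintype (ZMod K.m)ˣ).bind fun _ =>
      (unifBelow (P.d₀ κ)).bind fun i => (unifBelow 2).bind fun t =>
      (idealBit P A κ K β 1 i).bind fun z => (world P A κ gen t 1 i).bind fun w =>
      PMF.pure ((z + w + t) % 2) := by
    simp only [PMF.bind_const]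
    rw [PMF.bind_comm, parityGame]
    congr 1
    funext i
    conv_rhs => rw [PMF.bind_comm]
    simp only [world, PMF.bind_bind]
  rw [h1, h2]
  refine Close.bind_right _ fun K hK => Close.bind_right _ fun r _ =>
    Close.bind_right _ fun i _ => Close.bind_right _ fun t _ => ?_
  refine (close_simulation hS hE (hδ K hK) r (by simp) one_lt_two fun z =>
    (G.run κ []).bind fun y => (S.run κ [i, modulusOf y, 1 + t * modulusOf y, 1]).bind fun w =>
      PMF.pure ((z + w.headD 0 + t) % 2)).trans (Close.bind_right _ fun z _ => ?_)
  rw [world, PMF.bind_bind]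
  refine close_keyGen hG (f := fun m => (S.run κ [i, m, 1 + t * m, 1]).bind fun w =>
      PMF.pure ((z + w.headD 0 + t) % 2)) fun K hK =>
    close_simulation hS hE (hδ K hK) 1 ?_ one_lt_two fun w => PMF.pure ((z + w + t) % 2)
  -- The self-made ciphertext `1 + t * m` is the encryption of `t` with randomness 1;
  -- rerandomisation makes this choice harmless.
  rw [K.encWith_eq (x := t) (y := 1) (by simp) (by simp)]
  push_cast
  ring

theorem close_simulationGiven (hX : SimulatesGiven P A X) {K : PaillierKey} (hK : K.err ≤ δ)
    (i : ℕ) (x : P.LWEPair κ) : Close (P.n κ * δ)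
      ((X.run κ (i :: K.m :: (encMat x.1 ++ encVec x.2))).map fun z => z.headD 0)
      (idealGiven P A κ K i x) := by
  have h : X.run κ (i :: K.m :: (encMat x.1 ++ encVec x.2)) =
      (givenBit P A κ i K.m (encMat x.1) fun j => (x.2 j).val).map fun z => [z] :=
    hX κ i K.m (encMat x.1) (fun j => (x.2 j).val) (NeZero.pos K.m)
  rw [h, PMF.map_comp]
  change Close _ ((givenBit P A κ i K.m (encMat x.1) fun j => (x.2 j).val).map id) _
  rw [PMF.map_id, givenBit, idealGiven]
  refine Close.bind_left (Close.mono (Close.piPMF (ε := K.err) fun _ => ?_) (by gcongr)) _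
  -- For `s = 0` the base ciphertext is not used, and 1 is a valid encryption of 0.
  simpa using K.close_ctPair (c := 1) (s := 0) 0 1 (Or.inl rfl) (by simp [K.encWith_zero_one])

theorem close_keyGenGiven (hX : SimulatesGiven P A X)
    (hG : Close ρ (G.run κ []) ((gen κ).map fun K => [K.p, K.q]))
    (hδ : ∀ K ∈ (gen κ).support, K.err ≤ δ) (i : ℕ) (x : P.LWEPair κ) :
    Close (ρ + P.n κ * δ) ((G.run κ []).bind fun y =>
      (X.run κ (i :: modulusOf y :: (encMat x.1 ++ encVec x.2))).map fun z => z.headD 0)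
      ((gen κ).bind fun K => idealGiven P A κ K i x) := by
  refine (hG.bind_left _).trans ?_
  rw [PMF.bind_map]
  refine Close.bind_right _ fun K hK => ?_
  have h := close_simulationGiven hX (hδ K hK) i x
  exact h

/-- The output of the attack on LWE. -/
theorem close_lweAttack (hS : Simulates P A E S) (hX : SimulatesGiven P A X)
    (hE : Close ε ((E.run κ []).map fun y => y.headD 0) (P.errorNat κ))
    (hG : Close ρ (G.run κ []) ((gen κ).map fun K => [K.p, K.q]))
    (hδ : ∀ K ∈ (gen κ).support, K.err ≤ δ) {M : PPT}
    (hM : ∀ κ x, M.run κ x = (unifBelow (P.d₀ κ)).bind fun i => (unifBelow 2).bind fun t =>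
      (G.run κ []).bind fun y => (X.run κ (i :: modulusOf y :: x)).bind fun z =>
      (G.run κ []).bind fun y => (S.run κ [i, modulusOf y, 1, t]).bind fun w =>
      PMF.pure [(z.headD 0 + w.headD 0 + t) % 2]) (b : ℕ) :
    Close (ρ + P.n κ * δ + (ρ + (P.n κ * δ + P.d₀ κ * ε)))
      ((((P.lwePair κ b).map fun x => encMat x.1 ++ encVec x.2).bind (M.run κ)).map bitOf)
      (parityGame (P.d₀ κ) (fun b i => world P A κ gen 0 b i) b) := by
  have h1 : (((P.lwePair κ b).map fun x => encMat x.1 ++ encVec x.2).bind (M.run κ)).map bitOf =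
      (P.lwePair κ b).bind fun x =>
      (unifBelow (P.d₀ κ)).bind fun i => (unifBelow 2).bind fun t => (G.run κ []).bind fun y =>
      (X.run κ (i :: modulusOf y :: (encMat x.1 ++ encVec x.2))).bind fun z =>
      (G.run κ []).bind fun y => (S.run κ [i, modulusOf y, 1, t]).bind fun w =>
      PMF.pure ((z.headD 0 + w.headD 0 + t) % 2) := by
    simp only [map_eq_bind, PMF.bind_bind, PMF.pure_bind, hM, bitOf_singleton]
  have h2 : parityGame (P.d₀ κ) (fun b i => world P A κ gen 0 b i) b =
      (P.lwePair κ b).bind fun x =>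
      (unifBelow (P.d₀ κ)).bind fun i => (unifBelow 2).bind fun t =>
      ((gen κ).bind fun K => idealGiven P A κ K i x).bind fun z =>
      (world P A κ gen 0 t i).bind fun w => PMF.pure ((z + w + t) % 2) := by
    rw [PMF.bind_comm, parityGame]
    congr 1
    funext i
    conv_rhs => rw [PMF.bind_comm]
    congr 1
    funext t
    rw [world_zero P A κ gen b i, PMF.bind_bind]
  rw [h1, h2]
  refine Close.bind_right _ fun x _ => Close.bind_right _ fun i _ =>
    Close.bind_right _ fun t ht => ?_
  -- The second alternative, `t = 0`, is the default value of `unifBelow` on an empty range.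
  have ht : t < 2 := (mem_support_unifBelow ht).elim id fun h => by omega
  have h3 : ((G.run κ []).bind fun y =>
      (X.run κ (i :: modulusOf y :: (encMat x.1 ++ encVec x.2))).bind fun z =>
      (G.run κ []).bind fun y => (S.run κ [i, modulusOf y, 1, t]).bind fun w =>
      PMF.pure ((z.headD 0 + w.headD 0 + t) % 2)) =
      ((G.run κ []).bind fun y =>
        (X.run κ (i :: modulusOf y :: (encMat x.1 ++ encVec x.2))).map fun z => z.headD 0).bind
      fun z => (G.run κ []).bind fun y => (S.run κ [i, modulusOf y, 1, t]).bind fun w =>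
      PMF.pure ((z + w.headD 0 + t) % 2) := by
    simp only [map_eq_bind, PMF.bind_bind, PMF.pure_bind]
  have h4 : Close (ρ + P.n κ * δ) ((G.run κ []).bind fun y =>
      (X.run κ (i :: modulusOf y :: (encMat x.1 ++ encVec x.2))).map fun z => z.headD 0)
      ((gen κ).bind fun K => idealGiven P A κ K i x) :=
    close_keyGenGiven hX hG hδ i x
  have h5 : ∀ z, Close (ρ + (P.n κ * δ + P.d₀ κ * ε))
      ((G.run κ []).bind fun y => (S.run κ [i, modulusOf y, 1, t]).bind fun w =>
        PMF.pure ((z + w.headD 0 + t) % 2))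
      ((world P A κ gen 0 t i).bind fun w => PMF.pure ((z + w + t) % 2)) := by
    intro z
    rw [world, PMF.bind_bind]
    exact close_keyGen hG (f := fun m => (S.run κ [i, m, 1, t]).bind fun w =>
      PMF.pure ((z + w.headD 0 + t) % 2)) fun K hK =>
      close_simulation hS hE (hδ K hK) 1 (by simp [K.encWith_zero_one]) ht
        fun w => PMF.pure ((z + w + t) % 2)
  rw [h3]
  exact h4.bind fun z _ => h5 z

end

/-! ### Combining the hybrid steps -/

theorem Close.abs_sub_le {α : Type} {ε : ℝ≥0} {μ μ' ν ν' : PMF α} (h : Close ε μ ν)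
    (h' : Close ε μ' ν') (a : α) :
    |(ν a).toReal - (ν' a).toReal| ≤ |(μ a).toReal - (μ' a).toReal| + 2 * ε := by
  have h1 := abs_le.1 (h.abs_sub_apply_le a)
  have h2 := abs_le.1 (h'.abs_sub_apply_le a)
  have h3 := abs_le.1 (le_refl |(μ a).toReal - (μ' a).toReal|)
  rw [abs_le]
  constructor <;> linarith

/-- The distance of two games that differ by the success of an adversary. -/
theorem negligible_sqrt {d : ℕ → ℕ} (hd : PolyBounded d) {a : ℕ → ℝ} (ha : Negligible a)
    {ε : ℕ → ℝ≥0} (hε : Negligible fun κ => (ε κ : ℝ)) :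
    Negligible fun κ => √(d κ * (a κ + 2 * ε κ)) :=
  ((ha.add (hε.const_mul 2)).polyBounded_mul hd).sqrt

theorem SecurePaillier.exists_err_le {gen : KeyGen} (h : SecurePaillier gen) :
    ∃ δ : ℕ → ℝ≥0, Negligible (fun κ => (δ κ : ℝ)) ∧ ∀ κ, ∀ K ∈ (gen κ).support, K.err ≤ δ κ := by
  obtain ⟨ℓ, hℓ, hK⟩ := h.large
  refine ⟨fun κ => 4 * (2 ^ ℓ κ)⁻¹, ?_, fun κ K h => K.err_le (hK κ K h).1 (hK κ K h).2⟩
  simpa using hℓ.const_mul 4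

/-- The view on any index is close to a game that does not depend on the index. -/
theorem exists_negligible_view (P : Params) (hP : P.Efficient) (gen : KeyGen)
    (hgen : gen.Efficient) (hLWE : P.LWESecure) (hPaillier : SecurePaillier gen) (A : PPT) :
    ∃ ε : ℕ → ℝ, Negligible ε ∧ ∀ (κ : ℕ) (i : Fin (P.d₀ κ)),
      |A.prOne κ (P.view gen κ i) - (world P A κ gen 0 0 i 1).toReal| ≤ ε κ := by
  obtain ⟨G, ρ, hρ, hG⟩ := hgen.exists_close
  obtain ⟨E, ε, hε, hE⟩ := hP.error.exists_close
  obtain ⟨δ, hδ, hK⟩ := hPaillier.exists_err_le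
  have hE' : ∀ κ, Close (ε κ) ((E.run κ []).map fun y => y.headD 0) (P.errorNat κ) := by
    intro κ
    have h := (hE κ).map fun y => y.headD 0
    rw [PMF.map_comp] at h
    exact h
  obtain ⟨S, hS⟩ := exists_simBit hP A E
  obtain ⟨X, hX⟩ := exists_givenBit hP A
  obtain ⟨A₁, hA₁⟩ := exists_messages
  obtain ⟨A₂, hA₂⟩ := exists_cpaAttack hP S G
  obtain ⟨B, hB⟩ := exists_lweAttack hP S X G
  have hnδ : Negligible fun κ => (P.n κ * δ κ : ℝ) := hδ.polyBounded_mul hP.n_bound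
  have hdε : Negligible fun κ => (P.d₀ κ * ε κ : ℝ) := hε.polyBounded_mul hP.d₀_bound
  -- In the Paillier attack the challenge brings its own key, so only the self-made sample pays the
  -- error `ρ` of the key sampler.
  set η : ℕ → ℝ≥0 := fun κ => P.n κ * δ κ + P.d₀ κ * ε κ + (ρ κ + (P.n κ * δ κ + P.d₀ κ * ε κ))
    with hη
  -- In the LWE attack both halves use sampled keys, but the challenge contains its own LWE errors,
  -- so `d₀ * ε` occurs only once.
  set θ : ℕ → ℝ≥0 := fun κ => ρ κ + P.n κ * δ κ + (ρ κ + (P.n κ * δ κ + P.d₀ κ * ε κ)) with hθ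
  have hη' : Negligible fun κ => (η κ : ℝ) := by
    simpa [hη] using (hnδ.add hdε).add (hρ.add (hnδ.add hdε))
  have hθ' : Negligible fun κ => (θ κ : ℝ) := by
    simpa [hθ] using (hρ.add hnδ).add (hρ.add (hnδ.add hdε))
  refine ⟨_, (hnδ.add (negligible_sqrt hP.d₀_bound (hPaillier.indCPA A₁ A₂) hη')).add
    (negligible_sqrt hP.d₀_bound (hLWE B) hθ'), fun κ i => ?_⟩
  -- The three hybrid steps: statistical for the real view, IND-CPA from `b = 1` to `b = 0`, and LWE
  -- from `t = 1` to `t = 0`.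
  have h1 := (close_view P A κ (hK κ) i).abs_sub_apply_le 1
  have h2 : |(world P A κ gen 1 1 i 1).toReal - (world P A κ gen 0 1 i 1).toReal| ≤ _ :=
    abs_sub_le_sqrt_parityGame (fun b i => isBit_world P A κ gen b 1 i) i.isLt
      ((close_cpaAttack hS (hE' κ) (hG κ) (hK κ) hA₁ hA₂ true).abs_sub_le
        (close_cpaAttack hS (hE' κ) (hG κ) (hK κ) hA₁ hA₂ false) 1)
  have h3 : |(world P A κ gen 0 1 i 1).toReal - (world P A κ gen 0 0 i 1).toReal| ≤ _ :=
    abs_sub_le_sqrt_parityGame (fun b i => isBit_world P A κ gen 0 b i) i.isLt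
      ((close_lweAttack hS hX (hE' κ) (hG κ) (hK κ) hB 1).abs_sub_le
        (close_lweAttack hS hX (hE' κ) (hG κ) (hK κ) hB 0) 1)
  rw [← Params.lweReal_eq, ← Params.lweUniform_eq, ← PPT.prOne_eq, ← PPT.prOne_eq] at h3
  rw [← PPT.prOne_eq, ← PPT.prOne_eq, abs_sub_comm (A₂.prOne _ _)] at h2
  rw [← PPT.prOne_eq] at h1
  push_cast at h1
  refine (abs_sub_le _ (world P A κ gen 0 1 i 1).toReal _).trans (add_le_add ?_ h3)
  exact (abs_sub_le _ (world P A κ gen 1 1 i 1).toReal _).trans (add_le_add h1 h2)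

end ZipPIR

end

/-! ### The security theorem -/

theorem mainTheorem2 (P : ZipPIR.Params) (hP : P.Efficient)
    (gen : ZipPIR.KeyGen) (hgen : gen.Efficient)
    (hLWE : P.LWESecure) (hPaillier : ZipPIR.SecurePaillier gen)
    (𝒜 : ZipPIR.PPT) :
    ∃ ε : ℕ → ℝ, ZipPIR.Negligible ε ∧
      ∀ (κ : ℕ) (i j : Fin (P.d₀ κ)),
        |𝒜.prOne κ (P.view gen κ i) - 𝒜.prOne κ (P.view gen κ j)| < ε κ := by
  obtain ⟨ε, hε, h⟩ := ZipPIR.exists_negligible_view P hP gen hgen hLWE hPaillier 𝒜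
  -- Both views are within `ε` of the same game; the positive negligible summand makes the
  -- inequality strict.
  refine ⟨fun κ => 2 * ε κ + ((2 : ℝ) ^ κ)⁻¹, (hε.const_mul 2).add ZipPIR.negligible_two_pow_inv,
    fun κ i j => ?_⟩
  have h1 := abs_le.1 (h κ i)
  have h2 := abs_le.1 (h κ j)
  rw [ZipPIR.world_zero_zero P 𝒜 κ gen i j] at h1
  have h3 : (0 : ℝ) < ((2 : ℝ) ^ κ)⁻¹ := by positivity
  rw [abs_lt]
  constructor <;> linarith
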